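/- Let $n\ge 2$ and let $M$ be a $4n$-dimensional almost quaternion-Hermitian manifold: a Riemannian manifold $(M,\langle\cdot,\cdot\rangle)$ with a rank-three subbundle $\mathcal G\subset\operatorname{End}TM$ which locally has an adapted basis, i.e. orthogonal almost complex structures $I,J,K$ spanning $\mathcal G$ with $I^2=J^2=-1$ and $K=IJ=-JI$. Let $\nabla$ be the Levi-Civita connection, put $\omega_A(X,Y)=\langle X,AY\rangle$ for $A=I,J,K$, and let $\Omega$ be the fundamental four-form, locally $\Omega=\omega_I\wedge\omega_I+\omega_J\wedge\omega_J+\omega_K\wedge\omega_K$. For an orthogonal almost complex structure $A$ on a $4n$-dimensional Euclidean space $V$, let $\mathcal W$ be the space of trilinear forms $a$ with $a(x,y,z)=-a(x,z,y)=-a(x,Ay,Az)$. Its Gray–Hervella submodules $\mathcal W_1,\dots,\mathcal W_4$, with $\mathcal W=\mathcal W_1+\mathcal W_2+\mathcal W_3+\mathcal W_4$, are given by: $\mathcal W_1$: $a(x,x,z)=0$; $\mathcal W_2$: the cyclic sum of $a(x,y,z)$ is $0$; $\mathcal W_3$: $a(Ax,Ay,z)=a(x,y,z)$ and $\sum_i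 a(e_i,e_i,z)=0$ for orthonormal bases $(e_i)$; $\mathcal W_4$: $a(x,y,z)=\langle x,y\rangle\theta(z)-\langle x,z\rangle\theta(y)-\langle x,Ay\rangle\theta(Az)+\langle x,Az\rangle\theta(Ay)$ for some $\theta\in V^*$. The statement $\nabla\omega_A\in\mathcal W_i+\mathcal W_j+\cdots$ on an open set means that this holds at each of its points, with the modules taken for $A$. Let $E\cong\mathbb C^{2n}$ and $H\cong\mathbb C^2$ be the standard representations of $\mathrm{Sp}(n)$ and $\mathrm{Sp}(1)$, so that $T_xM\otimes\mathbb C\cong E\otimes H$. Let $\Lambda^r_0E$ be the $\mathrm{Sp}(n)$-invariant complement of $\omega_E\wedge\Lambda^{r-2}E$ in $\Lambda^rE$, where $\omega_E$ is the invariant symplectic form, and let $K$ also denote the irreducible $\mathrm{Sp}(n)$-module with highest weight $(2,1)$, so that $E\otimes\Lambda^2_0E\cong\Lambda^3_0E+K+E$. For each $x$ the $\mathrm{Sp}(n)\mathrm{Sp}(1)$-module $$T_x^*M\otimes\Lambda^2_0E\,S^2H\cong(\Lambda^3_0E+K+E)(S^3H+H)\subset T_x^*M\otimes\Lambda^4T_x^*M\otimes\mathbb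 C$$ is the sum of its components of types $VS^3H=V\otimes S^3H$ and $VH=V\otimes H$, $V=\Lambda^3_0E,K,E$ (for $n=2$ one has $\Lambda^3_0E=0$). A statement $\nabla\Omega\in\cdots$ on an open set means that $\nabla\Omega$ lies, at each of its points, in the indicated sum of these components. Let $U\subset M$ be an open set on which an adapted basis $I,J,K$ is defined. Then on $U$ the following hold. 1. (i) If $\nabla\omega_I\in\mathcal W_1+\mathcal W_4$ and $\nabla\omega_J\in\mathcal W_2+\mathcal W_4$, or if $\nabla\omega_I,\nabla\omega_J,\nabla\omega_K\in\mathcal W_1+\mathcal W_2+\mathcal W_4$, then $\nabla\Omega\in E(S^3H+H)$. 2. (ii) If $\nabla\omega_I,\nabla\omega_J\in\mathcal W_1+\mathcal W_3+\mathcal W_4$, then $\nabla\Omega\in(\Lambda^3_0E+E)(S^3H+H)+KH$. 3. (iii) If $\nabla\omega_I,\nabla\omega_J\in\mathcal W_2+\mathcal W_3+\mathcal W_4$, then $\nabla\Omega\in(K+E)(S^3H+H)+\Lambda^3_0E\,H$. 4. (iv) If $\nabla\omega_I\in\mathcal W_1+\mathcal W_4$ and $\nabla\omega_J\in\mathcal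 W_1+\mathcal C+\mathcal W_4$ with $\mathcal C=\mathcal W_2$ or $\mathcal C=\mathcal W_3$, then $\nabla\Omega\in(\Lambda^3_0E+E)(S^3H+H)$. 5. (v) If $\nabla\omega_I\in\mathcal W_2+\mathcal W_4$ and $\nabla\omega_J\in\mathcal W_2+\mathcal C+\mathcal W_4$ with $\mathcal C=\mathcal W_1$ or $\mathcal C=\mathcal W_3$, then $\nabla\Omega\in(K+E)(S^3H+H)$. 6. (vi) If $\nabla\omega_I,\nabla\omega_J\in\mathcal W_3+\mathcal W_4$, then $\nabla\Omega\in(\Lambda^3_0E+K+E)H$. 7. (vii) If $\nabla\omega_I\in\mathcal W_1$ and $\nabla\omega_J,\nabla\omega_K\in\mathcal W_1+\mathcal W_3$, then $\nabla\Omega\in\Lambda^3_0E(S^3H+H)$. 8. (viii) If $\nabla\omega_I\in\mathcal W_2$ and $\nabla\omega_J,\nabla\omega_K\in\mathcal W_2+\mathcal W_3$, then $\nabla\Omega\in K(S^3H+H)$. 9. (ix) If $\nabla\omega_I,\nabla\omega_J,\nabla\omega_K\in\mathcal W_1+\mathcal W_3$, then $\nabla\Omega\in\Lambda^3_0E(S^3H+H)+(K+E)H$.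 10. (x) If $\nabla\omega_I,\nabla\omega_J,\nabla\omega_K\in\mathcal W_2+\mathcal W_3$, then $\nabla\Omega\in K(S^3H+H)+(\Lambda^3_0E+E)H$. 11. (xi) $\nabla\Omega\in(\Lambda^3_0E+K)(S^3H+H)$ if one of the following holds: (a) $\nabla\omega_I\in\mathcal W_1$, $\nabla\omega_J\in\mathcal W_2+\mathcal W_3$ and $\nabla\omega_K\in\mathcal W_1+\mathcal W_2+\mathcal W_3$; (b) $\nabla\omega_I\in\mathcal W_2$, $\nabla\omega_J\in\mathcal W_1+\mathcal W_3$ and $\nabla\omega_K\in\mathcal W_1+\mathcal W_2+\mathcal W_3$; (c) $\nabla\omega_I\in\mathcal W_1+\mathcal W_2$, $\nabla\omega_J\in\mathcal W_1+\mathcal W_3$ and $\nabla\omega_K\in\mathcal W_2+\mathcal W_3$. 12. (xii) If $\nabla\omega_I\in\mathcal W_1+\mathcal W_3$, $\nabla\omega_J\in\mathcal W_2+\mathcal W_3$ and $\nabla\omega_K\in\mathcal W_1+\mathcal W_2+\mathcal W_3$, then $\nabla\Omega\in(\Lambda^3_0E+K)(S^3H+H)+EH$. Moreover, if $M$ is eight-dimensional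 ($n=2$): 13. (xiii) If $\nabla\omega_I\in\mathcal W_1+\mathcal W_3$, $\nabla\omega_J\in\mathcal W_1+\mathcal W_2+\mathcal W_3$ and $\nabla\omega_K\in\mathcal W_2+\mathcal W_4$, then $\nabla\Omega\in K(S^3H+H)+ES^3H$. 14. (xiv) If $\nabla\omega_I,\nabla\omega_J\in\mathcal W_1+\mathcal W_3$ and $\nabla\omega_K\in\mathcal W_4$, then $\nabla\Omega\in ES^3H$. -/

import Mathlib

open scoped Manifold ContDiff Bundle Topology Quaternion TensorProduct
open Bundle

noncomputable section

namespace AQH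

/-! ### Tensors on a vector space -/

/-- Real-valued covariant tensors of degree `s`. -/
abbrev RForm (V : Type*) [AddCommGroup V] [Module ℝ V] (s : ℕ) :=
  MultilinearMap ℝ (fun _ : Fin s => V) ℝ

/-- Complex-valued covariant tensors of degree `s`, that is, the complexification of
`RForm V s`. -/
abbrev CForm (V : Type*) [AddCommGroup V] [Module ℝ V] (s : ℕ) :=
  MultilinearMap ℝ (fun _ : Fin s => V) ℂ

/-- The contragredient action of a group on complex-valued tensors:
`(g • F)(v₁, …, vₛ) = F (g⁻¹ v₁, …, g⁻¹ vₛ)`. -/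
def tensorRep {G V : Type*} [Group G] [AddCommGroup V] [Module ℝ V]
    (ρ : Representation ℝ G V) (s : ℕ) : Representation ℂ G (CForm V s) where
  toFun g :=
    { toFun := fun F => F.compLinearMap (fun _ => ρ g⁻¹)
      map_add' := fun _ _ => rfl
      map_smul' := fun _ _ => rfl }
  map_one' := by
    ext F v
    simp
  map_mul' g h := by
    ext F v
    change F _ = F _
    simp

theorem tensorRep_apply {G V : Type*} [Group G] [AddCommGroup V] [Module ℝ V]
    (ρ : Representation ℝ G V) (s : ℕ) (g : G) (F : CForm V s) (v : Fin s → V) :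
    tensorRep ρ s g F v = F (fun i => ρ g⁻¹ (v i)) := rfl

/-- The sum of all images of intertwining maps `ρ → σ`. For irreducible `ρ` this is the
`ρ`-isotypic component of `σ`. -/
def isotypic {G W X : Type*} [Group G] [AddCommGroup W] [Module ℂ W] [AddCommGroup X]
    [Module ℂ X] (ρ : Representation ℂ G W) (σ : Representation ℂ G X) : Submodule ℂ X :=
  ⨆ f : Representation.IntertwiningMap ρ σ, LinearMap.range f.toLinearMap

/-- `F` is complex multilinear with respect to the complex structure `C` on `V`. -/
def IsComplexForm {V : Type*} [AddCommGroup V] [Module ℝ V] (C : Module.End ℝ V) {s : ℕ}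
    (F : CForm V s) : Prop :=
  ∀ (i : Fin s) (v : Fin s → V), F (Function.update v i (C (v i))) = Complex.I * F v

theorem IsComplexForm.tensorRep {G V : Type*} [Group G] [AddCommGroup V] [Module ℝ V]
    {ρ : Representation ℝ G V} {C : Module.End ℝ V} (hC : ∀ g v, ρ g (C v) = C (ρ g v))
    {s : ℕ} {F : CForm V s} (hF : IsComplexForm C F) (g : G) :
    IsComplexForm C (AQH.tensorRep ρ s g F) := by
  intro i v
  rw [tensorRep_apply, tensorRep_apply, ← hF i]
  congr 1
  ext j
  by_cases h : j = i
  · subst h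
    simp [hC]
  · simp [h]

/-! ### The `Sp(1)`-modules `SᵏH` -/

/-- `Sp(1)`, the group of unit quaternions. -/
abbrev Sp1 := unitary ℍ[ℝ]

/-- The action `q · ζ = ζ q̄` of `Sp(1)` on `H = ℍ`. -/
def repH : Representation ℝ Sp1 ℍ[ℝ] where
  toFun q := LinearMap.mulRight ℝ (star (q : ℍ[ℝ]))
  map_one' := by
    ext1 ζ
    simp
  map_mul' q r := by
    ext1 ζ
    simp [mul_assoc]

/-- The `Sp(1)`-invariant complex structure of `H = ℍ`, left multiplication by `i`. -/
def leftI : Module.End ℝ ℍ[ℝ] := LinearMap.mulLeft ℝ (⟨0, 1, 0, 0⟩ : ℍ[ℝ])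

/-- `SᵏH`, realised as the symmetric complex `k`-linear forms on `H ≅ ℂ²`
(recall `H ≅ H*` as `Sp(1)`-modules). -/
def SymH (k : ℕ) : Subrepresentation (tensorRep repH k) where
  toSubmodule :=
    { carrier := {F | IsComplexForm leftI F ∧
        ∀ (p : Equiv.Perm (Fin k)) (v : Fin k → ℍ[ℝ]), F (fun i => v (p i)) = F v}
      zero_mem' := by simp [IsComplexForm]
      add_mem' := by
        rintro F G ⟨h1, h2⟩ ⟨h3, h4⟩
        refine ⟨fun i v => ?_, fun p v => ?_⟩
        · simp only [add_apply, h1 i v, h3 i v]; ring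
        · simp only [add_apply, h2 p v, h4 p v]
      smul_mem' := by
        rintro c F ⟨h1, h2⟩
        refine ⟨fun i v => ?_, fun p v => ?_⟩
        · simp only [smul_apply, h1 i v, smul_eq_mul]; ring
        · simp only [smul_apply, h2 p v] }
  apply_mem_toSubmodule := by
    rintro g F ⟨h1, h2⟩
    refine ⟨h1.tensorRep (fun q v => ?_) g, fun p v => ?_⟩
    · exact mul_assoc _ _ _
    · simp only [tensorRep_apply]
      exact h2 p (fun i => repH g⁻¹ (v i))

/-! ### Adapted bases on a Euclidean vector space -/

/-- Three orthogonal endomorphisms of a Euclidean vector space satisfying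
`I² = J² = -1` and `K = IJ = -JI`. -/
structure Triple (V : Type*) [NormedAddCommGroup V] [InnerProductSpace ℝ V] where
  /-- the first almost complex structure -/
  I : Module.End ℝ V
  /-- the second almost complex structure -/
  J : Module.End ℝ V
  /-- the third almost complex structure -/
  K : Module.End ℝ V
  I_sq : I * I = -1
  J_sq : J * J = -1
  IJ : I * J = K
  JI : J * I = -K
  inner_I : ∀ u v, inner ℝ (I u) (I v) = inner ℝ u v
  inner_J : ∀ u v, inner ℝ (J u) (J v) = inner ℝ u v
  inner_K : ∀ u v, inner ℝ (K u) (K v) = inner ℝ u v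

namespace Triple

variable {V : Type*} [NormedAddCommGroup V] [InnerProductSpace ℝ V] (T : Triple V)

/-- `I, J, K` as a quaternionic basis in the algebra of endomorphisms. -/
def basis : QuaternionAlgebra.Basis (Module.End ℝ V) (-1 : ℝ) 0 (-1) where
  i := T.I
  j := T.J
  k := T.K
  i_mul_i := by rw [T.I_sq]; simp
  j_mul_j := by rw [T.J_sq]; simp
  i_mul_j := T.IJ
  j_mul_i := by rw [T.JI]; simp

/-- `Sp(n)`: the linear isometries commuting with `I`, `J` (hence with `K`). -/
def SpN : Subgroup (V ≃ₗᵢ[ℝ] V) where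
  carrier := {A | (∀ v, A (T.I v) = T.I (A v)) ∧ ∀ v, A (T.J v) = T.J (A v)}
  one_mem' := by simp
  mul_mem' := by
    rintro A B ⟨h1, h2⟩ ⟨h3, h4⟩
    simp [h1, h2, h3, h4]
  inv_mem' := by
    rintro A ⟨h1, h2⟩
    refine ⟨fun v => ?_, fun v => ?_⟩
    · apply A.injective
      rw [h1]
      simp [LinearIsometryEquiv.inv_def]
    · apply A.injective
      rw [h2]
      simp [LinearIsometryEquiv.inv_def]

/-- The standard real representation of `Sp(n)` on `V ≅ ℍⁿ`. -/
def repN : Representation ℝ T.SpN V where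
  toFun A := (A : V ≃ₗᵢ[ℝ] V).toLinearEquiv.toLinearMap
  map_one' := rfl
  map_mul' _ _ := rfl

theorem repN_apply (A : T.SpN) (v : V) : T.repN A v = (A : V ≃ₗᵢ[ℝ] V) v := rfl

theorem repN_I (A : T.SpN) (v : V) : T.repN A (T.I v) = T.I (T.repN A v) := A.2.1 v

theorem repN_J (A : T.SpN) (v : V) : T.repN A (T.J v) = T.J (T.repN A v) := A.2.2 v

/-- The action of a quaternion `a + bi + cj + dk` on `V` as `a + bI + cJ + dK`. -/
def quat : ℍ[ℝ] →ₐ[ℝ] Module.End ℝ V := T.basis.liftHom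

theorem quat_apply (q : ℍ[ℝ]) (v : V) :
    T.quat q v = q.re • v + q.imI • T.I v + q.imJ • T.J v + q.imK • T.K v := by
  change T.basis.lift q v = _
  simp [QuaternionAlgebra.Basis.lift, basis, Module.algebraMap_end_apply]

/-- The representation of `Sp(n) × Sp(1)` on `V`; its image is the group `Sp(n)Sp(1)`. -/
def repV : Representation ℝ (T.SpN × Sp1) V where
  toFun g := T.repN g.1 * T.quat (g.2 : ℍ[ℝ])
  map_one' := by simp
  map_mul' g h := by
    have key : T.quat (g.2 : ℍ[ℝ]) * T.repN h.1 = T.repN h.1 * T.quat (g.2 : ℍ[ℝ]) := by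
      ext v
      have hK : T.repN h.1 (T.K v) = T.K (T.repN h.1 v) := by
        rw [← T.IJ]
        simp [repN_I, repN_J]
      simp [quat_apply, repN_I, repN_J, hK]
    simp only [Prod.fst_mul, Prod.snd_mul, map_mul, Submonoid.coe_mul]
    rw [mul_assoc, ← mul_assoc (T.repN h.1), ← key]
    simp only [mul_assoc]

/-! ### The `Sp(n)`-modules `Λʳ₀E`, `K`, `E`

As an `Sp(n)`-module, `E ≅ ℂ²ⁿ` is `V ≅ ℍⁿ` with the complex structure `I`; its invariant complex
symplectic form is, up to scale, dual to `∑ᵢ eᵢ ⊗ J eᵢ` for any orthonormal basis `eᵢ` of `V`.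
Since `E ≅ E*`, the modules are realised as spaces of complex multilinear forms on `(V, I)`. -/

/-- Contraction of the first two arguments with the complex symplectic form of `E` vanishes. -/
def TraceFree {s : ℕ} (F : CForm V (s + 2)) : Prop :=
  ∀ (e : OrthonormalBasis (Fin (Module.finrank ℝ V)) ℝ V) (w : Fin s → V),
    ∑ i, F (Matrix.vecCons (e i) (Matrix.vecCons (T.J (e i)) w)) = 0

theorem TraceFree.tensorRep {s : ℕ} {F : CForm V (s + 2)} (hF : T.TraceFree F) (g : T.SpN) :
    T.TraceFree (AQH.tensorRep T.repN (s + 2) g F) := by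
  intro e w
  have h := hF (e.map ((g⁻¹ : T.SpN) : V ≃ₗᵢ[ℝ] V)) (fun i => T.repN g⁻¹ (w i))
  rw [← h]
  refine Finset.sum_congr rfl fun i _ => ?_
  rw [tensorRep_apply]
  congr 1
  ext j
  refine Fin.cases ?_ (fun j => Fin.cases ?_ (fun j => ?_) j) j
  · simp [repN_apply]
  · simp only [Matrix.cons_val_succ, Matrix.cons_val_zero, repN_J]
    simp [repN_apply]
  · simp

/-- `E`, as the complex linear forms on `(V, I)`. -/
def modE : Subrepresentation (tensorRep T.repN 1) where
  toSubmodule :=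
    { carrier := {F | IsComplexForm T.I F}
      zero_mem' := by simp [IsComplexForm]
      add_mem' := by
        intro F G h1 h2 i v
        simp only [add_apply, h1 i v, h2 i v]; ring
      smul_mem' := by
        intro c F h1 i v
        simp only [smul_apply, h1 i v, smul_eq_mul]; ring }
  apply_mem_toSubmodule := by
    intro g F h1
    exact IsComplexForm.tensorRep T.repN_I h1 g

/-- `Λʳ₀E` with `r = s + 2`: the alternating complex forms on `(V, I)` whose contraction with
the complex symplectic form vanishes. -/
def modLambda (s : ℕ) : Subrepresentation (tensorRep T.repN (s + 2)) where
  toSubmodule :=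
    { carrier := {F | IsComplexForm T.I F ∧
        (∀ (v : Fin (s + 2) → V) (i j : Fin (s + 2)), v i = v j → i ≠ j → F v = 0) ∧
        T.TraceFree F}
      zero_mem' := by simp [IsComplexForm, TraceFree]
      add_mem' := by
        rintro F G ⟨h1, h2, h3⟩ ⟨k1, k2, k3⟩
        refine ⟨fun i v => ?_, fun v i j h h' => ?_, fun e w => ?_⟩
        · simp only [add_apply, h1 i v, k1 i v]; ring
        · simp only [add_apply, h2 v i j h h', k2 v i j h h', add_zero]
        · simp only [add_apply, Finset.sum_add_distrib, h3 e w, k3 e w, add_zero]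
      smul_mem' := by
        rintro c F ⟨h1, h2, h3⟩
        refine ⟨fun i v => ?_, fun v i j h h' => ?_, fun e w => ?_⟩
        · simp only [smul_apply, h1 i v, smul_eq_mul]; ring
        · simp only [smul_apply, h2 v i j h h', smul_zero]
        · simp only [smul_apply, ← Finset.smul_sum, h3 e w, smul_zero] }
  apply_mem_toSubmodule := by
    rintro g F ⟨h1, h2, h3⟩
    refine ⟨h1.tensorRep T.repN_I g, fun v i j h h' => ?_, h3.tensorRep T g⟩
    rw [tensorRep_apply]
    exact h2 _ i j (by rw [h]) h'

/-- `K = V⁽²¹⁾`: the kernel, inside `E ⊗ Λ²₀E`, of the projections to `Λ³E` and to `E`. -/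
def modK : Subrepresentation (tensorRep T.repN 3) where
  toSubmodule :=
    { carrier := {F | IsComplexForm T.I F ∧
        (∀ x y z, F ![x, y, z] = -F ![x, z, y]) ∧
        (∀ (e : OrthonormalBasis (Fin (Module.finrank ℝ V)) ℝ V) (x : V),
          ∑ i, F ![x, e i, T.J (e i)] = 0) ∧
        (∀ x y z, F ![x, y, z] + F ![y, z, x] + F ![z, x, y] = 0) ∧
        T.TraceFree (s := 1) F}
      zero_mem' := by simp [IsComplexForm, TraceFree]
      add_mem' := by
        rintro F G ⟨h1, h2, h3, h4, h5⟩ ⟨k1, k2, k3, k4, k5⟩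
        refine ⟨fun i v => ?_, fun x y z => ?_, fun e x => ?_, fun x y z => ?_, fun e w => ?_⟩
        · simp only [add_apply, h1 i v, k1 i v]; ring
        · simp only [add_apply, h2 x y z, k2 x y z]; ring
        · simp only [add_apply, Finset.sum_add_distrib, h3 e x, k3 e x, add_zero]
        · simp only [add_apply]
          linear_combination h4 x y z + k4 x y z
        · simp only [add_apply, Finset.sum_add_distrib, h5 e w, k5 e w, add_zero]
      smul_mem' := by
        rintro c F ⟨h1, h2, h3, h4, h5⟩
        refine ⟨fun i v => ?_, fun x y z => ?_, fun e x => ?_, fun x y z => ?_, fun e w => ?_⟩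
        · simp only [smul_apply, h1 i v, smul_eq_mul]; ring
        · simp only [smul_apply, h2 x y z, smul_neg]
        · simp only [smul_apply, ← Finset.smul_sum, h3 e x, smul_zero]
        · simp only [smul_apply, smul_eq_mul]
          linear_combination c * h4 x y z
        · simp only [smul_apply, ← Finset.smul_sum, h5 e w, smul_zero] }
  apply_mem_toSubmodule := by
    rintro g F ⟨h1, h2, h3, h4, h5⟩
    have key : ∀ x y z, tensorRep T.repN 3 g F ![x, y, z] =
        F ![T.repN g⁻¹ x, T.repN g⁻¹ y, T.repN g⁻¹ z] := by
      intro x y z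
      rw [tensorRep_apply]
      congr 1
      ext j
      fin_cases j <;> rfl
    refine ⟨h1.tensorRep T.repN_I g, fun x y z => ?_, fun e x => ?_, fun x y z => ?_,
      h5.tensorRep T g⟩
    · rw [key, key, h2]
    · rw [← h3 (e.map ((g⁻¹ : T.SpN) : V ≃ₗᵢ[ℝ] V)) (T.repN g⁻¹ x)]
      refine Finset.sum_congr rfl fun i _ => ?_
      rw [key, repN_J]
      rfl
    · rw [key, key, key, h4]

/-- The `W ⊗ S`-component of the complex-valued tensors of degree `s` on `V`, for an
`Sp(n)`-module `W` and an `Sp(1)`-module `S`. -/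
def component {W S : Type*} [AddCommGroup W] [Module ℂ W] [AddCommGroup S] [Module ℂ S]
    (σ : Representation ℂ T.SpN W) (τ : Representation ℂ Sp1 S) (s : ℕ) :
    Submodule ℂ (CForm V s) :=
  isotypic (Representation.tprod (σ.comp (MonoidHom.fst T.SpN Sp1))
    (τ.comp (MonoidHom.snd T.SpN Sp1))) (tensorRep T.repV s)

/-- The submodule `Λ²₀E S²H` of `Λ⁴V* ⊗ ℂ`. -/
def lambdaTwoSTwo : Submodule ℂ (CForm V 4) :=
  T.component (T.modLambda 0).toRepresentation (SymH 2).toRepresentation 4 ⊓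
    { carrier := {F | ∀ (v : Fin 4 → V) (i j : Fin 4), v i = v j → i ≠ j → F v = 0}
      zero_mem' := by simp
      add_mem' := by
        intro F G h k v i j e ne
        simp only [add_apply, h v i j e ne, k v i j e ne, add_zero]
      smul_mem' := by
        intro c F h v i j e ne
        simp only [smul_apply, h v i j e ne, smul_zero] }

/-- The submodule `V* ⊗ Λ²₀E S²H` of `V* ⊗ Λ⁴V* ⊗ ℂ`. -/
def torsionSpace : Submodule ℂ (CForm V 5) where
  carrier := {F | ∀ x, F.curryLeft x ∈ T.lambdaTwoSTwo}
  zero_mem' := fun x => by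
    have : (0 : CForm V 5).curryLeft x = 0 := rfl
    rw [this]; exact Submodule.zero_mem _
  add_mem' := fun {F G} h k x => by
    have : (F + G).curryLeft x = F.curryLeft x + G.curryLeft x := rfl
    rw [this]; exact Submodule.add_mem _ (h x) (k x)
  smul_mem' := fun c F h x => by
    have : (c • F).curryLeft x = c • F.curryLeft x := rfl
    rw [this]; exact Submodule.smul_mem _ c (h x)

end Triple

/-- Labels of the `Sp(n)`-modules `Λ³₀E`, `K`, `E`. -/
inductive EType
  | Λ₃
  | K
  | E

/-- Labels of the `Sp(1)`-modules `S³H`, `H`. -/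
inductive HType
  | S₃
  | H

/-- The exponent `k` in `SᵏH`. -/
def HType.deg : HType → ℕ
  | .S₃ => 3
  | .H => 1

/-- The six submodules `(Λ³₀E, K, E) ⊗ (S³H, H)` of
`V* ⊗ Λ²₀E S²H = (Λ³₀E + K + E)(S³H + H)`. -/
def Triple.quatModule {V : Type*} [NormedAddCommGroup V] [InnerProductSpace ℝ V] (T : Triple V) :
    EType × HType → Submodule ℂ (CForm V 5)
  | (.Λ₃, h) =>
      T.component (T.modLambda 1).toRepresentation (SymH h.deg).toRepresentation 5 ⊓ T.torsionSpace
  | (.K, h) =>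
      T.component T.modK.toRepresentation (SymH h.deg).toRepresentation 5 ⊓ T.torsionSpace
  | (.E, h) =>
      T.component T.modE.toRepresentation (SymH h.deg).toRepresentation 5 ⊓ T.torsionSpace

/-- The sum of the modules with labels in `C`. -/
def Triple.quatClass {V : Type*} [NormedAddCommGroup V] [InnerProductSpace ℝ V] (T : Triple V)
    (C : Set (EType × HType)) : Submodule ℂ (CForm V 5) :=
  ⨆ c ∈ C, T.quatModule c

/-! ### The Gray–Hervella modules -/

/-- Labels of the four Gray–Hervella modules. -/
inductive GHType
  | W₁
  | W₂
  | W₃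
  | W₄

section GrayHervella

variable {V : Type*} [NormedAddCommGroup V] [InnerProductSpace ℝ V] (A : Module.End ℝ V)

/-- The tensors with the symmetries of the covariant derivative of the Kähler form of the
almost complex structure `A`. -/
def ghSpace : Submodule ℝ (RForm V 3) where
  carrier := {a | (∀ x y z, a ![x, y, z] = -a ![x, z, y]) ∧
    ∀ x y z, a ![x, A y, A z] = -a ![x, y, z]}
  zero_mem' := by simp
  add_mem' := by
    rintro a b ⟨h1, h2⟩ ⟨k1, k2⟩
    refine ⟨fun x y z => ?_, fun x y z => ?_⟩
    · simp only [add_apply, h1 x y z, k1 x y z]; ring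
    · simp only [add_apply, h2 x y z, k2 x y z]; ring
  smul_mem' := by
    rintro c a ⟨h1, h2⟩
    refine ⟨fun x y z => ?_, fun x y z => ?_⟩
    · simp only [smul_apply, h1 x y z, smul_neg]
    · simp only [smul_apply, h2 x y z, smul_neg]

/-- `𝒲₁`: `a(x, x, z) = 0`. -/
def ghOne : Submodule ℝ (RForm V 3) :=
  ghSpace A ⊓
    { carrier := {a | ∀ x z, a ![x, x, z] = 0}
      zero_mem' := by simp
      add_mem' := by
        intro a b h k x z
        simp only [add_apply, h x z, k x z, add_zero]
      smul_mem' := by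
        intro c a h x z
        simp only [smul_apply, h x z, smul_zero] }

/-- `𝒲₂`: the cyclic sum of `a` vanishes. -/
def ghTwo : Submodule ℝ (RForm V 3) :=
  ghSpace A ⊓
    { carrier := {a | ∀ x y z, a ![x, y, z] + a ![y, z, x] + a ![z, x, y] = 0}
      zero_mem' := by simp
      add_mem' := by
        intro a b h k x y z
        simp only [add_apply]
        linear_combination h x y z + k x y z
      smul_mem' := by
        intro c a h x y z
        simp only [smul_apply, smul_eq_mul]
        linear_combination c * h x y z }

/-- `𝒲₃`: `a(Ax, Ay, z) = a(x, y, z)` and the trace of `a` over the first two arguments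
vanishes. -/
def ghThree : Submodule ℝ (RForm V 3) :=
  ghSpace A ⊓
    { carrier := {a | (∀ x y z, a ![A x, A y, z] = a ![x, y, z]) ∧
        ∀ (e : OrthonormalBasis (Fin (Module.finrank ℝ V)) ℝ V) (z : V),
          ∑ i, a ![e i, e i, z] = 0}
      zero_mem' := by simp
      add_mem' := by
        rintro a b ⟨h1, h2⟩ ⟨k1, k2⟩
        refine ⟨fun x y z => ?_, fun e z => ?_⟩
        · simp only [add_apply, h1 x y z, k1 x y z]
        · simp only [add_apply, Finset.sum_add_distrib, h2 e z, k2 e z, add_zero]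
      smul_mem' := by
        rintro c a ⟨h1, h2⟩
        refine ⟨fun x y z => ?_, fun e z => ?_⟩
        · simp only [smul_apply, h1 x y z]
        · simp only [smul_apply, ← Finset.smul_sum, h2 e z, smul_zero] }

/-- `𝒲₄`: there is a one-form `θ` with
`a(x,y,z) = ⟨x,y⟩θ(z) - ⟨x,z⟩θ(y) - ⟨x,Ay⟩θ(Az) + ⟨x,Az⟩θ(Ay)`. -/
def ghFour : Submodule ℝ (RForm V 3) :=
  ghSpace A ⊓
    { carrier := {a | ∃ θ : V →ₗ[ℝ] ℝ, ∀ x y z, a ![x, y, z] =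
        inner ℝ x y * θ z - inner ℝ x z * θ y - inner ℝ x (A y) * θ (A z)
          + inner ℝ x (A z) * θ (A y)}
      zero_mem' := ⟨0, by simp⟩
      add_mem' := by
        rintro a b ⟨θ, h⟩ ⟨η, k⟩
        refine ⟨θ + η, fun x y z => ?_⟩
        simp only [add_apply, LinearMap.add_apply, h x y z, k x y z]; ring
      smul_mem' := by
        rintro c a ⟨θ, h⟩
        refine ⟨c • θ, fun x y z => ?_⟩
        simp only [smul_apply, LinearMap.smul_apply, smul_eq_mul, h x y z]; ring }

/-- The four Gray–Hervella modules of the almost complex structure `A`. -/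
def ghModule : GHType → Submodule ℝ (RForm V 3)
  | .W₁ => ghOne A
  | .W₂ => ghTwo A
  | .W₃ => ghThree A
  | .W₄ => ghFour A

/-- The sum of the Gray–Hervella modules with labels in `C`. -/
def ghClass (C : Set GHType) : Submodule ℝ (RForm V 3) := ⨆ c ∈ C, ghModule A c

end GrayHervella

/-! ### The fundamental form on a Euclidean vector space -/

/-- The Kähler form `ω_A(u, v) = ⟨u, A v⟩`. -/
def kaehlerForm {V : Type*} [NormedAddCommGroup V] [InnerProductSpace ℝ V]
    (A : Module.End ℝ V) (v : Fin 2 → V) : ℝ :=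
  inner ℝ (v 0) (A (v 1))

/-- The wedge product of two two-forms. -/
def wedge {V : Type*} (α β : (Fin 2 → V) → ℝ) (v : Fin 4 → V) : ℝ :=
  α ![v 0, v 1] * β ![v 2, v 3] - α ![v 0, v 2] * β ![v 1, v 3] + α ![v 0, v 3] * β ![v 1, v 2]
    + α ![v 1, v 2] * β ![v 0, v 3] - α ![v 1, v 3] * β ![v 0, v 2]
    + α ![v 2, v 3] * β ![v 0, v 1]

/-- `ω_I ∧ ω_I + ω_J ∧ ω_J + ω_K ∧ ω_K`. -/
def Triple.fourForm {V : Type*} [NormedAddCommGroup V] [InnerProductSpace ℝ V] (T : Triple V)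
    (v : Fin 4 → V) : ℝ :=
  wedge (kaehlerForm T.I) (kaehlerForm T.I) v + wedge (kaehlerForm T.J) (kaehlerForm T.J) v
    + wedge (kaehlerForm T.K) (kaehlerForm T.K) v

/-- The four-form depends only on the span of the adapted basis. -/
theorem Triple.fourForm_eq_of_span_eq {V : Type*} [NormedAddCommGroup V] [InnerProductSpace ℝ V]
    (T T' : Triple V)
    (h : Submodule.span ℝ {T.I, T.J, T.K} = Submodule.span ℝ {T'.I, T'.J, T'.K}) :
    T'.fourForm = T.fourForm := by
  ext v
  rcases subsingleton_or_nontrivial V with hV | hV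
  · have h0 : ∀ i, v i = 0 := fun i => Subsingleton.elim _ _
    simp [fourForm, wedge, kaehlerForm, h0]
  · have mem : ∀ X ∈ ({T'.I, T'.J, T'.K} : Set (Module.End ℝ V)),
        ∃ a b c : ℝ, a • T.I + b • T.J + c • T.K = X := by
      intro X hX
      have hX' : X ∈ Submodule.span ℝ {T.I, T.J, T.K} := h ▸ Submodule.subset_span hX
      exact Submodule.mem_span_triple.1 hX'
    obtain ⟨a1, b1, c1, h1⟩ := mem T'.I (by simp)
    obtain ⟨a2, b2, c2, h2⟩ := mem T'.J (by simp)
    obtain ⟨a3, b3, c3, h3⟩ := mem T'.K (by simp)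
    -- anticommutators
    have IK : T.I * T.K = -T.J := by
      rw [← T.IJ, ← mul_assoc, T.I_sq]; simp
    have KI : T.K * T.I = T.J := by
      rw [← T.IJ, mul_assoc, T.JI, mul_neg, IK, neg_neg]
    have KJ : T.K * T.J = -T.I := by
      rw [← T.IJ, mul_assoc, T.J_sq]; simp
    have JK : T.J * T.K = T.I := by
      have : T.K = -(T.J * T.I) := by rw [T.JI, neg_neg]
      rw [this, mul_neg, ← mul_assoc, T.J_sq]; simp
    have KK : T.K * T.K = -1 := by
      nth_rewrite 1 [← T.IJ]
      rw [mul_assoc, JK, T.I_sq]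
    have anti : ∀ a b c a' b' c' : ℝ,
        (a • T.I + b • T.J + c • T.K) * (a' • T.I + b' • T.J + c' • T.K)
          + (a' • T.I + b' • T.J + c' • T.K) * (a • T.I + b • T.J + c • T.K)
          = (-2 * (a * a' + b * b' + c * c')) • (1 : Module.End ℝ V) := by
      intro a b c a' b' c'
      simp only [add_mul, mul_add, smul_mul_smul_comm, T.I_sq, T.J_sq, T.IJ, T.JI, IK, KI, KJ,
        JK, KK]
      module
    have inj : ∀ r s : ℝ, r • (1 : Module.End ℝ V) = s • 1 → r = s := fun r s e =>
      smul_left_injective ℝ one_ne_zero e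
    have IK' : T'.I * T'.K = -T'.J := by
      rw [← T'.IJ, ← mul_assoc, T'.I_sq]; simp
    have KI' : T'.K * T'.I = T'.J := by
      rw [← T'.IJ, mul_assoc, T'.JI, mul_neg, IK', neg_neg]
    have KJ' : T'.K * T'.J = -T'.I := by
      rw [← T'.IJ, mul_assoc, T'.J_sq]; simp
    have JK' : T'.J * T'.K = T'.I := by
      have : T'.K = -(T'.J * T'.I) := by rw [T'.JI, neg_neg]
      rw [this, mul_neg, ← mul_assoc, T'.J_sq]; simp
    have KK' : T'.K * T'.K = -1 := by
      nth_rewrite 1 [← T'.IJ]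
      rw [mul_assoc, JK', T'.I_sq]
    have e11 := anti a1 b1 c1 a1 b1 c1
    have e22 := anti a2 b2 c2 a2 b2 c2
    have e33 := anti a3 b3 c3 a3 b3 c3
    have e12 := anti a1 b1 c1 a2 b2 c2
    have e13 := anti a1 b1 c1 a3 b3 c3
    have e23 := anti a2 b2 c2 a3 b3 c3
    rw [h1, T'.I_sq] at e11
    rw [h2, T'.J_sq] at e22
    rw [h3, KK'] at e33
    rw [h1, h2, T'.IJ, T'.JI] at e12
    rw [h1, h3, IK', KI'] at e13
    rw [h2, h3, JK', KJ'] at e23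
    have f11 := inj (-2) _ (by rw [← e11]; module)
    have f22 := inj (-2) _ (by rw [← e22]; module)
    have f33 := inj (-2) _ (by rw [← e33]; module)
    have f12 := inj 0 _ (by rw [← e12]; module)
    have f13 := inj 0 _ (by rw [← e13]; module)
    have f23 := inj 0 _ (by rw [← e23]; module)
    have hmat : !![a1, b1, c1; a2, b2, c2; a3, b3, c3] * !![a1, a2, a3; b1, b2, b3; c1, c2, c3]
        = (1 : Matrix (Fin 3) (Fin 3) ℝ) := by
      ext i j
      fin_cases i <;> fin_cases j <;>
        simp [Matrix.mul_apply, Fin.sum_univ_succ] <;> linarith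
    have hmat' := mul_eq_one_comm.1 hmat
    have g : ∀ i j, (!![a1, a2, a3; b1, b2, b3; c1, c2, c3] *
        !![a1, b1, c1; a2, b2, c2; a3, b3, c3]) i j = (1 : Matrix (Fin 3) (Fin 3) ℝ) i j :=
      fun i j => by rw [hmat']
    have g00 := g 0 0
    have g11 := g 1 1
    have g22 := g 2 2
    have g01 := g 0 1
    have g02 := g 0 2
    have g12 := g 1 2
    simp [Matrix.mul_apply, Fin.sum_univ_succ] at g00 g11 g22 g01 g02 g12
    have S : ∀ u w : Fin 2 → V,
        kaehlerForm T'.I u * kaehlerForm T'.I w + kaehlerForm T'.J u * kaehlerForm T'.J w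
          + kaehlerForm T'.K u * kaehlerForm T'.K w
        = kaehlerForm T.I u * kaehlerForm T.I w + kaehlerForm T.J u * kaehlerForm T.J w
          + kaehlerForm T.K u * kaehlerForm T.K w := by
      intro u w
      have k : ∀ (a b c : ℝ) (z : Fin 2 → V), kaehlerForm (a • T.I + b • T.J + c • T.K) z
          = a * kaehlerForm T.I z + b * kaehlerForm T.J z + c * kaehlerForm T.K z := by
        intro a b c z
        simp [kaehlerForm, inner_add_right, inner_smul_right]
      rw [← h1, ← h2, ← h3]
      simp only [k]
      linear_combination (kaehlerForm T.I u * kaehlerForm T.I w) * g00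
        + (kaehlerForm T.J u * kaehlerForm T.J w) * g11
        + (kaehlerForm T.K u * kaehlerForm T.K w) * g22
        + (kaehlerForm T.I u * kaehlerForm T.J w + kaehlerForm T.J u * kaehlerForm T.I w) * g01
        + (kaehlerForm T.I u * kaehlerForm T.K w + kaehlerForm T.K u * kaehlerForm T.I w) * g02
        + (kaehlerForm T.J u * kaehlerForm T.K w + kaehlerForm T.K u * kaehlerForm T.J w) * g12
    simp only [fourForm, wedge]
    linear_combination S ![v 0, v 1] ![v 2, v 3] - S ![v 0, v 2] ![v 1, v 3]
      + S ![v 0, v 3] ![v 1, v 2] + S ![v 1, v 2] ![v 0, v 3] - S ![v 1, v 3] ![v 0, v 2]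
      + S ![v 2, v 3] ![v 0, v 1]

/-! ### Almost quaternion-Hermitian manifolds -/

section Manifold

variable {n : ℕ} {M : Type*} [TopologicalSpace M]
  [ChartedSpace (EuclideanSpace ℝ (Fin (4 * n))) M] [IsManifold (𝓡 (4 * n)) ∞ M]
  [RiemannianBundle (fun x : M => TangentSpace (𝓡 (4 * n)) x)]

/-- A field of endomorphisms of the tangent spaces of `M`. -/
abbrev EndField (n : ℕ) (M : Type*) [TopologicalSpace M]
    [ChartedSpace (EuclideanSpace ℝ (Fin (4 * n))) M] :=
  ∀ x : M, TangentSpace (𝓡 (4 * n)) x →L[ℝ] TangentSpace (𝓡 (4 * n)) x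

/-- Smoothness on `U` of a field of endomorphisms, as a section of `End TM`. -/
def EndField.SmoothOn (A : EndField n M) (U : Set M) : Prop :=
  ContMDiffOn (𝓡 (4 * n))
    ((𝓡 (4 * n)).prod
      𝓘(ℝ, EuclideanSpace ℝ (Fin (4 * n)) →L[ℝ] EuclideanSpace ℝ (Fin (4 * n)))) ∞
    (fun x => Bundle.TotalSpace.mk'
      (EuclideanSpace ℝ (Fin (4 * n)) →L[ℝ] EuclideanSpace ℝ (Fin (4 * n)))
      (E := fun x : M => TangentSpace (𝓡 (4 * n)) x →L[ℝ] TangentSpace (𝓡 (4 * n)) x)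
      x (A x)) U

/-- An adapted basis over `U` of a family `𝒢` of subspaces of the spaces `End(T_x M)`: smooth
almost complex structures `I, J, K = IJ = -JI` over `U`, orthogonal for the Riemannian metric,
spanning `𝒢`. (The values of the fields outside `U` are irrelevant.) -/
structure AdaptedBasis
    (𝒢 : ∀ x : M, Submodule ℝ (TangentSpace (𝓡 (4 * n)) x →L[ℝ] TangentSpace (𝓡 (4 * n)) x))
    (U : Set M) where
  /-- the first almost complex structure -/
  I : EndField n M
  /-- the second almost complex structure -/
  J : EndField n M
  /-- the third almost complex structure -/
  K : EndField n M
  smooth_I : I.SmoothOn U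
  smooth_J : J.SmoothOn U
  smooth_K : K.SmoothOn U
  I_sq : ∀ x ∈ U, ∀ v, I x (I x v) = -v
  J_sq : ∀ x ∈ U, ∀ v, J x (J x v) = -v
  IJ : ∀ x ∈ U, ∀ v, I x (J x v) = K x v
  JI : ∀ x ∈ U, ∀ v, J x (I x v) = -K x v
  inner_I : ∀ x ∈ U, ∀ u v, inner ℝ (I x u) (I x v) = inner ℝ u v
  inner_J : ∀ x ∈ U, ∀ u v, inner ℝ (J x u) (J x v) = inner ℝ u v
  inner_K : ∀ x ∈ U, ∀ u v, inner ℝ (K x u) (K x v) = inner ℝ u v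
  span_eq : ∀ x ∈ U, 𝒢 x = Submodule.span ℝ {I x, J x, K x}

/-- The adapted basis at a point of `U`. -/
def AdaptedBasis.triple
    {𝒢 : ∀ x : M, Submodule ℝ (TangentSpace (𝓡 (4 * n)) x →L[ℝ] TangentSpace (𝓡 (4 * n)) x)}
    {U : Set M} (b : AdaptedBasis 𝒢 U) (x : M) (hx : x ∈ U) :
    Triple (TangentSpace (𝓡 (4 * n)) x) where
  I := (b.I x).toLinearMap
  J := (b.J x).toLinearMap
  K := (b.K x).toLinearMap
  I_sq := LinearMap.ext (b.I_sq x hx)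
  J_sq := LinearMap.ext (b.J_sq x hx)
  IJ := LinearMap.ext (b.IJ x hx)
  JI := LinearMap.ext (b.JI x hx)
  inner_I := b.inner_I x hx
  inner_J := b.inner_J x hx
  inner_K := b.inner_K x hx

variable (n M) in
/-- An almost quaternion-Hermitian structure on the Riemannian manifold `M` of dimension `4n`:
a subbundle of `End TM` which locally has an adapted basis. -/
structure AlmostQuaternionHermitian where
  /-- the fibres of the subbundle -/
  bundle : ∀ x : M,
    Submodule ℝ (TangentSpace (𝓡 (4 * n)) x →L[ℝ] TangentSpace (𝓡 (4 * n)) x)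
  exists_adaptedBasis : ∀ x : M, ∃ U : Set M, IsOpen U ∧ x ∈ U ∧
    Nonempty (AdaptedBasis bundle U)

/-- The fundamental four-form, `ω_I ∧ ω_I + ω_J ∧ ω_J + ω_K ∧ ω_K` in any local adapted
basis. -/
def AlmostQuaternionHermitian.fundamentalForm (Q : AlmostQuaternionHermitian n M) (x : M)
    (v : Fin 4 → TangentSpace (𝓡 (4 * n)) x) : ℝ :=
  ((Q.exists_adaptedBasis x).choose_spec.2.2.some.triple x
    (Q.exists_adaptedBasis x).choose_spec.2.1).fourForm v

/-- The local formula for the fundamental four-form. -/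
theorem AlmostQuaternionHermitian.fundamentalForm_eq (Q : AlmostQuaternionHermitian n M)
    {U : Set M} (b : AdaptedBasis Q.bundle U) {x : M} (hx : x ∈ U) :
    Q.fundamentalForm x = (b.triple x hx).fourForm := by
  refine Triple.fourForm_eq_of_span_eq _ _ ?_
  have key : ∀ {U' : Set M} (b' : AdaptedBasis Q.bundle U') (hx' : x ∈ U'),
      Submodule.span ℝ {(b'.triple x hx').I, (b'.triple x hx').J, (b'.triple x hx').K} =
        (Q.bundle x).map (ContinuousLinearMap.coeLM ℝ) := by
    intro U' b' hx'
    rw [b'.span_eq x hx', Submodule.map_span]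
    congr 1
    simp [Set.image_insert_eq, AdaptedBasis.triple]
  rw [key, key]

/-- The covariant derivative of a field `τ` of covariant tensors of degree `s`, with the direction
of differentiation as first argument:
`(∇τ)(X, Y₁, …, Yₛ) = X(τ(Y₁, …, Yₛ)) - ∑ᵢ τ(Y₁, …, ∇_X Yᵢ, …, Yₛ)`, where the tangent vectors
`Yᵢ` at `x` are extended to smooth vector fields near `x`. -/
def covDeriv (cov : CovariantDerivative (𝓡 (4 * n)) (EuclideanSpace ℝ (Fin (4 * n)))
      (fun x : M => TangentSpace (𝓡 (4 * n)) x)) {s : ℕ}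
    (τ : ∀ x : M, (Fin s → TangentSpace (𝓡 (4 * n)) x) → ℝ) (x : M)
    (v : Fin (s + 1) → TangentSpace (𝓡 (4 * n)) x) : ℝ :=
  mvfderiv (𝓡 (4 * n)) (fun y : M => τ y (fun i : Fin s =>
      FiberBundle.extend (EuclideanSpace ℝ (Fin (4 * n))) (v i.succ) y)) x (v 0)
    - ∑ i : Fin s, τ x (Function.update (fun j : Fin s => v j.succ) i
        (cov (FiberBundle.extend (EuclideanSpace ℝ (Fin (4 * n))) (v i.succ)) x (v 0)))

/-- The covariant derivative of the Kähler form of `A` lies, at every point of `U`, in the sum of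
the Gray–Hervella modules with labels in `C`. -/
def HasHermitianType (cov : CovariantDerivative (𝓡 (4 * n)) (EuclideanSpace ℝ (Fin (4 * n)))
      (fun x : M => TangentSpace (𝓡 (4 * n)) x))
    (U : Set M) (A : EndField n M) (C : Set GHType) : Prop :=
  ∀ x ∈ U, ∃ t ∈ ghClass (A x).toLinearMap C,
    ∀ v, t v = covDeriv cov (fun y => kaehlerForm (A y).toLinearMap) x v

/-- The covariant derivative of the fundamental form lies, at every point of `U`, in the sum of
the modules `(Λ³₀E, K, E) ⊗ (S³H, H)` with labels in `C`. -/
def HasQuaternionicType (cov : CovariantDerivative (𝓡 (4 * n)) (EuclideanSpace ℝ (Fin (4 * n)))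
      (fun x : M => TangentSpace (𝓡 (4 * n)) x))
    (Q : AlmostQuaternionHermitian n M) {U : Set M} (b : AdaptedBasis Q.bundle U)
    (C : Set (EType × HType)) : Prop :=
  ∀ (x : M) (hx : x ∈ U), ∃ t ∈ (b.triple x hx).quatClass C,
    ∀ v, t v = (covDeriv cov Q.fundamentalForm x v : ℂ)

variable [IsContMDiffRiemannianBundle (𝓡 (4 * n)) ∞ (EuclideanSpace ℝ (Fin (4 * n)))
    (fun x : M => TangentSpace (𝓡 (4 * n)) x)]

set_option synthInstance.maxHeartbeats 200000 in
/-- The Levi-Civita connection: torsion-free and compatible with the metric. -/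
structure IsLeviCivita (cov : CovariantDerivative (𝓡 (4 * n)) (EuclideanSpace ℝ (Fin (4 * n)))
    (fun x : M => TangentSpace (𝓡 (4 * n)) x)) : Prop where
  torsion_eq_zero : CovariantDerivative.torsion cov = 0
  metric : cov.IsMetricCompatible

end Manifold

end AQH

end

open scoped Manifold ContDiff Bundle Topology Quaternion TensorProduct
open Bundle

noncomputable section

namespace AQH

set_option maxSynthPendingDepth 3

/-! At a point, the derivatives of ω_I, ω_J, ω_K are encoded by three trilinear maps α, β, γ, each
symmetric and invariant under I, J, K in its last two arguments, with ∇ω_I(x,y,z) = γ(x;y,Jz) -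
β(x;y,Kz) and its cyclic analogues (`Triple.exists_symmetric_forms`; the input is the Leibniz rule
for K = IJ, `covDeriv_kaehlerForm_comp`). Put ξ = α(x;y,Iz) + β(x;y,Jz) + γ(x;y,Kz). An
Sp(n)Sp(1)-equivariant map `Triple.fiveMap` sends ξ to ∇Ω = 2 ∑ ∇ω_A ∧ ω_A
(`Triple.fiveMap_xi_apply`, `covDeriv_fundamentalForm`) and kills the parts of α, β, γ that are
multiples of the metric, since rotating the adapted basis does not change Ω
(`Triple.fiveMap_xi_outer`).

The E-type of such maps is read off from a transposition operator S = `symOp` with S² = 8 - 2S. On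
maps without traces its eigenvalue -4 is the type Λ³₀E and its eigenvalue 2 is the type K, because S
becomes -2 times the sum of the two nontrivial cyclic shifts on complex forms (`Triple.phi_symOp`).
The E-part depends only on the two traces `tr₁₂` and `tr₂₃`. The H-type is Clebsch–Gordan for H ⊗
S²H = S³H + H. With X = α(I·), Y = β(J·), Z = γ(K·), a component of type V lies in VH when the
V-parts of X, Y, Z are equal, and in VS³H when they add up to zero
(`Triple.fiveMap_xi_mem_quatClass_of_mem`). Since the components are sums of images of intertwining
maps, it is enough to exhibit intertwining maps; no irreducibility or dimension count enters.

The Gray–Hervella conditions become linear relations (`Triple.hermitianRel_of_mem_ghClass`). If ∇ω_I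
has no 𝒲₁-part, then Y and Z have equal Λ³₀E-parts; no 𝒲₂-part gives equal K-parts; no 𝒲₃-part gives
opposite Λ³₀E- and K-parts; no 𝒲₄-part gives opposite `tr₁₂`. A missing 𝒲₁, 𝒲₂ or 𝒲₃ also gives one
relation between the traces. The forms ω_J and ω_K relate the pairs (Z, X) and (X, Y) in the same
way. All the implications are then linear algebra: two equalities leave only VH, an odd number of
sign changes around the triangle X, Y, Z leaves nothing, and the E-part is settled by solving for
the traces. In dimension eight Λ³₀E vanishes (`Triple.typeSpace_lambda_eq_bot`), and the trace
relations have a coincidence special to that dimension (`Triple.TypeCond.of_trace_dim_eight`). -/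

/-- Complex-valued real-trilinear maps, in curried form. -/
abbrev Tri (V : Type*) [AddCommGroup V] [Module ℝ V] := V →ₗ[ℝ] V →ₗ[ℝ] V →ₗ[ℝ] ℂ

/-- A trilinear map from a function which is linear in each variable. -/
def mkTri {V : Type*} [AddCommGroup V] [Module ℝ V] (f : V → V → V → ℂ)
    (a1 : ∀ x x' y z, f (x + x') y z = f x y z + f x' y z)
    (s1 : ∀ (c : ℝ) x y z, f (c • x) y z = c • f x y z)
    (a2 : ∀ x y y' z, f x (y + y') z = f x y z + f x y' z)
    (s2 : ∀ (c : ℝ) x y z, f x (c • y) z = c • f x y z)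
    (a3 : ∀ x y z z', f x y (z + z') = f x y z + f x y z')
    (s3 : ∀ (c : ℝ) x y z, f x y (c • z) = c • f x y z) : Tri V where
  toFun x := LinearMap.mk₂ ℝ (f x) (a2 x) (fun c => s2 c x) (a3 x) (fun c => s3 c x)
  map_add' x x' := by ext y z; exact a1 x x' y z
  map_smul' c x := by ext y z; exact s1 c x y z

/-- A trilinear map as a tensor of degree three. -/
def toCForm {V : Type*} [AddCommGroup V] [Module ℝ V] : Tri V →ₗ[ℂ] CForm V 3 where
  toFun τ := MultilinearMap.mk' (fun v => τ (v 0) (v 1) (v 2))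
    (by intro v i x y; fin_cases i <;> simp [Function.update])
    (by intro v i c x; fin_cases i <;> simp [Function.update])
  map_add' τ τ' := by ext v; simp
  map_smul' c τ := by ext v; simp

@[simp] theorem toCForm_apply {V : Type*} [AddCommGroup V] [Module ℝ V] (τ : Tri V)
    (v : Fin 3 → V) : toCForm τ v = τ (v 0) (v 1) (v 2) := rfl

/-! ### Independence of metric traces of the orthonormal basis. -/

section Trace

variable {V : Type*} [NormedAddCommGroup V] [InnerProductSpace ℝ V]

/-- The metric trace of a bilinear map does not depend on the orthonormal basis. -/
theorem sum_bilin_orthonormal {ι κ W : Type*} [Fintype ι] [Fintype κ] [AddCommGroup W] [Module ℝ W]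
    (B : V →ₗ[ℝ] V →ₗ[ℝ] W) (e : OrthonormalBasis ι ℝ V) (f : OrthonormalBasis κ ℝ V) :
    ∑ i, B (e i) (e i) = ∑ k, B (f k) (f k) := by
  have h : ∀ i, B (e i) (e i) =
      ∑ j, ∑ k, (inner ℝ (f j) (e i) * inner ℝ (e i) (f k)) • B (f k) (f j) := by
    intro i
    conv_lhs => rw [← f.sum_repr' (e i)]
    simp only [map_sum, LinearMap.sum_apply, map_smul, LinearMap.smul_apply]
    refine Finset.sum_congr rfl fun j _ => ?_
    rw [Finset.smul_sum]
    refine Finset.sum_congr rfl fun k _ => ?_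
    rw [smul_smul, real_inner_comm (f k) (e i)]
  simp only [h]
  rw [Finset.sum_comm]
  refine Finset.sum_congr rfl fun j _ => ?_
  rw [Finset.sum_comm]
  classical
  simp only [← Finset.sum_smul, e.sum_inner_mul_inner, orthonormal_iff_ite.1 f.orthonormal]
  simp

end Trace

/-! ### Quaternion relations, invariant symmetric forms and the transposition operator. -/

namespace Triple

variable {V : Type*} [NormedAddCommGroup V] [InnerProductSpace ℝ V] (T : Triple V)

section Relations

@[simp] theorem I_I (v : V) : T.I (T.I v) = -v := by
  have := congrArg (fun f => f v) T.I_sq; simpa using this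

@[simp] theorem J_J (v : V) : T.J (T.J v) = -v := by
  have := congrArg (fun f => f v) T.J_sq; simpa using this

@[simp] theorem I_J (v : V) : T.I (T.J v) = T.K v := by
  have := congrArg (fun f => f v) T.IJ; simpa using this

@[simp] theorem J_I (v : V) : T.J (T.I v) = -T.K v := by
  have := congrArg (fun f => f v) T.JI; simpa using this

@[simp] theorem I_K (v : V) : T.I (T.K v) = -T.J v := by
  rw [← T.I_J, T.I_I]

@[simp] theorem K_I (v : V) : T.K (T.I v) = T.J v := by
  rw [← T.I_J, T.J_I, map_neg, T.I_K, neg_neg]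

@[simp] theorem K_J (v : V) : T.K (T.J v) = -T.I v := by
  rw [← T.I_J, T.J_J, map_neg]

@[simp] theorem J_K (v : V) : T.J (T.K v) = T.I v := by
  have h := T.J_I (T.J v)
  rw [T.I_J] at h
  rw [h, K_J, neg_neg]

@[simp] theorem K_K (v : V) : T.K (T.K v) = -v := by
  rw [← T.I_J, T.J_K, T.I_I]

theorem inner_I_left (u v : V) : inner ℝ (T.I u) v = -inner ℝ u (T.I v) := by
  rw [← T.inner_I u (T.I v), T.I_I, inner_neg_right, neg_neg]

theorem inner_J_left (u v : V) : inner ℝ (T.J u) v = -inner ℝ u (T.J v) := by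
  rw [← T.inner_J u (T.J v), T.J_J, inner_neg_right, neg_neg]

theorem inner_K_left (u v : V) : inner ℝ (T.K u) v = -inner ℝ u (T.K v) := by
  rw [← T.inner_K u (T.K v), T.K_K, inner_neg_right, neg_neg]

theorem inner_I_self (u : V) : inner ℝ u (T.I u) = 0 := by
  have := T.inner_I_left u u
  rw [real_inner_comm] at this
  linarith

theorem inner_J_self (u : V) : inner ℝ u (T.J u) = 0 := by
  have := T.inner_J_left u u
  rw [real_inner_comm] at this
  linarith

theorem inner_K_self (u : V) : inner ℝ u (T.K u) = 0 := by
  have := T.inner_K_left u u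
  rw [real_inner_comm] at this
  linarith

/-- The cyclic rotation `(J, K, I)` of an adapted basis. -/
def rot : Triple V where
  I := T.J
  J := T.K
  K := T.I
  I_sq := T.J_sq
  J_sq := LinearMap.ext T.K_K
  IJ := LinearMap.ext T.J_K
  JI := LinearMap.ext T.K_J
  inner_I := T.inner_J
  inner_J := T.inner_K
  inner_K := T.inner_I

@[simp] theorem rot_I : T.rot.I = T.J := rfl
@[simp] theorem rot_J : T.rot.J = T.K := rfl
@[simp] theorem rot_K : T.rot.K = T.I := rfl

/-- `I` as an isometry. -/
def isoI : V ≃ₗᵢ[ℝ] V where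
  toLinearEquiv := LinearEquiv.ofLinearMap T.I (-T.I) (by ext; simp) (by ext; simp)
  norm_map' v := by
    change ‖T.I v‖ = _
    rw [norm_eq_sqrt_real_inner, T.inner_I, ← norm_eq_sqrt_real_inner]

@[simp] theorem isoI_apply (v : V) : T.isoI v = T.I v := rfl

end Relations

/-! ### Trilinear maps with values in the quaternion-invariant symmetric forms -/

/-- The trilinear maps that are symmetric in the last two arguments and invariant under the
simultaneous action of `I`, `J` (hence `K`) on these. -/
def hSym : Submodule ℂ (Tri V) where
  carrier := {τ | (∀ x y z, τ x y z = τ x z y) ∧ (∀ x y z, τ x (T.I y) (T.I z) = τ x y z) ∧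
    ∀ x y z, τ x (T.J y) (T.J z) = τ x y z}
  zero_mem' := by simp
  add_mem' := by
    rintro a b ⟨h1, h2, h3⟩ ⟨k1, k2, k3⟩
    refine ⟨fun x y z => ?_, fun x y z => ?_, fun x y z => ?_⟩
    · simp [h1 x y z, k1 x y z]
    · simp [h2 x y z, k2 x y z]
    · simp [h3 x y z, k3 x y z]
  smul_mem' := by
    rintro c a ⟨h1, h2, h3⟩
    refine ⟨fun x y z => ?_, fun x y z => ?_, fun x y z => ?_⟩
    · simp [h1 x y z]
    · simp [h2 x y z]
    · simp [h3 x y z]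

variable {T}

theorem hSym.symm {τ : Tri V} (h : τ ∈ T.hSym) (x y z : V) : τ x y z = τ x z y := h.1 x y z

theorem hSym.I {τ : Tri V} (h : τ ∈ T.hSym) (x y z : V) : τ x (T.I y) z = -τ x y (T.I z) := by
  rw [← h.2.1 x y (T.I z)]; simp

theorem hSym.J {τ : Tri V} (h : τ ∈ T.hSym) (x y z : V) : τ x (T.J y) z = -τ x y (T.J z) := by
  rw [← h.2.2 x y (T.J z)]; simp

theorem hSym.K {τ : Tri V} (h : τ ∈ T.hSym) (x y z : V) : τ x (T.K y) z = -τ x y (T.K z) := by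
  rw [← T.I_J, hSym.I h, hSym.J h]; simp

theorem hSym.I_swap {τ : Tri V} (h : τ ∈ T.hSym) (x y z : V) :
    τ x z (T.I y) = -τ x y (T.I z) := by
  rw [hSym.symm h, hSym.I h]

theorem hSym.J_swap {τ : Tri V} (h : τ ∈ T.hSym) (x y z : V) :
    τ x z (T.J y) = -τ x y (T.J z) := by
  rw [hSym.symm h, hSym.J h]

theorem hSym.K_swap {τ : Tri V} (h : τ ∈ T.hSym) (x y z : V) :
    τ x z (T.K y) = -τ x y (T.K z) := by
  rw [hSym.symm h, hSym.K h]

theorem hSym.I_self {τ : Tri V} (h : τ ∈ T.hSym) (x y : V) : τ x y (T.I y) = 0 := by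
  have := hSym.I h x y y
  rw [hSym.symm h] at this
  linear_combination this / 2

theorem hSym.J_self {τ : Tri V} (h : τ ∈ T.hSym) (x y : V) : τ x y (T.J y) = 0 := by
  have := hSym.J h x y y
  rw [hSym.symm h] at this
  linear_combination this / 2

theorem hSym.K_self {τ : Tri V} (h : τ ∈ T.hSym) (x y : V) : τ x y (T.K y) = 0 := by
  have := hSym.K h x y y
  rw [hSym.symm h] at this
  linear_combination this / 2

theorem hSym.comp {τ : Tri V} (h : τ ∈ T.hSym) (A : Module.End ℝ V) : τ ∘ₗ A ∈ T.hSym :=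
  ⟨fun x => h.1 (A x), fun x => h.2.1 (A x), fun x => h.2.2 (A x)⟩

variable (T)

/-- Rotation of the adapted basis preserves all the invariant objects, so that facts about I pass to
J and K by applying them to `T.rot` and `T.rot.rot`. -/
theorem rot_hSym : T.rot.hSym = T.hSym := by
  ext τ
  refine ⟨fun h => ⟨h.1, fun x y z => ?_, h.2.1⟩, fun h => ⟨h.1, h.2.2, fun x y z => ?_⟩⟩
  · have := hSym.K h x y (T.I z)
    simpa using this
  · have := hSym.K h x y (T.K z)
    simpa using this

/-- The transposition operator `(Sτ)(x; y, z) = ∑_A τ(Ay; x, Az) + τ(Az; x, Ay)`, the sum being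
over `A = 1, I, J, K`. -/
def symOp : Tri V →ₗ[ℂ] Tri V where
  toFun τ := mkTri (fun x y z => τ y x z + τ z x y + (τ (T.I y) x (T.I z) + τ (T.I z) x (T.I y))
      + (τ (T.J y) x (T.J z) + τ (T.J z) x (T.J y))
      + (τ (T.K y) x (T.K z) + τ (T.K z) x (T.K y)))
    (by intros; simp only [map_add, LinearMap.add_apply]; ring)
    (by intros; simp only [map_smul, LinearMap.smul_apply, smul_add])
    (by intros; simp only [map_add, LinearMap.add_apply]; ring)
    (by intros; simp only [map_smul, LinearMap.smul_apply, smul_add])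
    (by intros; simp only [map_add, LinearMap.add_apply]; ring)
    (by intros; simp only [map_smul, LinearMap.smul_apply, smul_add])
  map_add' τ τ' := by ext x y z; simp [mkTri]; ring
  map_smul' c τ := by ext x y z; simp [mkTri]; ring

theorem symOp_apply (τ : Tri V) (x y z : V) : T.symOp τ x y z =
    τ y x z + τ z x y + (τ (T.I y) x (T.I z) + τ (T.I z) x (T.I y))
      + (τ (T.J y) x (T.J z) + τ (T.J z) x (T.J y))
      + (τ (T.K y) x (T.K z) + τ (T.K z) x (T.K y)) := rfl

theorem rot_symOp : T.rot.symOp = T.symOp := by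
  ext τ x y z
  simp only [symOp_apply, rot_I, rot_J, rot_K]
  ring

variable {T}

/-- Replacing y, z by Iy, Iz or by Jy, Jz only permutes the summands A = 1, I, J, K, up to signs
that occur twice and cancel. -/
theorem symOp_mem (τ : Tri V) : T.symOp τ ∈ T.hSym := by
  refine ⟨fun x y z => ?_, fun x y z => ?_, fun x y z => ?_⟩
  · simp only [symOp_apply]; ring
  · simp only [symOp_apply, I_I, J_I, K_I, map_neg, LinearMap.neg_apply]; ring
  · simp only [symOp_apply, I_J, J_J, K_J, map_neg, LinearMap.neg_apply]; ring

/-- Reindexing the sum by A ↦ IA moves I from the first to the third argument of τ, and invariance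
moves it on to the second. Thus S commutes with the quaternions acting on the first argument, that
is, with the factor H. -/
theorem symOp_comp_I {τ : Tri V} (h : τ ∈ T.hSym) : T.symOp (τ ∘ₗ T.I) = T.symOp τ ∘ₗ T.I := by
  ext x y z
  simp only [symOp_apply, LinearMap.comp_apply, hSym.I h, I_I, I_J, I_K, map_neg,
    LinearMap.neg_apply]
  ring

/-- The relation reads (S - 2)(S + 4) = 0; its two eigenspaces separate the type K from the type
Λ³₀E. -/
theorem symOp_symOp {τ : Tri V} (h : τ ∈ T.hSym) :
    T.symOp (T.symOp τ) = (8 : ℂ) • τ - (2 : ℂ) • T.symOp τ := by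
  ext x y z
  simp only [symOp_apply, LinearMap.sub_apply, LinearMap.smul_apply, smul_eq_mul]
  simp only [hSym.I h, hSym.J h, hSym.K h, I_I, I_J, I_K, J_I, J_J, J_K, K_I, K_J, K_K, map_neg,
    LinearMap.neg_apply]
  rw [hSym.symm h x z y, hSym.symm h z y x, hSym.symm h y z x, hSym.I_swap h _ x y,
    hSym.I_swap h _ x z, hSym.J_swap h _ x y, hSym.J_swap h _ x z, hSym.K_swap h _ x y,
    hSym.K_swap h _ x z]
  ring
end Triple

/-! ### Traces and the projections to the types Λ³₀E, K and E. -/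

namespace Triple

section Traces

variable {V : Type*} [NormedAddCommGroup V] [InnerProductSpace ℝ V]

/-- The tensor product of a one-form with the metric. -/
def outer : (V →ₗ[ℝ] ℂ) →ₗ[ℂ] Tri V where
  toFun η := mkTri (fun x y z => η x * (inner ℝ y z : ℝ))
    (by intros; simp only [map_add]; ring)
    (by intros; simp only [map_smul, smul_mul_assoc])
    (by intros; simp only [inner_add_left]; push_cast; ring)
    (by intros; simp only [real_inner_smul_left, Complex.real_smul]; push_cast; ring)
    (by intros; simp only [inner_add_right]; push_cast; ring)
    (by intros; simp only [real_inner_smul_right, Complex.real_smul]; push_cast; ring)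
  map_add' η ζ := by ext x y z; simp [mkTri, add_mul]
  map_smul' c η := by ext x y z; simp [mkTri, mul_assoc]

theorem outer_apply (η : V →ₗ[ℝ] ℂ) (x y z : V) :
    outer η x y z = η x * (inner ℝ y z : ℝ) := rfl

theorem outer_comp (η : V →ₗ[ℝ] ℂ) (A : Module.End ℝ V) : outer η ∘ₗ A = outer (η ∘ₗ A) := rfl

theorem outer_mem {T : Triple V} (η : V →ₗ[ℝ] ℂ) : outer η ∈ T.hSym := by
  refine ⟨fun x y z => ?_, fun x y z => ?_, fun x y z => ?_⟩
  · rw [outer_apply, outer_apply, real_inner_comm]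
  · rw [outer_apply, outer_apply, T.inner_I]
  · rw [outer_apply, outer_apply, T.inner_J]

variable [FiniteDimensional ℝ V]

/-- The trace of a trilinear map over the first two arguments. -/
def tr₁₂ : Tri V →ₗ[ℂ] (V →ₗ[ℝ] ℂ) where
  toFun τ := ∑ i, τ (stdOrthonormalBasis ℝ V i) (stdOrthonormalBasis ℝ V i)
  map_add' τ τ' := by simp [Finset.sum_add_distrib]
  map_smul' c τ := by simp [Finset.smul_sum]

/-- The trace of a trilinear map over the last two arguments. -/
def tr₂₃ : Tri V →ₗ[ℂ] (V →ₗ[ℝ] ℂ) where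
  toFun τ := ∑ i, (τ.flip (stdOrthonormalBasis ℝ V i)).flip (stdOrthonormalBasis ℝ V i)
  map_add' τ τ' := by ext x; simp [Finset.sum_add_distrib]
  map_smul' c τ := by ext x; simp [Finset.mul_sum]

theorem tr₁₂_apply {ι : Type*} [Fintype ι] (e : OrthonormalBasis ι ℝ V) (τ : Tri V) (z : V) :
    tr₁₂ τ z = ∑ i, τ (e i) (e i) z := by
  have := sum_bilin_orthonormal τ (stdOrthonormalBasis ℝ V) e
  change (∑ i, τ (stdOrthonormalBasis ℝ V i) (stdOrthonormalBasis ℝ V i)) z = _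
  rw [this, LinearMap.sum_apply]

theorem tr₂₃_apply {ι : Type*} [Fintype ι] (e : OrthonormalBasis ι ℝ V) (τ : Tri V) (x : V) :
    tr₂₃ τ x = ∑ i, τ x (e i) (e i) := by
  rw [← sum_bilin_orthonormal (τ x) (stdOrthonormalBasis ℝ V) e]
  change (∑ i, (τ.flip (stdOrthonormalBasis ℝ V i)).flip (stdOrthonormalBasis ℝ V i)) x = _
  simp

variable {T : Triple V}

theorem tr₁₂_outer (η : V →ₗ[ℝ] ℂ) : tr₁₂ (outer η) = η := by
  ext z
  rw [tr₁₂_apply (stdOrthonormalBasis ℝ V)]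
  conv_rhs => rw [← (stdOrthonormalBasis ℝ V).sum_repr' z]
  simp [outer_apply, mul_comm]

theorem tr₂₃_outer (η : V →ₗ[ℝ] ℂ) :
    tr₂₃ (outer η) = (Module.finrank ℝ V : ℂ) • η := by
  ext z
  rw [tr₂₃_apply (stdOrthonormalBasis ℝ V)]
  simp [outer_apply]

/-- The trace may be computed in the rotated basis I eᵢ, where I² = -1 in the first argument and
skewness of I between the last two arguments give the claim. -/
theorem tr₁₂_comp_I {τ : Tri V} (h : τ ∈ T.hSym) : tr₁₂ (τ ∘ₗ T.I) = tr₁₂ τ ∘ₗ T.I := by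
  ext z
  rw [tr₁₂_apply ((stdOrthonormalBasis ℝ V).map T.isoI), LinearMap.comp_apply,
    tr₁₂_apply (stdOrthonormalBasis ℝ V)]
  refine Finset.sum_congr rfl fun i _ => ?_
  simp [hSym.I h]

theorem tr₁₂_comp_J {τ : Tri V} (h : τ ∈ T.hSym) : tr₁₂ (τ ∘ₗ T.J) = tr₁₂ τ ∘ₗ T.J :=
  tr₁₂_comp_I (T := T.rot) (by rwa [rot_hSym])

theorem tr₁₂_comp_K {τ : Tri V} (h : τ ∈ T.hSym) : tr₁₂ (τ ∘ₗ T.K) = tr₁₂ τ ∘ₗ T.K :=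
  tr₁₂_comp_J (T := T.rot) (by rwa [rot_hSym])

theorem tr₂₃_comp (τ : Tri V) (A : Module.End ℝ V) : tr₂₃ (τ ∘ₗ A) = tr₂₃ τ ∘ₗ A := by
  ext z
  simp [tr₂₃_apply (stdOrthonormalBasis ℝ V)]

/-- The summands τ(Az; eᵢ, Aeᵢ) vanish by skewness unless A = 1, which leaves one `tr₂₃`. The others
give one `tr₁₂` for A = 1 and, since A² = -1, minus one for each of I, J, K. -/
theorem tr₁₂_symOp {τ : Tri V} (h : τ ∈ T.hSym) :
    tr₁₂ (T.symOp τ) = tr₂₃ τ - (2 : ℂ) • tr₁₂ τ := by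
  ext z
  have hI := congrArg (fun f => f (T.I z)) (tr₁₂_comp_I h)
  have hJ := congrArg (fun f => f (T.J z)) (tr₁₂_comp_J h)
  have hK := congrArg (fun f => f (T.K z)) (tr₁₂_comp_K h)
  simp only [tr₁₂_apply (stdOrthonormalBasis ℝ V), LinearMap.comp_apply, I_I, J_J, K_K, map_neg,
    Finset.sum_neg_distrib] at hI hJ hK
  simp only [tr₁₂_apply (stdOrthonormalBasis ℝ V), tr₂₃_apply (stdOrthonormalBasis ℝ V),
    symOp_apply, hSym.I_self h, hSym.J_self h, hSym.K_self h, Finset.sum_add_distrib,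
    LinearMap.sub_apply, LinearMap.smul_apply, smul_eq_mul, hI, hJ, hK, Finset.sum_const_zero]
  ring

/-- Each of the eight summands of S contributes one copy of `tr₁₂`. -/
theorem tr₂₃_symOp {τ : Tri V} (h : τ ∈ T.hSym) :
    tr₂₃ (T.symOp τ) = (8 : ℂ) • tr₁₂ τ := by
  ext z
  have hI := congrArg (fun f => f (T.I z)) (tr₁₂_comp_I h)
  have hJ := congrArg (fun f => f (T.J z)) (tr₁₂_comp_J h)
  have hK := congrArg (fun f => f (T.K z)) (tr₁₂_comp_K h)
  simp only [tr₁₂_apply (stdOrthonormalBasis ℝ V), LinearMap.comp_apply, I_I, J_J, K_K, map_neg,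
    Finset.sum_neg_distrib] at hI hJ hK
  simp only [tr₁₂_apply (stdOrthonormalBasis ℝ V), tr₂₃_apply (stdOrthonormalBasis ℝ V),
    symOp_apply, Finset.sum_add_distrib, LinearMap.smul_apply, smul_eq_mul,
    fun x y => hSym.symm h x z y, hSym.I h, hSym.J h, hSym.K h, Finset.sum_neg_distrib, hI, hJ, hK]
  ring

/-! ### The decomposition into types -/

/-- The one-form which determines the `E`-part of a trilinear map. -/
def leeForm : Tri V →ₗ[ℂ] (V →ₗ[ℝ] ℂ) :=
  ((Module.finrank ℝ V : ℂ) - 2 - 8 / (Module.finrank ℝ V : ℂ))⁻¹ •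
    (tr₁₂ (V := V) - (Module.finrank ℝ V : ℂ)⁻¹ • tr₂₃ (V := V))

variable (T)

/-- The trace-free trilinear map of type `E` determined by a one-form. -/
def ofForm : (V →ₗ[ℝ] ℂ) →ₗ[ℂ] Tri V :=
  T.symOp ∘ₗ (outer (V := V)) - (8 / (Module.finrank ℝ V : ℂ)) • outer (V := V)

/-- The pure trace part of a trilinear map. -/
def tracePart : Tri V →ₗ[ℂ] Tri V := (Module.finrank ℝ V : ℂ)⁻¹ • (outer (V := V) ∘ₗ tr₂₃ (V := V))

/-- The part of a trilinear map on which all traces vanish. -/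
def traceFreePart : Tri V →ₗ[ℂ] Tri V :=
  LinearMap.id - tracePart - T.ofForm ∘ₗ leeForm

/-- The projections to the `Λ³₀E`-, `K`- and `E`-parts. -/
def proj : EType → (Tri V →ₗ[ℂ] Tri V)
  | .Λ₃ => (1 / 6 : ℂ) • ((2 : ℂ) • T.traceFreePart - T.symOp ∘ₗ T.traceFreePart)
  | .K => (1 / 6 : ℂ) • ((4 : ℂ) • T.traceFreePart + T.symOp ∘ₗ T.traceFreePart)
  | .E => T.ofForm ∘ₗ leeForm

/-- The trilinear maps of type `Λ³₀E`, `K`, `E`. -/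
def typeSpace : EType → Submodule ℂ (Tri V)
  | .Λ₃ => T.hSym ⊓ (LinearMap.ker tr₁₂ ⊓ (LinearMap.ker tr₂₃ ⊓
      LinearMap.ker (T.symOp + (4 : ℂ) • LinearMap.id)))
  | .K => T.hSym ⊓ (LinearMap.ker tr₁₂ ⊓ (LinearMap.ker tr₂₃ ⊓
      LinearMap.ker (T.symOp - (2 : ℂ) • LinearMap.id)))
  | .E => LinearMap.range T.ofForm

/-- The Λ³₀E- and K-projections are (2 - S)/6 and (4 + S)/6 of the trace-free part, and these two
factors add up to the identity. -/
theorem add_proj (τ : Tri V) :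
    τ = tracePart τ + (T.proj .Λ₃ τ + T.proj .K τ + T.proj .E τ) := by
  simp only [proj, traceFreePart, LinearMap.smul_apply, LinearMap.sub_apply, LinearMap.add_apply,
    LinearMap.comp_apply, LinearMap.id_apply]
  module

variable {T}

theorem ofForm_apply (θ : V →ₗ[ℝ] ℂ) : T.ofForm θ =
    T.symOp (outer θ) - (8 / (Module.finrank ℝ V : ℂ)) • outer θ := rfl

theorem ofForm_mem (θ : V →ₗ[ℝ] ℂ) : T.ofForm θ ∈ T.hSym :=
  sub_mem (symOp_mem _) (T.hSym.smul_mem _ (outer_mem _))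

theorem ofForm_comp_I (θ : V →ₗ[ℝ] ℂ) : T.ofForm θ ∘ₗ T.I = T.ofForm (θ ∘ₗ T.I) := by
  rw [ofForm_apply, ofForm_apply, ← outer_comp, symOp_comp_I (outer_mem _)]
  rfl

theorem rot_ofForm : T.rot.ofForm = T.ofForm := by
  rw [ofForm, ofForm, rot_symOp]

theorem rot_proj (w : EType) : T.rot.proj w = T.proj w := by
  cases w <;> simp only [proj, traceFreePart, rot_symOp, rot_ofForm]

theorem rot_typeSpace (w : EType) : T.rot.typeSpace w = T.typeSpace w := by
  cases w <;> simp only [typeSpace, rot_symOp, rot_ofForm, rot_hSym]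

theorem leeForm_apply (τ : Tri V) : leeForm τ =
    ((Module.finrank ℝ V : ℂ) - 2 - 8 / (Module.finrank ℝ V : ℂ))⁻¹ •
    (tr₁₂ τ - (Module.finrank ℝ V : ℂ)⁻¹ • tr₂₃ τ) := rfl

theorem leeForm_comp_I {τ : Tri V} (h : τ ∈ T.hSym) :
    leeForm (τ ∘ₗ T.I) = leeForm τ ∘ₗ T.I := by
  rw [leeForm_apply, leeForm_apply, tr₁₂_comp_I h, tr₂₃_comp]
  rfl

theorem traceFreePart_apply (τ : Tri V) : T.traceFreePart τ =
    τ - (Module.finrank ℝ V : ℂ)⁻¹ • outer (tr₂₃ τ) - T.ofForm (leeForm τ) := rfl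

theorem traceFreePart_mem {τ : Tri V} (h : τ ∈ T.hSym) : T.traceFreePart τ ∈ T.hSym :=
  sub_mem (sub_mem h (T.hSym.smul_mem _ (outer_mem _))) (ofForm_mem _)

theorem traceFreePart_comp_I {τ : Tri V} (h : τ ∈ T.hSym) :
    T.traceFreePart (τ ∘ₗ T.I) = T.traceFreePart τ ∘ₗ T.I := by
  rw [traceFreePart_apply, traceFreePart_apply, tr₂₃_comp, leeForm_comp_I h, ← outer_comp,
    ← ofForm_comp_I]
  rfl

/-- The projections are built from S and the two traces, all of which commute with the quaternions
in the first argument; hence the E-type of α, β, γ is also that of X, Y, Z. -/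
theorem proj_comp_I {τ : Tri V} (h : τ ∈ T.hSym) (w : EType) :
    T.proj w (τ ∘ₗ T.I) = T.proj w τ ∘ₗ T.I := by
  cases w
  · change (1 / 6 : ℂ) • ((2 : ℂ) • T.traceFreePart _ - T.symOp (T.traceFreePart _)) = _
    rw [traceFreePart_comp_I h, symOp_comp_I (traceFreePart_mem h)]
    rfl
  · change (1 / 6 : ℂ) • ((4 : ℂ) • T.traceFreePart _ + T.symOp (T.traceFreePart _)) = _
    rw [traceFreePart_comp_I h, symOp_comp_I (traceFreePart_mem h)]
    rfl
  · change T.ofForm (leeForm _) = _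
    rw [leeForm_comp_I h, ← ofForm_comp_I]
    rfl

theorem proj_comp_J {τ : Tri V} (h : τ ∈ T.hSym) (w : EType) :
    T.proj w (τ ∘ₗ T.J) = T.proj w τ ∘ₗ T.J := by
  rw [← rot_proj, ← rot_I, proj_comp_I (by rwa [rot_hSym])]

theorem proj_comp_K {τ : Tri V} (h : τ ∈ T.hSym) (w : EType) :
    T.proj w (τ ∘ₗ T.K) = T.proj w τ ∘ₗ T.K := by
  rw [← rot_proj, ← rot_J, proj_comp_J (by rwa [rot_hSym])]

section Dimension

theorem finrank_ne (h4 : 4 < Module.finrank ℝ V) : (Module.finrank ℝ V : ℂ) ≠ 0 := by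
  have : Module.finrank ℝ V ≠ 0 := by omega
  exact_mod_cast this

/-- With d the real dimension, d - 2 - 8/d = (d - 4)(d + 2)/d. The exclusion of d = 4 is what makes
one-forms recoverable from trace-free maps of type E. -/
theorem finrank_aux_ne (h4 : 4 < Module.finrank ℝ V) : (Module.finrank ℝ V : ℂ) - 2 - 8 / (Module.finrank ℝ V : ℂ) ≠ 0 := by
  have h0 := finrank_ne h4
  have h1 : (Module.finrank ℝ V : ℂ) - 4 ≠ 0 := by
    rw [sub_ne_zero]
    have : Module.finrank ℝ V ≠ 4 := by omega
    exact_mod_cast this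
  have h2 : (Module.finrank ℝ V : ℂ) + 2 ≠ 0 := by
    have : Module.finrank ℝ V + 2 ≠ 0 := by omega
    exact_mod_cast this
  have h3 : (Module.finrank ℝ V : ℂ) - 2 - 8 / (Module.finrank ℝ V : ℂ)
      = ((Module.finrank ℝ V : ℂ) - 4) * ((Module.finrank ℝ V : ℂ) + 2)
        / (Module.finrank ℝ V : ℂ) := by
    field_simp
    ring
  rw [h3]
  exact div_ne_zero (mul_ne_zero h1 h2) h0

/-- The coefficient 8/d in `ofForm` is chosen for this cancellation. -/
theorem tr₂₃_ofForm (h4 : 4 < Module.finrank ℝ V) (θ : V →ₗ[ℝ] ℂ) : tr₂₃ (T.ofForm θ) = 0 := by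
  have h0 := finrank_ne h4
  rw [ofForm_apply, map_sub, map_smul, tr₂₃_symOp (outer_mem _), tr₂₃_outer, tr₁₂_outer,
    smul_smul, div_mul_cancel₀ _ h0, sub_self]

theorem tr₁₂_ofForm (θ : V →ₗ[ℝ] ℂ) : tr₁₂ (T.ofForm θ) =
    ((Module.finrank ℝ V : ℂ) - 2 - 8 / (Module.finrank ℝ V : ℂ)) • θ := by
  rw [ofForm_apply, map_sub, map_smul, tr₁₂_symOp (outer_mem _), tr₂₃_outer, tr₁₂_outer]
  module

theorem tr₁₂_traceFreePart (h4 : 4 < Module.finrank ℝ V) (τ : Tri V) : tr₁₂ (T.traceFreePart τ) = 0 := by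
  rw [traceFreePart_apply, map_sub, map_sub, map_smul, tr₁₂_ofForm, tr₁₂_outer, leeForm_apply,
    smul_inv_smul₀ (finrank_aux_ne h4)]
  module

theorem tr₂₃_traceFreePart (h4 : 4 < Module.finrank ℝ V) (τ : Tri V) : tr₂₃ (T.traceFreePart τ) = 0 := by
  rw [traceFreePart_apply, map_sub, map_sub, map_smul, tr₂₃_ofForm h4, tr₂₃_outer, smul_smul,
    inv_mul_cancel₀ (finrank_ne h4)]
  module

/-- The trace formulas show that S preserves vanishing of both traces. The factors 2 - S and 4 + S
then produce eigenvectors because (S + 4)(2 - S) = 0. -/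
theorem proj_mem (h4 : 4 < Module.finrank ℝ V) {τ : Tri V} (h : τ ∈ T.hSym) (w : EType) : T.proj w τ ∈ T.typeSpace w := by
  have hm := traceFreePart_mem h
  have s1 := tr₁₂_symOp hm
  have s2 := tr₂₃_symOp hm
  rw [tr₁₂_traceFreePart h4, tr₂₃_traceFreePart h4] at s1
  rw [tr₁₂_traceFreePart h4] at s2
  cases w
  · change (1 / 6 : ℂ) • ((2 : ℂ) • T.traceFreePart τ - T.symOp (T.traceFreePart τ)) ∈ _
    refine ⟨T.hSym.smul_mem _ (sub_mem (T.hSym.smul_mem _ hm) (symOp_mem _)), ?_, ?_, ?_⟩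
    · simp [s1, tr₁₂_traceFreePart h4]
    · simp [s2, tr₂₃_traceFreePart h4]
    · change T.symOp _ + (4 : ℂ) • _ = 0
      simp only [map_smul, map_sub, symOp_symOp hm]
      module
  · change (1 / 6 : ℂ) • ((4 : ℂ) • T.traceFreePart τ + T.symOp (T.traceFreePart τ)) ∈ _
    refine ⟨T.hSym.smul_mem _ (add_mem (T.hSym.smul_mem _ hm) (symOp_mem _)), ?_, ?_, ?_⟩
    · simp [s1, tr₁₂_traceFreePart h4]
    · simp [s2, tr₂₃_traceFreePart h4]
    · change T.symOp _ - (2 : ℂ) • _ = 0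
      simp only [map_smul, map_add, symOp_symOp hm]
      module
  · exact ⟨_, rfl⟩

theorem typeSpace_tr₂₃ (h4 : 4 < Module.finrank ℝ V) {τ : Tri V} {w : EType} (h : τ ∈ T.typeSpace w) : tr₂₃ τ = 0 := by
  cases w
  · exact h.2.2.1
  · exact h.2.2.1
  · obtain ⟨θ, rfl⟩ := h
    exact tr₂₃_ofForm h4 θ

theorem typeSpace_le (w : EType) : T.typeSpace w ≤ T.hSym := by
  cases w
  · exact inf_le_left
  · exact inf_le_left
  · rintro _ ⟨θ, rfl⟩
    exact ofForm_mem θ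

theorem typeSpace_comp_I {τ : Tri V} {w : EType} (h : τ ∈ T.typeSpace w) :
    τ ∘ₗ T.I ∈ T.typeSpace w := by
  have hm := typeSpace_le w h
  cases w
  · obtain ⟨-, h1, h2, h3⟩ := h
    refine ⟨hSym.comp hm _, ?_, ?_, ?_⟩
    · simp [tr₁₂_comp_I hm, LinearMap.mem_ker.1 h1]
    · simp [tr₂₃_comp, LinearMap.mem_ker.1 h2]
    · replace h3 : T.symOp τ + (4 : ℂ) • τ = 0 := h3
      change T.symOp (τ ∘ₗ T.I) + (4 : ℂ) • (τ ∘ₗ T.I) = 0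
      rw [symOp_comp_I hm, ← LinearMap.smul_comp, ← LinearMap.add_comp, h3, LinearMap.zero_comp]
  · obtain ⟨-, h1, h2, h3⟩ := h
    refine ⟨hSym.comp hm _, ?_, ?_, ?_⟩
    · simp [tr₁₂_comp_I hm, LinearMap.mem_ker.1 h1]
    · simp [tr₂₃_comp, LinearMap.mem_ker.1 h2]
    · replace h3 : T.symOp τ - (2 : ℂ) • τ = 0 := h3
      change T.symOp (τ ∘ₗ T.I) - (2 : ℂ) • (τ ∘ₗ T.I) = 0
      rw [symOp_comp_I hm, ← LinearMap.smul_comp, ← LinearMap.sub_comp, h3, LinearMap.zero_comp]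
  · obtain ⟨θ, rfl⟩ := h
    exact ⟨θ ∘ₗ T.I, (ofForm_comp_I θ).symm⟩

theorem typeSpace_comp_J {τ : Tri V} {w : EType} (h : τ ∈ T.typeSpace w) :
    τ ∘ₗ T.J ∈ T.typeSpace w := by
  rw [← rot_typeSpace] at h ⊢
  exact typeSpace_comp_I h

theorem typeSpace_comp_K {τ : Tri V} {w : EType} (h : τ ∈ T.typeSpace w) :
    τ ∘ₗ T.K ∈ T.typeSpace w := by
  rw [← rot_typeSpace] at h ⊢
  exact typeSpace_comp_J h

/-! ### Consequences of eigenvalue equations -/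

/-- Taking `tr₁₂` of Su = 2u gives the trace relation. It makes every trace correction to u a
combination of η ⊗ g and S(η ⊗ g) with the single one-form η = `tr₁₂ u`, g being the metric, and 2 -
S annihilates the corrected map. -/
theorem of_symOp_eq_two (h4 : 4 < Module.finrank ℝ V) {u : Tri V} (hu : u ∈ T.hSym) (h : T.symOp u = (2 : ℂ) • u) :
    T.proj .Λ₃ u = 0 ∧ tr₂₃ u = (4 : ℂ) • tr₁₂ u := by
  have hq : tr₂₃ u = (4 : ℂ) • tr₁₂ u := by
    have := tr₁₂_symOp hu
    rw [h, map_smul] at this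
    rw [← sub_add_cancel (tr₂₃ u) ((2 : ℂ) • tr₁₂ u), ← this]
    module
  refine ⟨?_, hq⟩
  have h0 := finrank_ne h4
  have h1 := finrank_aux_ne h4
  change (1 / 6 : ℂ) • ((2 : ℂ) • T.traceFreePart u - T.symOp (T.traceFreePart u)) = 0
  simp only [traceFreePart_apply, leeForm_apply, hq, ofForm_apply, map_sub, map_smul, h,
    symOp_symOp (outer_mem _)]
  generalize T.symOp (outer (tr₁₂ u)) = s
  generalize outer (tr₁₂ u) = t
  -- The nonvanishing constant with its denominator cleared, in the form needed to clear fractions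
  -- in the two coefficients below.
  have h2 : (Module.finrank ℝ V : ℂ) * ((Module.finrank ℝ V : ℂ) - 2) - 8 ≠ 0 := by
    intro h2
    apply h1
    field_simp
    linear_combination h2
  match_scalars <;> field_simp <;> ring

/-- The same argument for the other eigenvalue: `tr₁₂` of Su = -4u gives the trace relation, and 4 +
S annihilates the trace-corrected map. -/
theorem of_symOp_eq_neg_four (h4 : 4 < Module.finrank ℝ V) {u : Tri V} (hu : u ∈ T.hSym) (h : T.symOp u = (-4 : ℂ) • u) :
    T.proj .K u = 0 ∧ tr₂₃ u = (-2 : ℂ) • tr₁₂ u := by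
  have hq : tr₂₃ u = (-2 : ℂ) • tr₁₂ u := by
    have := tr₁₂_symOp hu
    rw [h, map_smul] at this
    rw [← sub_add_cancel (tr₂₃ u) ((2 : ℂ) • tr₁₂ u), ← this]
    module
  refine ⟨?_, hq⟩
  have h0 := finrank_ne h4
  have h1 := finrank_aux_ne h4
  change (1 / 6 : ℂ) • ((4 : ℂ) • T.traceFreePart u + T.symOp (T.traceFreePart u)) = 0
  simp only [traceFreePart_apply, leeForm_apply, hq, ofForm_apply, map_sub, map_smul, h,
    symOp_symOp (outer_mem _)]
  generalize T.symOp (outer (tr₁₂ u)) = s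
  generalize outer (tr₁₂ u) = t
  have h2 : (Module.finrank ℝ V : ℂ) * ((Module.finrank ℝ V : ℂ) - 2) - 8 ≠ 0 := by
    intro h2
    apply h1
    field_simp
    linear_combination h2
  match_scalars <;> field_simp <;> ring

/-- Here the traces are (d - 2)ζ and 8ζ, so `leeForm v` is ζ itself and v is the sum of a pure trace
and `ofForm ζ`; nothing of type Λ³₀E or K remains. -/
theorem of_eq_symOp_outer (h4 : 4 < Module.finrank ℝ V) {v : Tri V} {ζ : V →ₗ[ℝ] ℂ} (h : v = T.symOp (outer ζ)) :
    T.proj .Λ₃ v = 0 ∧ T.proj .K v = 0 ∧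
      ((Module.finrank ℝ V : ℂ) - 2) • tr₂₃ v = (8 : ℂ) • tr₁₂ v := by
  have h0 := finrank_ne h4
  have h1 := finrank_aux_ne h4
  have hp : tr₁₂ v = ((Module.finrank ℝ V : ℂ) - 2) • ζ := by
    rw [h, tr₁₂_symOp (outer_mem _), tr₂₃_outer, tr₁₂_outer]
    module
  have hq : tr₂₃ v = (8 : ℂ) • ζ := by
    rw [h, tr₂₃_symOp (outer_mem _), tr₁₂_outer]
  have hl : leeForm v = ζ := by
    rw [leeForm_apply, hp, hq]
    have e : ((Module.finrank ℝ V : ℂ) - 2) • ζ - (Module.finrank ℝ V : ℂ)⁻¹ • (8 : ℂ) • ζ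
        = ((Module.finrank ℝ V : ℂ) - 2 - 8 / (Module.finrank ℝ V : ℂ)) • ζ := by
      module
    rw [e, inv_smul_smul₀ h1]
  have ht : T.traceFreePart v = 0 := by
    rw [traceFreePart_apply, hl, hq, ofForm_apply, h, map_smul]
    module
  refine ⟨by simp [proj, ht], by simp [proj, ht], ?_⟩
  rw [hp, hq]
  module

end Dimension

end Traces

end Triple

/-! ### Isotypic components and coordinates of quaternions. -/

/-- An equivariant map carries isotypic components to isotypic components. -/
theorem map_mem_isotypic {G W X Y : Type*} [Group G] [AddCommGroup W] [Module ℂ W]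
    [AddCommGroup X] [Module ℂ X] [AddCommGroup Y] [Module ℂ Y] {ρ : Representation ℂ G W}
    {σ : Representation ℂ G X} {σ' : Representation ℂ G Y} (f : X →ₗ[ℂ] Y)
    (hf : ∀ g x, f (σ g x) = σ' g (f x)) {x : X} (hx : x ∈ isotypic ρ σ) :
    f x ∈ isotypic ρ σ' := by
  have : isotypic ρ σ ≤ (isotypic ρ σ').comap f := by
    refine iSup_le fun k => ?_
    rintro _ ⟨w, rfl⟩
    let k' : Representation.IntertwiningMap ρ σ' :=
      LinearMap.intertwiningMap_of_isIntertwiningMap ρ σ' (f ∘ₗ k.toLinearMap) (fun g v => by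
        have := congrArg (fun l => l v) (k.isIntertwining' g)
        simp only [LinearMap.comp_apply] at this ⊢
        rw [this, hf])
    exact Submodule.mem_iSup_of_mem k' ⟨w, rfl⟩
  exact this hx

/-! ### The standard basis of the quaternions -/

/-- The standard basis `1, i, j, k` of the quaternions. -/
def qBasis : Fin 4 → ℍ[ℝ] := ![⟨1, 0, 0, 0⟩, ⟨0, 1, 0, 0⟩, ⟨0, 0, 1, 0⟩, ⟨0, 0, 0, 1⟩]

@[simp] theorem qBasis_re (a : Fin 4) : (qBasis a).re = (![1, 0, 0, 0] : Fin 4 → ℝ) a := by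
  fin_cases a <;> rfl

@[simp] theorem qBasis_imI (a : Fin 4) : (qBasis a).imI = (![0, 1, 0, 0] : Fin 4 → ℝ) a := by
  fin_cases a <;> rfl

@[simp] theorem qBasis_imJ (a : Fin 4) : (qBasis a).imJ = (![0, 0, 1, 0] : Fin 4 → ℝ) a := by
  fin_cases a <;> rfl

@[simp] theorem qBasis_imK (a : Fin 4) : (qBasis a).imK = (![0, 0, 0, 1] : Fin 4 → ℝ) a := by
  fin_cases a <;> rfl

/-- The coordinates of a quaternion. -/
def qCoord (q : ℍ[ℝ]) : Fin 4 → ℝ := ![q.re, q.imI, q.imJ, q.imK]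

theorem sum_qCoord (q : ℍ[ℝ]) : ∑ c, qCoord q c • qBasis c = q := by
  ext <;> simp [Fin.sum_univ_four, qCoord]

/-- Right multiplication by `q̄` is adjoint to right multiplication by `q`. -/
theorem qCoord_mul_star (q : ℍ[ℝ]) (a c : Fin 4) :
    qCoord (qBasis a * star q) c = qCoord (qBasis c * q) a := by
  fin_cases a <;> fin_cases c <;> simp [qCoord]

theorem sp1_normSq (q : Sp1) : (q : ℍ[ℝ]).re ^ 2 + (q : ℍ[ℝ]).imI ^ 2 + (q : ℍ[ℝ]).imJ ^ 2
    + (q : ℍ[ℝ]).imK ^ 2 = 1 := by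
  have h := (Unitary.mem_iff.1 q.2).2
  have := congrArg QuaternionAlgebra.re h
  rw [Quaternion.re_mul] at this
  simp only [Quaternion.re_star, Quaternion.imI_star, Quaternion.imJ_star, Quaternion.imK_star,
    Quaternion.re_one] at this
  linear_combination this

/-! ### Intertwining maps from E-forms and H-forms to tensors on V. -/

namespace Triple

variable {V : Type*} [NormedAddCommGroup V] [InnerProductSpace ℝ V] (T : Triple V)

theorem repV_inv_apply (g : T.SpN) (q : Sp1) (v : V) :
    T.repV (g, q)⁻¹ v = T.repN g⁻¹ (T.quat (star (q : ℍ[ℝ])) v) := rfl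

theorem repN_K (g : T.SpN) (v : V) : T.repN g (T.K v) = T.K (T.repN g v) := by
  rw [← T.I_J, repN_I, repN_J, T.I_J]

theorem repN_quat (g : T.SpN) (q : ℍ[ℝ]) (v : V) :
    T.repN g (T.quat q v) = T.quat q (T.repN g v) := by
  simp [quat_apply, repN_I, repN_J, repN_K]

/-- The full contraction of a form on `V` with a form on `ℍ`. -/
def contract {s : ℕ} (G : CForm V s) (φ : CForm ℍ[ℝ] s) : CForm V s :=
  ∑ a : Fin s → Fin 4, φ (fun i => qBasis (a i)) •
    G.compLinearMap (fun i => T.quat (qBasis 2 * qBasis (a i)))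

theorem contract_apply {s : ℕ} (G : CForm V s) (φ : CForm ℍ[ℝ] s) (v : Fin s → V) :
    T.contract G φ v = ∑ a : Fin s → Fin 4, φ (fun i => qBasis (a i)) *
      G (fun i => T.quat (qBasis 2 * qBasis (a i)) (v i)) := by
  simp [contract]

/-- Sp(n) commutes with the quaternions, so only q matters. Expanding in the standard basis, the
matrix acting on φ and the one acting on G are transposes of each other (`qCoord_mul_star`), and the
two double sums coincide after exchanging summation indices. -/
theorem contract_tensorRep {s : ℕ} (G : CForm V s) (φ : CForm ℍ[ℝ] s) (g : T.SpN) (q : Sp1) :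
    T.contract (tensorRep T.repN s g G) (tensorRep repH s q φ)
      = tensorRep T.repV s (g, q) (T.contract G φ) := by
  ext v
  rw [contract_apply, tensorRep_apply, contract_apply]
  have h1 : ∀ a : Fin s → Fin 4, tensorRep repH s q φ (fun i => qBasis (a i)) =
      ∑ c : Fin s → Fin 4, ((∏ i, qCoord (qBasis (a i) * q) (c i) : ℝ) : ℂ) *
        φ (fun i => qBasis (c i)) := by
    intro a
    have : ∀ i, repH q⁻¹ (qBasis (a i)) = ∑ c, qCoord (qBasis (a i) * q) c • qBasis c := by
      intro i
      rw [sum_qCoord]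
      change qBasis (a i) * star (star (q : ℍ[ℝ])) = _
      rw [star_star]
    rw [tensorRep_apply]
    simp only [this, MultilinearMap.map_sum, MultilinearMap.map_smul_univ, Complex.real_smul]
  have h2 : ∀ c : Fin s → Fin 4,
      G (fun i => T.quat (qBasis 2 * qBasis (c i)) (T.repV (g, q)⁻¹ (v i))) =
      ∑ a : Fin s → Fin 4, ((∏ i, qCoord (qBasis (a i) * q) (c i) : ℝ) : ℂ) *
        tensorRep T.repN s g G (fun i => T.quat (qBasis 2 * qBasis (a i)) (v i)) := by
    intro c
    have : ∀ i, T.quat (qBasis 2 * qBasis (c i)) (T.repV (g, q)⁻¹ (v i)) =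
        ∑ a, qCoord (qBasis a * q) (c i) •
          T.repN g⁻¹ (T.quat (qBasis 2 * qBasis a) (v i)) := by
      intro i
      rw [repV_inv_apply, ← repN_quat, ← Module.End.mul_apply (T.quat _) (T.quat _), ← map_mul,
        mul_assoc]
      conv_lhs => rw [← sum_qCoord (qBasis (c i) * star (q : ℍ[ℝ]))]
      simp only [Finset.mul_sum, mul_smul_comm, map_sum, map_smul, LinearMap.sum_apply,
        LinearMap.smul_apply, qCoord_mul_star]
    simp only [this, MultilinearMap.map_sum, MultilinearMap.map_smul_univ, Complex.real_smul,
      tensorRep_apply]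
  simp only [h1, h2, Finset.sum_mul, Finset.mul_sum]
  rw [Finset.sum_comm]
  refine Finset.sum_congr rfl fun c _ => Finset.sum_congr rfl fun a _ => ?_
  ring

/-- An equivariant bilinear map lands in the component. -/
theorem mem_component_of_bilinear {W S : Type*} [AddCommGroup W] [Module ℂ W] [AddCommGroup S]
    [Module ℂ S] {σ : Representation ℂ T.SpN W} {τ : Representation ℂ Sp1 S} {s : ℕ}
    (f : W →ₗ[ℂ] S →ₗ[ℂ] CForm V s)
    (hf : ∀ g q w φ, f (σ g w) (τ q φ) = tensorRep T.repV s (g, q) (f w φ)) (w : W) (φ : S) :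
    f w φ ∈ T.component σ τ s := by
  let k : Representation.IntertwiningMap (Representation.tprod (σ.comp (MonoidHom.fst T.SpN Sp1))
    (τ.comp (MonoidHom.snd T.SpN Sp1))) (tensorRep T.repV s) :=
    LinearMap.intertwiningMap_of_isIntertwiningMap _ _ (TensorProduct.lift f) (by
      rintro ⟨g, q⟩ v
      induction v using TensorProduct.induction_on with
      | zero => simp
      | tmul w φ =>
        rw [Representation.tprod_apply, TensorProduct.map_tmul, TensorProduct.lift.tmul,
          TensorProduct.lift.tmul]
        exact hf g q w φ
      | add x y hx hy => simp only [map_add, hx, hy])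
  refine Submodule.mem_iSup_of_mem k ⟨w ⊗ₜ φ, ?_⟩
  exact TensorProduct.lift.tmul _ _

/-- Equivariance makes the contraction an intertwining map on W ⊗ SˢH, and the component is by
definition the sum of all images of such maps. -/
theorem contract_mem_component {W : Type*} [AddCommGroup W] [Module ℂ W]
    {σ : Representation ℂ T.SpN W} {s : ℕ} (ι : W →ₗ[ℂ] CForm V s)
    (hι : ∀ g w, ι (σ g w) = tensorRep T.repN s g (ι w)) (w : W) {φ : CForm ℍ[ℝ] s}
    (hφ : φ ∈ (SymH s).toSubmodule) :
    T.contract (ι w) φ ∈ T.component σ (SymH s).toRepresentation s := by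
  let f : W →ₗ[ℂ] (SymH s).toSubmodule →ₗ[ℂ] CForm V s :=
    LinearMap.mk₂ ℂ (fun w φ => T.contract (ι w) (φ : CForm ℍ[ℝ] s))
      (by intros; ext v; simp [contract_apply, mul_add, Finset.sum_add_distrib])
      (by intros; ext v; simp [contract_apply, Finset.mul_sum, mul_left_comm])
      (by intros; ext v; simp [contract_apply, add_mul, Finset.sum_add_distrib])
      (by intros; ext v; simp [contract_apply, Finset.mul_sum, mul_assoc])
  refine T.mem_component_of_bilinear f (fun g q w φ => ?_) w ⟨φ, hφ⟩
  change T.contract (ι (σ g w)) (tensorRep repH s q φ) = _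
  rw [hι, contract_tensorRep]
  rfl

/-! ### Complex forms -/

/-- Multiplication by a complex number, for the complex structure `I`. -/
def cAct (c : ℂ) : Module.End ℝ V := c.re • 1 + c.im • T.I

theorem cAct_apply (c : ℂ) (v : V) : T.cAct c v = c.re • v + c.im • T.I v := rfl

variable {T}

theorem _root_.AQH.IsComplexForm.cAct {s : ℕ} {G : CForm V s} (hG : IsComplexForm T.I G)
    (c : Fin s → ℂ) (v : Fin s → V) : G (fun i => T.cAct (c i) (v i)) = (∏ i, c i) * G v := by
  classical
  have h1 : ∀ (i : Fin s) (c : ℂ) (v : Fin s → V),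
      G (Function.update v i (T.cAct c (v i))) = c * G v := by
    intro i c v
    rw [cAct_apply, MultilinearMap.map_update_add, MultilinearMap.map_update_smul,
      MultilinearMap.map_update_smul, hG i v, Function.update_eq_self, Complex.real_smul,
      Complex.real_smul]
    conv_rhs => rw [← Complex.re_add_im c]
    ring
  -- Scalars are pulled out one slot at a time, by induction on the set of slots already treated.
  have h2 : ∀ t : Finset (Fin s), G (fun i => if i ∈ t then T.cAct (c i) (v i) else v i) =
      (∏ i ∈ t, c i) * G v := by
    intro t
    induction t using Finset.induction_on with
    | empty => simp
    | insert i t hi ih =>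
      rw [Finset.prod_insert hi, mul_assoc, ← ih, ← h1 i (c i)]
      congr 1
      ext j
      by_cases hj : j = i
      · subst hj; simp [hi]
      · simp [hj]
  simpa using h2 Finset.univ

/-- The complex-linear form `ζ = z + wj ↦ bz - aw` on the quaternions. -/
def linForm (a b : ℝ) : ℍ[ℝ] →ₗ[ℝ] ℂ where
  toFun ζ := b * (ζ.re + ζ.imI * Complex.I) - a * (ζ.imJ + ζ.imK * Complex.I)
  map_add' ζ ξ := by simp; ring
  map_smul' c ζ := by simp; ring

theorem linForm_apply (a b : ℝ) (ζ : ℍ[ℝ]) : linForm a b ζ =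
    b * (ζ.re + ζ.imI * Complex.I) - a * (ζ.imJ + ζ.imK * Complex.I) := rfl

theorem linForm_leftI (a b : ℝ) (ζ : ℍ[ℝ]) :
    linForm a b (leftI ζ) = Complex.I * linForm a b ζ := by
  have h : leftI ζ = qBasis 1 * ζ := rfl
  rw [h]
  simp [linForm_apply]
  linear_combination (-b * ζ.imI + a * ζ.imK) * Complex.I_mul_I

/-- The power of a linear form. -/
def powForm (s : ℕ) (a b : ℝ) : CForm ℍ[ℝ] s :=
  (MultilinearMap.mkPiAlgebra ℝ (Fin s) ℂ).compLinearMap (fun _ => linForm a b)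

theorem powForm_apply (s : ℕ) (a b : ℝ) (v : Fin s → ℍ[ℝ]) :
    powForm s a b v = ∏ i, linForm a b (v i) := rfl

theorem powForm_mem (s : ℕ) (a b : ℝ) : powForm s a b ∈ (SymH s).toSubmodule := by
  classical
  refine ⟨fun i v => ?_, fun p v => ?_⟩
  · rw [powForm_apply, powForm_apply, ← Finset.mul_prod_erase _ _ (Finset.mem_univ i),
      ← Finset.mul_prod_erase _ (fun i => linForm a b (v i)) (Finset.mem_univ i),
      Function.update_self, linForm_leftI, mul_assoc]
    congr 2
    refine Finset.prod_congr rfl fun j hj => ?_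
    rw [Function.update_of_ne (Finset.ne_of_mem_erase hj)]
  · rw [powForm_apply, powForm_apply]
    exact Equiv.prod_comp p (fun i => linForm a b (v i))

/-- The endomorphism `a + bJ`. -/
def real1J (T : Triple V) (a b : ℝ) : Module.End ℝ V := a • 1 + b • T.J

theorem real1J_apply (a b : ℝ) (v : V) : T.real1J a b v = a • v + b • T.J v := rfl

/-- This is why the contraction carries the extra factor j = `qBasis 2`: both forms are complex
linear, so without a factor anticommuting with i the contributions of p and ip would cancel. -/
theorem sum_cAct (a b : ℝ) (v : V) :
    ∑ c, T.cAct (linForm a b (qBasis c)) (T.quat (qBasis 2 * qBasis c) v) =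
      (2 : ℝ) • T.real1J a b v := by
  simp [Fin.sum_univ_four, linForm_apply, cAct_apply, quat_apply, real1J_apply]
  module

/-- Complex linearity moves the factors of the power into the slots of G, and multilinearity then
turns the sum over multi-indices into a sum in each slot. -/
theorem contract_powForm {s : ℕ} {G : CForm V s} (hG : IsComplexForm T.I G) (a b : ℝ) :
    T.contract G (powForm s a b) = (2 : ℂ) ^ s • G.compLinearMap (fun _ => T.real1J a b) := by
  ext v
  rw [contract_apply]
  simp only [powForm_apply, ← hG.cAct]
  rw [← MultilinearMap.map_sum G
    (fun i c => T.cAct (linForm a b (qBasis c)) (T.quat (qBasis 2 * qBasis c) (v i)))]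
  simp only [sum_cAct, MultilinearMap.map_smul_univ]
  simp

/-- Powers of linear forms suffice for what follows: membership for all real a, b gives, by
polarization, membership of each homogeneous part in a and b. -/
theorem comp_real1J_mem_component {W : Type*} [AddCommGroup W] [Module ℂ W]
    {σ : Representation ℂ T.SpN W} {s : ℕ} (ι : W →ₗ[ℂ] CForm V s)
    (hι : ∀ g w, ι (σ g w) = tensorRep T.repN s g (ι w)) (w : W)
    (hw : IsComplexForm T.I (ι w)) (a b : ℝ) :
    (ι w).compLinearMap (fun _ => T.real1J a b) ∈ T.component σ (SymH s).toRepresentation s := by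
  have h := T.contract_mem_component ι hι w (powForm_mem s a b)
  rw [contract_powForm hw] at h
  have h' := Submodule.smul_mem _ ((2 : ℂ) ^ s)⁻¹ h
  rwa [inv_smul_smul₀ (pow_ne_zero _ two_ne_zero)] at h'

end Triple

/-! ### The equivariant map from two-tensors to four-forms defined by the fundamental form. -/

/-- The product of two bilinear maps as a tensor of degree four. -/
def prodForm {V : Type*} [AddCommGroup V] [Module ℝ V] (B C : V →ₗ[ℝ] V →ₗ[ℝ] ℂ) : CForm V 4 :=
  MultilinearMap.mk' (fun v => B (v 0) (v 1) * C (v 2) (v 3))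
    (by intro v i x y; fin_cases i <;> simp [Function.update] <;> ring)
    (by intro v i c x; fin_cases i <;> simp [Function.update] <;> ring)

theorem prodForm_apply {V : Type*} [AddCommGroup V] [Module ℝ V] (B C : V →ₗ[ℝ] V →ₗ[ℝ] ℂ)
    (v : Fin 4 → V) : prodForm B C v = B (v 0) (v 1) * C (v 2) (v 3) := rfl

theorem update_zero_vec2 {α : Type*} (x y u : α) : Function.update ![x, y] 0 u = ![u, y] := by
  funext i; fin_cases i <;> rfl

theorem update_one_vec2 {α : Type*} (x y u : α) : Function.update ![x, y] 1 u = ![x, u] := by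
  funext i; fin_cases i <;> rfl

/-- A tensor of degree two as a bilinear map. -/
def toBilin {V : Type*} [AddCommGroup V] [Module ℝ V] : CForm V 2 →ₗ[ℂ] (V →ₗ[ℝ] V →ₗ[ℝ] ℂ) where
  toFun G := LinearMap.mk₂ ℝ (fun x y => G ![x, y])
    (fun x x' y => by
      have := G.map_update_add ![x, y] 0 x x'
      rwa [update_zero_vec2, update_zero_vec2, update_zero_vec2] at this)
    (fun c x y => by
      have := G.map_update_smul ![x, y] 0 c x
      rwa [update_zero_vec2, update_zero_vec2] at this)
    (fun x y y' => by
      have := G.map_update_add ![x, y] 1 y y'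
      rwa [update_one_vec2, update_one_vec2, update_one_vec2] at this)
    (fun c x y => by
      have := G.map_update_smul ![x, y] 1 c y
      rwa [update_one_vec2, update_one_vec2] at this)
  map_add' G G' := by ext; simp
  map_smul' c G := by ext; simp

theorem toBilin_apply {V : Type*} [AddCommGroup V] [Module ℝ V] (G : CForm V 2) (x y : V) :
    toBilin G x y = G ![x, y] := rfl

/-- The sum over the shuffles of type `(2, 2)`, with signs. -/
def shuffle {V : Type*} [AddCommGroup V] [Module ℝ V] : CForm V 4 →ₗ[ℂ] CForm V 4 where
  toFun F := F - F.domDomCongr ⟨![0, 2, 1, 3], ![0, 2, 1, 3], by decide, by decide⟩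
    + F.domDomCongr ⟨![0, 3, 1, 2], ![0, 2, 3, 1], by decide, by decide⟩
    + F.domDomCongr ⟨![1, 2, 0, 3], ![2, 0, 1, 3], by decide, by decide⟩
    - F.domDomCongr ⟨![1, 3, 0, 2], ![2, 0, 3, 1], by decide, by decide⟩
    + F.domDomCongr ⟨![2, 3, 0, 1], ![2, 3, 0, 1], by decide, by decide⟩
  map_add' F F' := by ext v; simp; ring
  map_smul' c F := by ext v; simp; ring

theorem shuffle_apply {V : Type*} [AddCommGroup V] [Module ℝ V] (F : CForm V 4) (v : Fin 4 → V) :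
    shuffle F v = F v - F ![v 0, v 2, v 1, v 3] + F ![v 0, v 3, v 1, v 2]
      + F ![v 1, v 2, v 0, v 3] - F ![v 1, v 3, v 0, v 2] + F ![v 2, v 3, v 0, v 1] := by
  simp only [shuffle, LinearMap.coe_mk, AddHom.coe_mk, add_apply, sub_apply,
    MultilinearMap.domDomCongr_apply]
  congr <;> · ext i; fin_cases i <;> rfl

namespace Triple

variable {V : Type*} [NormedAddCommGroup V] [InnerProductSpace ℝ V] (T : Triple V)

/-- The bilinear form `⟨x, Ay⟩`, with complex values. -/
def kForm (A : Module.End ℝ V) : V →ₗ[ℝ] V →ₗ[ℝ] ℂ :=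
  LinearMap.mk₂ ℝ (fun x y => ((inner ℝ x (A y) : ℝ) : ℂ))
    (by intros; simp only [inner_add_left]; push_cast; ring)
    (by intros; simp only [real_inner_smul_left, Complex.real_smul]; push_cast; ring)
    (by intros; simp only [map_add, inner_add_right]; push_cast; ring)
    (by intros; simp only [map_smul, real_inner_smul_right, Complex.real_smul]; push_cast; ring)

theorem kForm_apply (A : Module.End ℝ V) (x y : V) :
    kForm A x y = ((inner ℝ x (A y) : ℝ) : ℂ) := rfl

/-- The skew part of `G(·, A·)`, up to a factor. -/
def skewComp (A : Module.End ℝ V) (B : V →ₗ[ℝ] V →ₗ[ℝ] ℂ) : V →ₗ[ℝ] V →ₗ[ℝ] ℂ :=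
  B.compl₂ A - (B.compl₂ A).flip

theorem skewComp_apply (A : Module.End ℝ V) (B : V →ₗ[ℝ] V →ₗ[ℝ] ℂ) (x y : V) :
    skewComp A B x y = B x (A y) - B y (A x) := rfl

/-- The equivariant map from two-forms to four-forms given by the derivation action on the
fundamental form. -/
def fourMap : CForm V 2 →ₗ[ℂ] CForm V 4 where
  toFun G := shuffle (prodForm (skewComp T.I (toBilin G)) (kForm T.I)
    + prodForm (skewComp T.J (toBilin G)) (kForm T.J)
    + prodForm (skewComp T.K (toBilin G)) (kForm T.K))
  map_add' F F' := by
    rw [← map_add]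
    congr 1
    ext v
    simp only [add_apply, prodForm_apply, skewComp_apply, map_add, LinearMap.add_apply]
    ring
  map_smul' c F := by
    rw [RingHom.id_apply, ← map_smul]
    congr 1
    ext v
    simp only [add_apply, prodForm_apply, skewComp_apply, map_smul, LinearMap.smul_apply,
      smul_apply, smul_eq_mul]
    ring

/-- The pairing of a two-tensor with the fundamental form, before alternation. -/
def pairing (G : CForm V 2) (a b c d : V) : ℂ :=
  (G ![a, T.I b] - G ![b, T.I a]) * (inner ℝ c (T.I d) : ℝ)
    + (G ![a, T.J b] - G ![b, T.J a]) * (inner ℝ c (T.J d) : ℝ)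
    + (G ![a, T.K b] - G ![b, T.K a]) * (inner ℝ c (T.K d) : ℝ)

theorem fourMap_apply (G : CForm V 2) (v : Fin 4 → V) : T.fourMap G v =
    T.pairing G (v 0) (v 1) (v 2) (v 3) - T.pairing G (v 0) (v 2) (v 1) (v 3)
    + T.pairing G (v 0) (v 3) (v 1) (v 2) + T.pairing G (v 1) (v 2) (v 0) (v 3)
    - T.pairing G (v 1) (v 3) (v 0) (v 2) + T.pairing G (v 2) (v 3) (v 0) (v 1) :=
  shuffle_apply _ v

/-- The element `∑_A A ⊗ A` commutes with the action of quaternions. -/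
theorem sum_conj (b : V →ₗ[ℝ] V →ₗ[ℝ] ℂ) (p : ℍ[ℝ]) (y w : V) :
    b (T.I (T.quat p y)) (T.I (T.quat p w)) + b (T.J (T.quat p y)) (T.J (T.quat p w))
      + b (T.K (T.quat p y)) (T.K (T.quat p w))
    = b (T.quat p (T.I y)) (T.quat p (T.I w)) + b (T.quat p (T.J y)) (T.quat p (T.J w))
      + b (T.quat p (T.K y)) (T.quat p (T.K w)) := by
  simp only [quat_apply, map_add, map_smul, LinearMap.add_apply, LinearMap.smul_apply, I_I, I_J,
    I_K, J_I, J_J, J_K, K_I, K_J, K_K, Complex.real_smul, map_neg, LinearMap.neg_apply]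
  ring

theorem inner_quat (p : ℍ[ℝ]) (y w : V) : inner ℝ (T.quat p y) (T.quat p w) =
    (p.re ^ 2 + p.imI ^ 2 + p.imJ ^ 2 + p.imK ^ 2) * inner ℝ y w := by
  simp only [quat_apply, inner_add_left, inner_add_right, real_inner_smul_left,
    real_inner_smul_right, T.inner_I_left, T.inner_J_left, T.inner_K_left, I_I, I_J,
    I_K, J_I, J_J, J_K, K_I, K_J, K_K, inner_neg_right]
  ring

theorem inner_repV_inv (g : T.SpN) (q : Sp1) (y w : V) :
    inner ℝ (T.repV (g, q)⁻¹ y) (T.repV (g, q)⁻¹ w) = inner ℝ y w := by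
  rw [repV_inv_apply, repV_inv_apply, repN_apply, repN_apply, LinearIsometryEquiv.inner_map_map,
    inner_quat]
  simp only [Quaternion.re_star, Quaternion.imI_star, Quaternion.imJ_star, Quaternion.imK_star,
    neg_sq, sp1_normSq, one_mul]

/-- A quaternion q does not commute with I, J, K individually, but it does commute with the sum of A
⊗ A over them, which is all that the pairing involves. -/
theorem pairing_tensorRep (G : CForm V 2) (g : T.SpN) (q : Sp1) (a b c d : V) :
    T.pairing (tensorRep T.repV 2 (g, q) G) a b c d =
      T.pairing G (T.repV (g, q)⁻¹ a) (T.repV (g, q)⁻¹ b) (T.repV (g, q)⁻¹ c)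
        (T.repV (g, q)⁻¹ d) := by
  have e : ∀ x y, tensorRep T.repV 2 (g, q) G ![x, y] =
      G ![T.repV (g, q)⁻¹ x, T.repV (g, q)⁻¹ y] := by
    intro x y
    rw [tensorRep_apply]
    congr 1
    ext i
    fin_cases i <;> rfl
  have h : ∀ a b c d : V,
      G ![T.repV (g, q)⁻¹ a, T.repV (g, q)⁻¹ (T.I b)] * (inner ℝ c (T.I d) : ℝ)
      + G ![T.repV (g, q)⁻¹ a, T.repV (g, q)⁻¹ (T.J b)] * (inner ℝ c (T.J d) : ℝ)
      + G ![T.repV (g, q)⁻¹ a, T.repV (g, q)⁻¹ (T.K b)] * (inner ℝ c (T.K d) : ℝ)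
      = G ![T.repV (g, q)⁻¹ a, T.I (T.repV (g, q)⁻¹ b)] *
          (inner ℝ (T.repV (g, q)⁻¹ c) (T.I (T.repV (g, q)⁻¹ d)) : ℝ)
      + G ![T.repV (g, q)⁻¹ a, T.J (T.repV (g, q)⁻¹ b)] *
          (inner ℝ (T.repV (g, q)⁻¹ c) (T.J (T.repV (g, q)⁻¹ d)) : ℝ)
      + G ![T.repV (g, q)⁻¹ a, T.K (T.repV (g, q)⁻¹ b)] *
          (inner ℝ (T.repV (g, q)⁻¹ c) (T.K (T.repV (g, q)⁻¹ d)) : ℝ) := by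
    intro a b c d
    -- With a and c frozen, the product of the two factors is bilinear in b and d, so `sum_conj`
    -- applies to it.
    let β : V →ₗ[ℝ] V →ₗ[ℝ] ℂ := LinearMap.mk₂ ℝ
      (fun u u' => toBilin G (T.repV (g, q)⁻¹ a) (T.repN g⁻¹ u) *
        kForm 1 (T.repV (g, q)⁻¹ c) (T.repN g⁻¹ u'))
      (by intros; simp only [map_add]; ring)
      (by intros; simp only [map_smul, smul_mul_assoc])
      (by intros; simp only [map_add]; ring)
      (by intros; simp only [map_smul, mul_smul_comm])
    have := T.sum_conj β (star (q : ℍ[ℝ])) b d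
    simp only [β, LinearMap.mk₂_apply, toBilin_apply, kForm_apply, Module.End.one_apply, repN_I,
      repN_J, repN_K, ← repV_inv_apply, inner_repV_inv] at this
    exact this.symm
  simp only [pairing, e]
  linear_combination h a b c d - h b a c d

theorem fourMap_tensorRep (G : CForm V 2) (g : T.SpN × Sp1) :
    T.fourMap (tensorRep T.repV 2 g G) = tensorRep T.repV 4 g (T.fourMap G) := by
  obtain ⟨g, q⟩ := g
  ext v
  rw [tensorRep_apply, fourMap_apply, fourMap_apply]
  simp only [pairing_tensorRep]

/-- The pairing is skew in its first pair and in its second pair of arguments; the signed sum over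
shuffles is then fully alternating, checked on each of the six coincidences. -/
theorem fourMap_alternating (G : CForm V 2) (v : Fin 4 → V) (i j : Fin 4) (h : v i = v j)
    (hij : i ≠ j) : T.fourMap G v = 0 := by
  have s1 : ∀ a b c d, T.pairing G a b c d = -T.pairing G b a c d := by
    intro a b c d; simp only [pairing]; ring
  have s2 : ∀ a b c d, T.pairing G a b c d = -T.pairing G a b d c := by
    intro a b c d
    simp only [pairing]
    rw [real_inner_comm (T.I c) d, real_inner_comm (T.J c) d, real_inner_comm (T.K c) d,
      T.inner_I_left, T.inner_J_left, T.inner_K_left]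
    push_cast; ring
  have z1 : ∀ a c d, T.pairing G a a c d = 0 := by
    intro a c d; simp only [pairing]; ring
  have z2 : ∀ a b c, T.pairing G a b c c = 0 := by
    intro a b c
    have := s2 a b c c
    linear_combination this / 2
  rw [fourMap_apply]
  have c01 : v 0 = v 1 → T.pairing G (v 0) (v 1) (v 2) (v 3) -
      T.pairing G (v 0) (v 2) (v 1) (v 3)
      + T.pairing G (v 0) (v 3) (v 1) (v 2) + T.pairing G (v 1) (v 2) (v 0) (v 3)
      - T.pairing G (v 1) (v 3) (v 0) (v 2) + T.pairing G (v 2) (v 3) (v 0) (v 1) = 0 := by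
    intro h
    rw [h, z1, z2]; ring
  have c02 : v 0 = v 2 → T.pairing G (v 0) (v 1) (v 2) (v 3) -
      T.pairing G (v 0) (v 2) (v 1) (v 3)
      + T.pairing G (v 0) (v 3) (v 1) (v 2) + T.pairing G (v 1) (v 2) (v 0) (v 3)
      - T.pairing G (v 1) (v 3) (v 0) (v 2) + T.pairing G (v 2) (v 3) (v 0) (v 1) = 0 := by
    intro h
    rw [h, z1, z2, s1 (v 2) (v 1), s2 _ _ (v 1) (v 2)]; ring
  have c03 : v 0 = v 3 → T.pairing G (v 0) (v 1) (v 2) (v 3) -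
      T.pairing G (v 0) (v 2) (v 1) (v 3)
      + T.pairing G (v 0) (v 3) (v 1) (v 2) + T.pairing G (v 1) (v 2) (v 0) (v 3)
      - T.pairing G (v 1) (v 3) (v 0) (v 2) + T.pairing G (v 2) (v 3) (v 0) (v 1) = 0 := by
    intro h
    rw [h, z1, z2, s1 (v 3) (v 1), s2 _ _ (v 2) (v 3), s1 (v 3) (v 2), s2 _ _ (v 1) (v 3)]; ring
  have c12 : v 1 = v 2 → T.pairing G (v 0) (v 1) (v 2) (v 3) -
      T.pairing G (v 0) (v 2) (v 1) (v 3)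
      + T.pairing G (v 0) (v 3) (v 1) (v 2) + T.pairing G (v 1) (v 2) (v 0) (v 3)
      - T.pairing G (v 1) (v 3) (v 0) (v 2) + T.pairing G (v 2) (v 3) (v 0) (v 1) = 0 := by
    intro h
    rw [h, z1, z2]; ring
  have c13 : v 1 = v 3 → T.pairing G (v 0) (v 1) (v 2) (v 3) -
      T.pairing G (v 0) (v 2) (v 1) (v 3)
      + T.pairing G (v 0) (v 3) (v 1) (v 2) + T.pairing G (v 1) (v 2) (v 0) (v 3)
      - T.pairing G (v 1) (v 3) (v 0) (v 2) + T.pairing G (v 2) (v 3) (v 0) (v 1) = 0 := by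
    intro h
    rw [h, z1, z2, s1 (v 3) (v 2), s2 _ _ (v 2) (v 3)]; ring
  have c23 : v 2 = v 3 → T.pairing G (v 0) (v 1) (v 2) (v 3) -
      T.pairing G (v 0) (v 2) (v 1) (v 3)
      + T.pairing G (v 0) (v 3) (v 1) (v 2) + T.pairing G (v 1) (v 2) (v 0) (v 3)
      - T.pairing G (v 1) (v 3) (v 0) (v 2) + T.pairing G (v 2) (v 3) (v 0) (v 1) = 0 := by
    intro h
    rw [h, z1, z2]; ring
  fin_cases i <;> fin_cases j <;>
    first
    | exact absurd rfl hij
    | exact c01 h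
    | exact c02 h
    | exact c03 h
    | exact c12 h
    | exact c13 h
    | exact c23 h
    | exact c01 h.symm
    | exact c02 h.symm
    | exact c03 h.symm
    | exact c12 h.symm
    | exact c13 h.symm
    | exact c23 h.symm

/-- The equivariant map from the intrinsic torsion to the covariant derivative of the
fundamental form. -/
def fiveMap : CForm V 3 →ₗ[ℂ] CForm V 5 where
  toFun F := LinearMap.uncurryLeft ((T.fourMap.restrictScalars ℝ) ∘ₗ F.curryLeft)
  map_add' F F' := by
    ext v
    simp only [LinearMap.uncurryLeft_apply, LinearMap.comp_apply, add_apply]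
    have : (F + F').curryLeft (v 0) = F.curryLeft (v 0) + F'.curryLeft (v 0) := rfl
    rw [this, map_add, add_apply]
  map_smul' c F := by
    ext v
    simp only [LinearMap.uncurryLeft_apply, LinearMap.comp_apply, smul_apply, RingHom.id_apply]
    have : (c • F).curryLeft (v 0) = c • F.curryLeft (v 0) := rfl
    rw [this]
    exact congrArg (fun f => f (Fin.tail v)) (map_smul T.fourMap c _)

theorem fiveMap_curryLeft (F : CForm V 3) (x : V) :
    (T.fiveMap F).curryLeft x = T.fourMap (F.curryLeft x) := rfl

theorem fiveMap_apply (F : CForm V 3) (v : Fin 5 → V) :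
    T.fiveMap F v = T.fourMap (F.curryLeft (v 0)) (Fin.tail v) := rfl

theorem fiveMap_tensorRep (F : CForm V 3) (g : T.SpN × Sp1) :
    T.fiveMap (tensorRep T.repV 3 g F) = tensorRep T.repV 5 g (T.fiveMap F) := by
  ext v
  rw [tensorRep_apply, fiveMap_apply, fiveMap_apply]
  have : (tensorRep T.repV 3 g F).curryLeft (v 0) =
      tensorRep T.repV 2 g (F.curryLeft (T.repV g⁻¹ (v 0))) := by
    ext w
    rw [tensorRep_apply, MultilinearMap.curryLeft_apply, MultilinearMap.curryLeft_apply,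
      tensorRep_apply]
    congr 1
    ext i
    refine Fin.cases rfl (fun j => rfl) i
  rw [this, fourMap_tensorRep, tensorRep_apply]
  rfl

/-! ### Trilinear maps from triples -/

/-- Composition of the last argument with an endomorphism. -/
def third (A : Module.End ℝ V) : Tri V →ₗ[ℂ] Tri V where
  toFun τ := mkTri (fun x y z => τ x y (A z))
    (by intros; simp) (by intros; simp) (by intros; simp) (by intros; simp) (by intros; simp)
    (by intros; simp)
  map_add' _ _ := rfl
  map_smul' _ _ := rfl

@[simp] theorem third_apply (A : Module.End ℝ V) (τ : Tri V) (x y z : V) :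
    third A τ x y z = τ x y (A z) := rfl

/-- The trilinear map `α(x; y, Iz) + β(x; y, Jz) + γ(x; y, Kz)`. -/
def xi (α β γ : Tri V) : Tri V := third T.I α + third T.J β + third T.K γ

theorem xi_apply (α β γ : Tri V) (x y z : V) :
    T.xi α β γ x y z = α x y (T.I z) + β x y (T.J z) + γ x y (T.K z) := rfl

/-- The trilinear map `∑_A δ(Ax; y, Az)`. -/
def xiH : Tri V →ₗ[ℂ] Tri V where
  toFun δ := T.xi (δ ∘ₗ T.I) (δ ∘ₗ T.J) (δ ∘ₗ T.K)
  map_add' δ δ' := by ext x y z; simp [xi_apply]; ring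
  map_smul' c δ := by ext x y z; simp [xi_apply]; ring

theorem xiH_apply (δ : Tri V) (x y z : V) : T.xiH δ x y z =
    δ (T.I x) y (T.I z) + δ (T.J x) y (T.J z) + δ (T.K x) y (T.K z) := rfl

/-- Contraction of the first argument of a trilinear map with a form on `ℍ`. -/
def contractOne (τ : Tri V) (φ : CForm ℍ[ℝ] 1) : Tri V :=
  ∑ a, φ (fun _ => qBasis a) • (τ ∘ₗ T.quat (qBasis 2 * qBasis a))

theorem contractOne_apply (τ : Tri V) (φ : CForm ℍ[ℝ] 1) (x y z : V) : T.contractOne τ φ x y z =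
    ∑ a, φ (fun _ => qBasis a) * τ (T.quat (qBasis 2 * qBasis a) x) y z := by
  simp [contractOne]

/-- The factor is the squared norm of p, so Sp(1) acts trivially on the last two arguments. -/
theorem hSym_quat {T : Triple V} {τ : Tri V} (h : τ ∈ T.hSym) (p : ℍ[ℝ]) (x y z : V) :
    τ x (T.quat p y) (T.quat p z) =
      ((p.re ^ 2 + p.imI ^ 2 + p.imJ ^ 2 + p.imK ^ 2 : ℝ) : ℂ) * τ x y z := by
  simp only [quat_apply, map_add, map_smul, LinearMap.add_apply, LinearMap.smul_apply, I_I, I_J,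
    I_K, J_I, J_J, J_K, K_I, K_J, K_K, Complex.real_smul, map_neg, hSym.I h, hSym.J h, hSym.K h]
  push_cast
  ring

/-- This embeds W ⊗ H in tensors of degree three. The factor H sits in the first argument, where q
is treated as in `contract_tensorRep`. The remaining action of q passes through ∑ A ⊗ A on the first
and third arguments by `sum_conj`, and disappears from the last two by `hSym_quat`. -/
theorem xiH_contractOne_equivariant {W : Type*} [AddCommGroup W] [Module ℂ W]
    {σ : Representation ℂ T.SpN W} (j : W →ₗ[ℂ] Tri V)
    (hj : ∀ g w x y z, j (σ g w) x y z = j w (T.repN g⁻¹ x) (T.repN g⁻¹ y) (T.repN g⁻¹ z))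
    (hjm : ∀ w, j w ∈ T.hSym) (g : T.SpN) (q : Sp1) (w : W) (φ : CForm ℍ[ℝ] 1) :
    toCForm (T.xiH (T.contractOne (j (σ g w)) (tensorRep repH 1 q φ))) =
      tensorRep T.repV 3 (g, q) (toCForm (T.xiH (T.contractOne (j w) φ))) := by
  ext v
  rw [tensorRep_apply, toCForm_apply, toCForm_apply, xiH_apply, xiH_apply]
  generalize v 0 = x
  generalize v 1 = y
  generalize v 2 = z
  have h1 : ∀ a, tensorRep repH 1 q φ (fun _ => qBasis a) =
      ∑ c, (qCoord (qBasis a * q) c : ℂ) * φ (fun _ => qBasis c) := by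
    intro a
    have e : ∀ ζ, φ (fun _ => ζ) = φ (Function.update (fun _ => (0 : ℍ[ℝ])) 0 ζ) := by
      intro ζ
      congr 1
      funext i
      fin_cases i
      rfl
    rw [tensorRep_apply]
    have : repH q⁻¹ (qBasis a) = ∑ c, qCoord (qBasis a * q) c • qBasis c := by
      rw [sum_qCoord]
      change qBasis a * star (star (q : ℍ[ℝ])) = _
      rw [star_star]
    rw [this, e, MultilinearMap.map_update_sum]
    refine Finset.sum_congr rfl fun c _ => ?_
    rw [MultilinearMap.map_update_smul, ← e, Complex.real_smul]
  have key : ∀ x y z : V, T.contractOne (j (σ g w)) (tensorRep repH 1 q φ) x y z =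
      T.contractOne (j w) φ (T.repV (g, q)⁻¹ x) (T.repN g⁻¹ y) (T.repN g⁻¹ z) := by
    intro x y z
    rw [contractOne_apply, contractOne_apply]
    have h2 : ∀ c, j w (T.quat (qBasis 2 * qBasis c) (T.repV (g, q)⁻¹ x)) (T.repN g⁻¹ y)
        (T.repN g⁻¹ z) = ∑ a, (qCoord (qBasis a * q) c : ℂ) *
          j (σ g w) (T.quat (qBasis 2 * qBasis a) x) y z := by
      intro c
      have : T.quat (qBasis 2 * qBasis c) (T.repV (g, q)⁻¹ x) =
          ∑ a, qCoord (qBasis a * q) c • T.repN g⁻¹ (T.quat (qBasis 2 * qBasis a) x) := by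
        rw [repV_inv_apply, ← repN_quat, ← Module.End.mul_apply (T.quat _) (T.quat _), ← map_mul,
          mul_assoc]
        conv_lhs => rw [← sum_qCoord (qBasis c * star (q : ℍ[ℝ]))]
        simp only [Finset.mul_sum, mul_smul_comm, map_sum, map_smul, LinearMap.sum_apply,
          LinearMap.smul_apply, qCoord_mul_star]
      rw [this]
      simp only [map_sum, map_smul, LinearMap.sum_apply, LinearMap.smul_apply, Complex.real_smul,
        hj]
    simp only [h1, h2, Finset.sum_mul, Finset.mul_sum]
    rw [Finset.sum_comm]
    refine Finset.sum_congr rfl fun c _ => Finset.sum_congr rfl fun a _ => ?_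
    ring
  simp only [key]
  have inv : ∀ x' y' z', T.contractOne (j w) φ x' (T.repV (g, q)⁻¹ y') (T.repV (g, q)⁻¹ z') =
      T.contractOne (j w) φ x' (T.repN g⁻¹ y') (T.repN g⁻¹ z') := by
    intro x' y' z'
    rw [contractOne_apply, contractOne_apply]
    refine Finset.sum_congr rfl fun a _ => ?_
    rw [repV_inv_apply, repV_inv_apply, repN_quat, repN_quat, hSym_quat (hjm w)]
    simp only [Quaternion.re_star, Quaternion.imI_star, Quaternion.imJ_star, Quaternion.imK_star,
      neg_sq, sp1_normSq, Complex.ofReal_one, one_mul]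
  -- The middle argument is already moved by the inverse of (g, q), so that after `sum_conj` the
  -- last two arguments carry the same quaternion and `inv` can remove it.
  let β : V →ₗ[ℝ] V →ₗ[ℝ] ℂ := LinearMap.mk₂ ℝ
    (fun u u' => T.contractOne (j w) φ (T.repN g⁻¹ u) (T.repV (g, q)⁻¹ y) (T.repN g⁻¹ u'))
    (by intros; simp only [map_add, LinearMap.add_apply])
    (by intros; simp only [map_smul, LinearMap.smul_apply])
    (by intros; simp only [map_add])
    (by intros; simp only [map_smul])
  have := T.sum_conj β (star (q : ℍ[ℝ])) x z
  simp only [β, LinearMap.mk₂_apply, repN_I, repN_J, repN_K, ← repV_inv_apply, inv] at this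
  simp only [repN_I, repN_J, repN_K] at this ⊢
  exact this.symm

variable {T}

theorem xiH_comp_mem_component {W : Type*} [AddCommGroup W] [Module ℂ W]
    {σ : Representation ℂ T.SpN W} (j : W →ₗ[ℂ] Tri V)
    (hj : ∀ g w x y z, j (σ g w) x y z = j w (T.repN g⁻¹ x) (T.repN g⁻¹ y) (T.repN g⁻¹ z))
    (hjm : ∀ w, j w ∈ T.hSym) (w : W) (hw : j w ∘ₗ T.I = Complex.I • j w) (a b : ℝ) :
    toCForm (T.xiH (j w ∘ₗ T.real1J a b)) ∈ T.component σ (SymH 1).toRepresentation 3 := by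
  let f : W →ₗ[ℂ] (SymH 1).toSubmodule →ₗ[ℂ] CForm V 3 :=
    LinearMap.mk₂ ℂ (fun w φ => toCForm (T.xiH (T.contractOne (j w) (φ : CForm ℍ[ℝ] 1))))
      (by intros; rw [← map_add, ← map_add]; congr 2; ext x y z
          simp [contractOne_apply, mul_add, Finset.sum_add_distrib])
      (by intros; rw [← map_smul, ← map_smul]; congr 2; ext x y z
          simp [contractOne_apply, Finset.mul_sum, mul_left_comm])
      (by intros; rw [← map_add, ← map_add]; congr 2; ext x y z
          simp [contractOne_apply, add_mul, Finset.sum_add_distrib])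
      (by intros; rw [← map_smul, ← map_smul]; congr 2; ext x y z
          simp [contractOne_apply, Finset.mul_sum, mul_assoc])
  have h := T.mem_component_of_bilinear (σ := σ) (τ := (SymH 1).toRepresentation) f
    (fun g q w φ => T.xiH_contractOne_equivariant j hj hjm g q w φ) w
    ⟨powForm 1 a b, powForm_mem 1 a b⟩
  have e : T.contractOne (j w) (powForm 1 a b) = (2 : ℂ) • (j w ∘ₗ T.real1J a b) := by
    have hc : ∀ (c : ℂ) (x y z : V), j w (T.cAct c x) y z = c * j w x y z := by
      intro c x y z
      have : j w (T.I x) y z = Complex.I * j w x y z :=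
        congrArg (fun τ : Tri V => τ x y z) hw
      rw [cAct_apply, map_add, map_smul, map_smul]
      simp only [LinearMap.add_apply, LinearMap.smul_apply, this, Complex.real_smul]
      conv_rhs => rw [← Complex.re_add_im c]
      ring
    ext x y z
    rw [contractOne_apply]
    simp only [powForm_apply, Finset.univ_unique, Finset.prod_singleton, ← hc]
    have := congrArg (fun u => j w u y z) (sum_cAct (T := T) a b x)
    simp only [map_sum, LinearMap.sum_apply] at this
    rw [this]
    simp
  have h' : toCForm (T.xiH (T.contractOne (j w) (powForm 1 a b))) ∈
      T.component σ (SymH 1).toRepresentation 3 := h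
  rw [e, map_smul, map_smul] at h'
  have h'' := Submodule.smul_mem _ (2 : ℂ)⁻¹ h'
  rwa [inv_smul_smul₀ two_ne_zero] at h''

end Triple

/-! ### Passage between tensors of degree three and trilinear maps. -/

section OfCForm

variable {V : Type*} [AddCommGroup V] [Module ℝ V]

theorem update_zero_vec3 {α : Type*} (x y z u : α) :
    Function.update ![x, y, z] 0 u = ![u, y, z] := by
  funext i; fin_cases i <;> rfl

theorem update_one_vec3 {α : Type*} (x y z u : α) :
    Function.update ![x, y, z] 1 u = ![x, u, z] := by
  funext i; fin_cases i <;> rfl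

theorem update_two_vec3 {α : Type*} (x y z u : α) :
    Function.update ![x, y, z] 2 u = ![x, y, u] := by
  funext i; fin_cases i <;> rfl

/-- A tensor of degree three as a trilinear map. -/
def ofCForm : CForm V 3 →ₗ[ℂ] Tri V where
  toFun F := mkTri (fun x y z => F ![x, y, z])
    (fun x x' y z => by
      have := F.map_update_add ![x, y, z] 0 x x'
      rwa [update_zero_vec3, update_zero_vec3, update_zero_vec3] at this)
    (fun c x y z => by
      have := F.map_update_smul ![x, y, z] 0 c x
      rwa [update_zero_vec3, update_zero_vec3] at this)
    (fun x y y' z => by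
      have := F.map_update_add ![x, y, z] 1 y y'
      rwa [update_one_vec3, update_one_vec3, update_one_vec3] at this)
    (fun c x y z => by
      have := F.map_update_smul ![x, y, z] 1 c y
      rwa [update_one_vec3, update_one_vec3] at this)
    (fun x y z z' => by
      have := F.map_update_add ![x, y, z] 2 z z'
      rwa [update_two_vec3, update_two_vec3, update_two_vec3] at this)
    (fun c x y z => by
      have := F.map_update_smul ![x, y, z] 2 c z
      rwa [update_two_vec3, update_two_vec3] at this)
  map_add' _ _ := rfl
  map_smul' _ _ := rfl

theorem ofCForm_apply (F : CForm V 3) (x y z : V) : ofCForm F x y z = F ![x, y, z] := rfl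

theorem IsComplexForm.ofCForm {C : Module.End ℝ V} {F : CForm V 3} (h : IsComplexForm C F) :
    (∀ x y z, AQH.ofCForm F (C x) y z = Complex.I * AQH.ofCForm F x y z) ∧
    (∀ x y z, AQH.ofCForm F x (C y) z = Complex.I * AQH.ofCForm F x y z) ∧
    ∀ x y z, AQH.ofCForm F x y (C z) = Complex.I * AQH.ofCForm F x y z := by
  refine ⟨fun x y z => ?_, fun x y z => ?_, fun x y z => ?_⟩
  · have := h 0 ![x, y, z]
    rwa [update_zero_vec3] at this
  · have := h 1 ![x, y, z]
    rwa [update_one_vec3] at this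
  · have := h 2 ![x, y, z]
    rwa [update_two_vec3] at this

end OfCForm

/-! ### Symmetric forms versus complex skew forms; membership in the components S³H and H. -/

namespace Triple

variable {V : Type*} [NormedAddCommGroup V] [InnerProductSpace ℝ V] (T : Triple V)

/-- The complex form `τ(x; y, Jz) + iτ(x; y, Kz)`. -/
def phi : Tri V →ₗ[ℂ] Tri V := third T.J + Complex.I • third T.K

theorem phi_apply (τ : Tri V) (x y z : V) :
    T.phi τ x y z = τ x y (T.J z) + Complex.I * τ x y (T.K z) := rfl

/-- The symmetric form attached to a skew complex form. -/
def ofSkew : CForm V 3 →ₗ[ℂ] Tri V where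
  toFun F := mkTri (fun x y z => ofCForm F x y (T.J z) - ofCForm F x (T.J y) z)
    (by intros; simp only [map_add, LinearMap.add_apply]; ring)
    (by intros; simp only [map_smul, LinearMap.smul_apply, smul_sub])
    (by intros; simp only [map_add, LinearMap.add_apply]; ring)
    (by intros; simp only [map_smul, LinearMap.smul_apply, smul_sub])
    (by intros; simp only [map_add]; ring)
    (by intros; simp only [map_smul, smul_sub])
  map_add' F F' := by ext x y z; simp [mkTri, ofCForm_apply]; ring
  map_smul' c F := by ext x y z; simp [mkTri, ofCForm_apply]; ring

theorem ofSkew_apply (F : CForm V 3) (x y z : V) :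
    T.ofSkew F x y z = F ![x, y, T.J z] - F ![x, T.J y, z] := rfl

variable {T}

/-- Symmetry comes from the skewness of F, invariance under I from its complex linearity, and
invariance under J from J² = -1 in the defining formula. -/
theorem ofSkew_mem {F : CForm V 3} (h : IsComplexForm T.I F)
    (hs : ∀ x y z, F ![x, y, z] = -F ![x, z, y]) : T.ofSkew F ∈ T.hSym := by
  have hI : ∀ x y z, T.ofSkew F x (T.I y) (T.I z) = T.ofSkew F x y z := by
    intro x y z
    simp only [ofSkew_apply, ← ofCForm_apply, J_I, map_neg, LinearMap.neg_apply, ← T.I_J,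
      h.ofCForm.2.1, h.ofCForm.2.2]
    linear_combination (ofCForm F x (T.J y) z - ofCForm F x y (T.J z)) * Complex.I_mul_I
  refine ⟨fun x y z => ?_, hI, fun x y z => ?_⟩
  · rw [ofSkew_apply, ofSkew_apply, hs x y, hs x (T.J y)]
    ring
  · simp only [ofSkew_apply, ← ofCForm_apply, J_J, map_neg, LinearMap.neg_apply]
    ring

/-- Up to this factor `ofSkew` is a left inverse of `phi`; every symmetric form thus comes from its
complex form. -/
theorem ofSkew_phi {τ : Tri V} (h : τ ∈ T.hSym) : T.ofSkew (toCForm (T.phi τ)) = (-2 : ℂ) • τ := by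
  ext x y z
  rw [ofSkew_apply]
  change T.phi τ x y (T.J z) - T.phi τ x (T.J y) z = -2 * τ x y z
  simp only [phi_apply, hSym.J h, J_J, K_J, J_K, map_neg]
  ring

theorem phi_isComplexForm {τ : Tri V} (h : τ ∈ T.hSym) (hc : τ ∘ₗ T.I = Complex.I • τ) :
    IsComplexForm T.I (toCForm (T.phi τ)) := by
  have hc' : ∀ x y z, τ (T.I x) y z = Complex.I * τ x y z := fun x y z =>
    congrArg (fun τ : Tri V => τ x y z) hc
  intro i v
  fin_cases i
  · change T.phi τ (T.I (v 0)) (v 1) (v 2) = Complex.I * T.phi τ (v 0) (v 1) (v 2)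
    simp only [phi_apply, hc']
    ring
  · change T.phi τ (v 0) (T.I (v 1)) (v 2) = Complex.I * T.phi τ (v 0) (v 1) (v 2)
    simp only [phi_apply, hSym.I h, I_J, I_K, map_neg]
    linear_combination (-τ (v 0) (v 1) (T.K (v 2))) * Complex.I_mul_I
  · change T.phi τ (v 0) (v 1) (T.I (v 2)) = Complex.I * T.phi τ (v 0) (v 1) (v 2)
    simp only [phi_apply, J_I, K_I, map_neg]
    linear_combination (-τ (v 0) (v 1) (T.K (v 2))) * Complex.I_mul_I

theorem phi_skew {τ : Tri V} (h : τ ∈ T.hSym) (x y z : V) :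
    T.phi τ x y z = -T.phi τ x z y := by
  rw [phi_apply, phi_apply, hSym.J_swap h x z y, hSym.K_swap h x z y]
  ring

/-- In terms of complex forms S is -2 times the sum of the two nontrivial cyclic shifts. Eigenvalue
-4 therefore means cyclic invariance, which for a form skew in the last two arguments is membership
in Λ³E, and eigenvalue 2 means vanishing cyclic sum, which characterizes K. -/
theorem phi_symOp {τ : Tri V} (h : τ ∈ T.hSym) (hc : τ ∘ₗ T.I = Complex.I • τ) (x y z : V) :
    T.phi (T.symOp τ) x y z = -2 * (T.phi τ y z x + T.phi τ z x y) := by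
  have hI : ∀ x y z, τ (T.I x) y z = Complex.I * τ x y z := fun x y z =>
    congrArg (fun τ : Tri V => τ x y z) hc
  have hK : ∀ x y z, τ (T.K x) y z = Complex.I * τ (T.J x) y z := by
    intro x y z
    rw [← T.I_J, hI]
  simp only [phi_apply, symOp_apply, I_J, I_K, J_J, J_K, K_J, K_K, map_neg, LinearMap.neg_apply,
    hI, hK]
  rw [hSym.J_swap h y x z, hSym.K_swap h y x z]
  linear_combination (τ z x (T.J y) - τ y x (T.J z) + τ (T.J z) x y - τ (T.J y) x z) * Complex.I_mul_I

/-! ### Realizations of the types -/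

/-- An equivariant map from a module to the trilinear maps which covers all those of a given
type that are complex linear in the first argument. -/
structure Realizes (T : Triple V) {W : Type*} [AddCommGroup W] [Module ℂ W]
    (σ : Representation ℂ T.SpN W) (j : W →ₗ[ℂ] Tri V) (P : Submodule ℂ (Tri V)) : Prop where
  equivariant : ∀ g w x y z,
    j (σ g w) x y z = j w (T.repN g⁻¹ x) (T.repN g⁻¹ y) (T.repN g⁻¹ z)
  mem : ∀ w, j w ∈ T.hSym
  exists_eq : ∀ τ ∈ P, τ ∘ₗ T.I = Complex.I • τ → ∃ w, j w = τ
  le : P ≤ T.hSym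
  comp_I : ∀ τ ∈ P, τ ∘ₗ T.I ∈ P
  comp_J : ∀ τ ∈ P, τ ∘ₗ T.J ∈ P
  comp_K : ∀ τ ∈ P, τ ∘ₗ T.K ∈ P

variable (T)

/-- The complex-linear part. -/
def part₀ : Tri V →ₗ[ℂ] Tri V where
  toFun τ := (1 / 2 : ℂ) • (τ - Complex.I • (τ ∘ₗ T.I))
  map_add' τ τ' := by ext x y z; simp; ring
  map_smul' c τ := by ext x y z; simp; ring

/-- The complex-antilinear part, composed with `J`. -/
def part₁ : Tri V →ₗ[ℂ] Tri V where
  toFun τ := (-1 / 2 : ℂ) • (τ ∘ₗ T.J + Complex.I • (τ ∘ₗ T.K))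
  map_add' τ τ' := by ext x y z; simp; ring
  map_smul' c τ := by ext x y z; simp; ring

theorem part₀_apply (τ : Tri V) (x y z : V) :
    T.part₀ τ x y z = (1 / 2) * (τ x y z - Complex.I * τ (T.I x) y z) := rfl

theorem part₁_apply (τ : Tri V) (x y z : V) :
    T.part₁ τ x y z = (-1 / 2) * (τ (T.J x) y z + Complex.I * τ (T.K x) y z) := rfl

theorem part₀_comp_I (τ : Tri V) : T.part₀ τ ∘ₗ T.I = Complex.I • T.part₀ τ := by
  ext x y z
  simp only [LinearMap.comp_apply, LinearMap.smul_apply, smul_eq_mul, part₀_apply, I_I, map_neg,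
    LinearMap.neg_apply]
  linear_combination (1 / 2 * τ (T.I x) y z) * Complex.I_mul_I

theorem part₁_comp_I (τ : Tri V) : T.part₁ τ ∘ₗ T.I = Complex.I • T.part₁ τ := by
  ext x y z
  simp only [LinearMap.comp_apply, LinearMap.smul_apply, smul_eq_mul, part₁_apply, J_I, K_I,
    map_neg, LinearMap.neg_apply]
  linear_combination (1 / 2 * τ (T.K x) y z) * Complex.I_mul_I

/-- J anticommutes with I, so composing the antilinear part with J makes it complex linear; the two
parts are the two weight components in the factor H of the first argument. -/
theorem part_add (τ : Tri V) (x y z : V) :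
    τ x y z = T.part₀ τ x y z + T.part₁ τ (T.J x) y z := by
  simp only [part₀_apply, part₁_apply, J_J, K_J, map_neg, LinearMap.neg_apply]
  ring

variable {T}

theorem Realizes.part₀_mem {W : Type*} [AddCommGroup W] [Module ℂ W]
    {σ : Representation ℂ T.SpN W} {j : W →ₗ[ℂ] Tri V} {P : Submodule ℂ (Tri V)}
    (R : T.Realizes σ j P) {τ : Tri V} (h : τ ∈ P) : T.part₀ τ ∈ P :=
  P.smul_mem _ (P.sub_mem h (P.smul_mem _ (R.comp_I τ h)))

theorem Realizes.part₁_mem {W : Type*} [AddCommGroup W] [Module ℂ W]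
    {σ : Representation ℂ T.SpN W} {j : W →ₗ[ℂ] Tri V} {P : Submodule ℂ (Tri V)}
    (R : T.Realizes σ j P) {τ : Tri V} (h : τ ∈ P) : T.part₁ τ ∈ P :=
  P.smul_mem _ (P.add_mem (R.comp_J τ h) (P.smul_mem _ (R.comp_K τ h)))

theorem Realizes.xiH_mem {W : Type*} [AddCommGroup W] [Module ℂ W]
    {σ : Representation ℂ T.SpN W} {j : W →ₗ[ℂ] Tri V} {P : Submodule ℂ (Tri V)}
    (R : T.Realizes σ j P) {δ : Tri V} (h : δ ∈ P) :
    toCForm (T.xiH δ) ∈ T.component σ (SymH 1).toRepresentation 3 := by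
  obtain ⟨w₀, h₀⟩ := R.exists_eq _ (R.part₀_mem h) (T.part₀_comp_I δ)
  obtain ⟨w₁, h₁⟩ := R.exists_eq _ (R.part₁_mem h) (T.part₁_comp_I δ)
  -- The parameters (1, 0) and (0, 1) give the endomorphisms 1 and J, which reassemble δ from its
  -- two parts.
  have m₀ := xiH_comp_mem_component j R.equivariant R.mem w₀
    (by rw [h₀]; exact T.part₀_comp_I δ) 1 0
  have m₁ := xiH_comp_mem_component j R.equivariant R.mem w₁
    (by rw [h₁]; exact T.part₁_comp_I δ) 0 1
  have : toCForm (T.xiH δ) = toCForm (T.xiH (j w₀ ∘ₗ T.real1J 1 0)) +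
      toCForm (T.xiH (j w₁ ∘ₗ T.real1J 0 1)) := by
    rw [← map_add, ← map_add]
    congr 2
    ext x y z
    simp only [LinearMap.add_apply, LinearMap.comp_apply, real1J_apply, h₀, h₁, one_smul, zero_smul,
      add_zero, zero_add]
    exact T.part_add δ x y z
  rw [this]
  exact add_mem m₀ m₁

/-- The weight decomposition in S²H: the three terms have J in none, in exactly one and in both of
the last two arguments. -/
theorem xi_eq_phi {α β γ : Tri V} (hα : α ∈ T.hSym) (hβ : β ∈ T.hSym) (hγ : γ ∈ T.hSym)
    (x y z : V) : T.xi α β γ x y z =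
      (1 / 2) * T.phi (β - Complex.I • γ) x y z
      + (Complex.I / 2) * (T.phi α x (T.J y) z + T.phi α x y (T.J z))
      + (1 / 2) * T.phi (β + Complex.I • γ) x (T.J y) (T.J z) := by
  simp only [xi_apply, phi_apply, LinearMap.add_apply, LinearMap.sub_apply, LinearMap.smul_apply,
    smul_eq_mul, hSym.J hα, hSym.J hβ, hSym.J hγ, J_J, K_J, J_K, J_I, map_neg]
  linear_combination (γ x y (T.K z) + α x y (T.I z)) * Complex.I_mul_I

theorem Realizes.comp_mem {W : Type*} [AddCommGroup W] [Module ℂ W]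
    {σ : Representation ℂ T.SpN W} {j : W →ₗ[ℂ] Tri V} {P : Submodule ℂ (Tri V)}
    (R : T.Realizes σ j P) {τ : Tri V} (h : τ ∈ P) (hc : τ ∘ₗ T.I = Complex.I • τ) (a b : ℝ) :
    (toCForm (T.phi τ)).compLinearMap (fun _ => T.real1J a b) ∈
      T.component σ (SymH 3).toRepresentation 3 := by
  obtain ⟨w, rfl⟩ := R.exists_eq τ h hc
  refine comp_real1J_mem_component (toCForm ∘ₗ T.phi ∘ₗ j) (fun g w => ?_) w
    (phi_isComplexForm (R.mem w) hc) a b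
  ext v
  change T.phi (j (σ g w)) (v 0) (v 1) (v 2) =
    T.phi (j w) (T.repN g⁻¹ (v 0)) (T.repN g⁻¹ (v 1)) (T.repN g⁻¹ (v 2))
  simp only [phi_apply, R.equivariant, repN_J, repN_K]

/-- Splitting the first argument as well gives six coefficients for H ⊗ S²H. The vanishing sum
identifies them in pairs, leaving the four weights of S³H, each symmetric in the placement of J
among the three arguments. -/
theorem Realizes.xi_mem {W : Type*} [AddCommGroup W] [Module ℂ W]
    {σ : Representation ℂ T.SpN W} {j : W →ₗ[ℂ] Tri V} {P : Submodule ℂ (Tri V)}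
    (R : T.Realizes σ j P) {α β γ : Tri V} (hα : α ∈ P) (hβ : β ∈ P) (hγ : γ ∈ P)
    (h : α ∘ₗ T.I + β ∘ₗ T.J + γ ∘ₗ T.K = 0) :
    toCForm (T.xi α β γ) ∈ T.component σ (SymH 3).toRepresentation 3 := by
  have h0 : ∀ x y z, α (T.I x) y z + β (T.J x) y z + γ (T.K x) y z = 0 := fun x y z =>
    congrArg (fun τ : Tri V => τ x y z) h
  have hm := P.sub_mem hβ (P.smul_mem Complex.I hγ)
  have hp := P.add_mem hβ (P.smul_mem Complex.I hγ)
  -- These two identities say that J may be moved between the first argument and the last two, for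
  -- the terms with one J and with two J respectively.
  have e1 : T.part₁ (β - Complex.I • γ) = Complex.I • T.part₀ α := by
    ext x y z
    have a1 := h0 x y z
    have a2 := h0 (T.I x) y z
    simp only [I_I, J_I, K_I, map_neg, LinearMap.neg_apply] at a2
    simp only [part₀_apply, part₁_apply, LinearMap.sub_apply, LinearMap.smul_apply, smul_eq_mul]
    linear_combination (-1 / 2) * a1 + (Complex.I / 2) * a2 +
      (1 / 2 * (γ (T.K x) y z + α (T.I x) y z)) * Complex.I_mul_I
  have e2 : T.part₀ (β + Complex.I • γ) = Complex.I • T.part₁ α := by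
    ext x y z
    have a1 := h0 (T.J x) y z
    have a2 := h0 (T.K x) y z
    simp only [I_J, J_J, K_J, I_K, J_K, K_K, map_neg, LinearMap.neg_apply] at a1 a2
    simp only [part₀_apply, part₁_apply, LinearMap.add_apply, LinearMap.smul_apply, smul_eq_mul]
    linear_combination (-1 / 2) * a1 - (Complex.I / 2) * a2 +
      (1 / 2 * (α (T.K x) y z - γ (T.I x) y z)) * Complex.I_mul_I
  have c1 := T.part₀_comp_I α
  have c2 := T.part₁_comp_I α
  have m0 := R.comp_mem (R.part₀_mem hm) (T.part₀_comp_I _)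
  have m1 := R.comp_mem (R.part₀_mem hα) (T.part₀_comp_I _)
  have m2 := R.comp_mem (R.part₁_mem hα) (T.part₁_comp_I _)
  have m3 := R.comp_mem (R.part₁_mem hp) (T.part₁_comp_I _)
  -- Polarization of the pullbacks by a + bJ: half the difference at (1, 1) and (1, -1), minus the
  -- value at (0, 1), isolates exactly one J; half the sum, minus the value at (1, 0), isolates
  -- exactly two.
  have key : toCForm (T.xi α β γ) =
      (1 / 2 : ℂ) • (toCForm (T.phi (T.part₀ (β - Complex.I • γ)))).compLinearMap
        (fun _ => T.real1J 1 0)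
      + (Complex.I / 2) • ((1 / 2 : ℂ) •
        ((toCForm (T.phi (T.part₀ α))).compLinearMap (fun _ => T.real1J 1 1)
        - (toCForm (T.phi (T.part₀ α))).compLinearMap (fun _ => T.real1J 1 (-1)))
        - (toCForm (T.phi (T.part₀ α))).compLinearMap (fun _ => T.real1J 0 1))
      + (Complex.I / 2) • ((1 / 2 : ℂ) •
        ((toCForm (T.phi (T.part₁ α))).compLinearMap (fun _ => T.real1J 1 1)
        + (toCForm (T.phi (T.part₁ α))).compLinearMap (fun _ => T.real1J 1 (-1)))
        - (toCForm (T.phi (T.part₁ α))).compLinearMap (fun _ => T.real1J 1 0))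
      + (1 / 2 : ℂ) • (toCForm (T.phi (T.part₁ (β + Complex.I • γ)))).compLinearMap
        (fun _ => T.real1J 0 1) := by
    ext v
    simp only [add_apply, sub_apply, smul_apply, MultilinearMap.compLinearMap_apply, toCForm_apply,
      smul_eq_mul, real1J_apply, one_smul, zero_smul, add_zero, zero_add, neg_smul]
    generalize v 0 = x
    generalize v 1 = y
    generalize v 2 = z
    rw [xi_eq_phi (R.le hα) (R.le hβ) (R.le hγ)]
    have d : ∀ (τ : Tri V) (y z : V), T.phi τ x y z =
        T.phi (T.part₀ τ) x y z + T.phi (T.part₁ τ) (T.J x) y z := by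
      intro τ y z
      rw [phi_apply, phi_apply, phi_apply, T.part_add τ, T.part_add τ x y (T.K z)]
      ring
    rw [d (β - Complex.I • γ), d α, d α, d (β + Complex.I • γ), e1, e2]
    simp only [map_add, map_neg, map_smul, LinearMap.add_apply, LinearMap.neg_apply,
      LinearMap.smul_apply, smul_eq_mul]
    ring
  rw [key]
  refine add_mem (add_mem (add_mem (Submodule.smul_mem _ _ (m0 _ _)) (Submodule.smul_mem _ _ ?_))
    (Submodule.smul_mem _ _ ?_)) (Submodule.smul_mem _ _ (m3 _ _))
  · exact sub_mem (Submodule.smul_mem _ _ (sub_mem (m1 _ _) (m1 _ _))) (m1 _ _)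
  · exact sub_mem (Submodule.smul_mem _ _ (add_mem (m2 _ _) (m2 _ _))) (m2 _ _)

end Triple

/-! ### Realizations of Λ³₀E, K, E and membership in the six quaternionic modules. -/

namespace Triple

variable {V : Type*} [NormedAddCommGroup V] [InnerProductSpace ℝ V] {T : Triple V}

theorem tensorRep_vec3 (g : T.SpN) (F : CForm V 3) (x y z : V) :
    tensorRep T.repN 3 g F ![x, y, z] = F ![T.repN g⁻¹ x, T.repN g⁻¹ y, T.repN g⁻¹ z] := by
  rw [tensorRep_apply]
  congr 1
  ext j
  fin_cases j <;> rfl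

theorem inner_repN (g : T.SpN) (x y : V) :
    inner ℝ (T.repN g x) (T.repN g y) = inner ℝ x y := by
  rw [repN_apply, repN_apply, LinearIsometryEquiv.inner_map_map]

theorem outer_repN (g : T.SpN) (θ : V →ₗ[ℝ] ℂ) (x y z : V) :
    outer (θ ∘ₗ T.repN g) x y z = outer θ (T.repN g x) (T.repN g y) (T.repN g z) := by
  rw [outer_apply, outer_apply, inner_repN, LinearMap.comp_apply]

theorem toCForm_phi_curryLeft_isComplexForm {τ : Tri V} (h : τ ∈ T.hSym) (x : V) :
    IsComplexForm T.I ((toCForm (T.phi τ)).curryLeft x) := by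
  intro i v
  fin_cases i
  · change T.phi τ x (T.I (v 0)) (v 1) = Complex.I * T.phi τ x (v 0) (v 1)
    simp only [phi_apply, hSym.I h, I_J, I_K, map_neg]
    linear_combination (-τ x (v 0) (T.K (v 1))) * Complex.I_mul_I
  · change T.phi τ x (v 0) (T.I (v 1)) = Complex.I * T.phi τ x (v 0) (v 1)
    simp only [phi_apply, J_I, K_I, map_neg]
    linear_combination (-τ x (v 0) (T.K (v 1))) * Complex.I_mul_I

theorem phi_self {τ : Tri V} (h : τ ∈ T.hSym) (x y : V) : T.phi τ x y y = 0 := by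
  rw [phi_apply, hSym.J_self h, hSym.K_self h, mul_zero, add_zero]

theorem fiveMap_mem_component {W S : Type*} [AddCommGroup W] [Module ℂ W] [AddCommGroup S]
    [Module ℂ S] {σ : Representation ℂ T.SpN W} {τ : Representation ℂ Sp1 S} {F : CForm V 3}
    (hF : F ∈ T.component σ τ 3) : T.fiveMap F ∈ T.component σ τ 5 :=
  map_mem_isotypic T.fiveMap (fun g F => T.fiveMap_tensorRep F g) hF

theorem ofSkew_tensorRep (g : T.SpN) (F : CForm V 3) (x y z : V) :
    T.ofSkew (tensorRep T.repN 3 g F) x y z =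
      T.ofSkew F (T.repN g⁻¹ x) (T.repN g⁻¹ y) (T.repN g⁻¹ z) := by
  rw [ofSkew_apply, ofSkew_apply, tensorRep_vec3, tensorRep_vec3, repN_J, repN_J]

theorem exists_ofSkew_eq {P : Submodule ℂ (CForm V 3)} {τ : Tri V} (h : τ ∈ T.hSym)
    (hP : toCForm (T.phi τ) ∈ P) : ∃ w : P, (T.ofSkew ∘ₗ P.subtype) w = τ := by
  refine ⟨(-1 / 2 : ℂ) • ⟨_, hP⟩, ?_⟩
  rw [map_smul, LinearMap.comp_apply, Submodule.subtype_apply, ofSkew_phi h, smul_smul]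
  norm_num

variable [FiniteDimensional ℝ V]

theorem sum_phi₂₃ {ι : Type*} [Fintype ι] (e : OrthonormalBasis ι ℝ V) {τ : Tri V}
    (h : τ ∈ T.hSym) (ht : tr₂₃ τ = 0) (x : V) : ∑ i, T.phi τ x (e i) (T.J (e i)) = 0 := by
  have := congrArg (fun f => f x) ht
  simp only [tr₂₃_apply e, LinearMap.zero_apply] at this
  simp only [phi_apply, J_J, K_J, map_neg, hSym.I_self h, Finset.sum_add_distrib,
    Finset.sum_neg_distrib, this]
  simp

theorem sum_phi₁₂ {ι : Type*} [Fintype ι] (e : OrthonormalBasis ι ℝ V) {τ : Tri V}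
    (h : τ ∈ T.hSym) (ht : tr₁₂ τ = 0) (z : V) : ∑ i, T.phi τ (e i) (T.J (e i)) z = 0 := by
  have : ∀ z, ∑ i, τ (e i) (e i) z = 0 := fun z => by
    rw [← tr₁₂_apply e, ht, LinearMap.zero_apply]
  simp only [phi_apply, hSym.J h, J_J, J_K, map_neg, Finset.sum_add_distrib, neg_neg,
    Finset.sum_neg_distrib, this, mul_neg, ← Finset.mul_sum]
  simp

theorem toCForm_phi_curryLeft_mem {τ : Tri V} (h : τ ∈ T.hSym) (ht : tr₂₃ τ = 0) (x : V) :
    (toCForm (T.phi τ)).curryLeft x ∈ (T.modLambda 0).toSubmodule := by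
  refine ⟨toCForm_phi_curryLeft_isComplexForm h x, fun v i j hv hij => ?_, fun e w => ?_⟩
  · have : v 0 = v 1 := by
      fin_cases i <;> fin_cases j <;> first | exact absurd rfl hij | exact hv | exact hv.symm
    change T.phi τ x (v 0) (v 1) = 0
    rw [this, phi_self h]
  · exact sum_phi₂₃ e h ht x

theorem comp_phi_curryLeft_mem_component {τ : Tri V} (h : τ ∈ T.hSym) (ht : tr₂₃ τ = 0) (x : V)
    (a b : ℝ) : ((toCForm (T.phi τ)).curryLeft x).compLinearMap (fun _ => T.real1J a b) ∈
      T.component (T.modLambda 0).toRepresentation (SymH 2).toRepresentation 2 :=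
  comp_real1J_mem_component (T.modLambda 0).toSubmodule.subtype (fun _ _ => rfl)
    ⟨_, toCForm_phi_curryLeft_mem h ht x⟩ (toCForm_phi_curryLeft_isComplexForm h x) a b

/-- With the first argument fixed, the weight decomposition exhibits the form in Λ²₀E ⊗ S²H; the
middle weight is obtained by polarization, and vanishing `tr₂₃` gives trace-freeness. -/
theorem xi_curryLeft_mem_component {α β γ : Tri V} (hα : α ∈ T.hSym) (hβ : β ∈ T.hSym)
    (hγ : γ ∈ T.hSym) (tα : tr₂₃ α = 0) (tβ : tr₂₃ β = 0) (tγ : tr₂₃ γ = 0) (x : V) :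
    (toCForm (T.xi α β γ)).curryLeft x ∈
      T.component (T.modLambda 0).toRepresentation (SymH 2).toRepresentation 2 := by
  have ma := comp_phi_curryLeft_mem_component
    (T.hSym.sub_mem hβ (T.hSym.smul_mem Complex.I hγ)) (by simp [tβ, tγ]) x 1 0
  have mb := comp_phi_curryLeft_mem_component hα tα x
  have mc := comp_phi_curryLeft_mem_component
    (T.hSym.add_mem hβ (T.hSym.smul_mem Complex.I hγ)) (by simp [tβ, tγ]) x 0 1
  have m := add_mem (add_mem (Submodule.smul_mem _ (1 / 2 : ℂ) ma)
    (Submodule.smul_mem _ (Complex.I / 2) (sub_mem (sub_mem (mb 1 1) (mb 1 0)) (mb 0 1))))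
    (Submodule.smul_mem _ (1 / 2 : ℂ) mc)
  convert m using 1
  ext v
  change T.xi α β γ x (v 0) (v 1) = _
  rw [xi_eq_phi hα hβ hγ]
  simp only [add_apply, sub_apply, smul_apply, MultilinearMap.compLinearMap_apply,
    MultilinearMap.curryLeft_apply, toCForm_apply, smul_eq_mul, real1J_apply, one_smul, zero_smul,
    add_zero, zero_add]
  change _ = (1 / 2) * T.phi (β - Complex.I • γ) x (v 0) (v 1) + (Complex.I / 2) *
    (T.phi α x (v 0 + T.J (v 0)) (v 1 + T.J (v 1)) - T.phi α x (v 0) (v 1)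
      - T.phi α x (T.J (v 0)) (T.J (v 1)))
    + (1 / 2) * T.phi (β + Complex.I • γ) x (T.J (v 0)) (T.J (v 1))
  simp only [map_add, LinearMap.add_apply]
  ring

theorem fiveMap_xi_mem_torsionSpace {α β γ : Tri V} (hα : α ∈ T.hSym) (hβ : β ∈ T.hSym)
    (hγ : γ ∈ T.hSym) (tα : tr₂₃ α = 0) (tβ : tr₂₃ β = 0) (tγ : tr₂₃ γ = 0) :
    T.fiveMap (toCForm (T.xi α β γ)) ∈ T.torsionSpace := by
  intro x
  rw [fiveMap_curryLeft]
  have h := xi_curryLeft_mem_component hα hβ hγ tα tβ tγ x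
  generalize (toCForm (T.xi α β γ)).curryLeft x = G at h
  exact ⟨map_mem_isotypic T.fourMap (fun g F => T.fourMap_tensorRep F g) h,
    T.fourMap_alternating G⟩

/-! ### The three realizations -/

theorem traceFree_phi {τ : Tri V} (h : τ ∈ T.hSym) (ht : tr₁₂ τ = 0) :
    T.TraceFree (s := 1) (toCForm (T.phi τ)) := fun e w => sum_phi₁₂ e h ht (w 0)

theorem realizes_modLambda : T.Realizes (T.modLambda 1).toRepresentation
    (T.ofSkew ∘ₗ (T.modLambda 1).toSubmodule.subtype) (T.typeSpace .Λ₃) where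
  equivariant g w := ofSkew_tensorRep g w.1
  mem w := by
    refine ofSkew_mem w.2.1 fun x y z => ?_
    have h := w.2.2.1
    have h' : ∀ y, ofCForm w.1 x y y = 0 := fun y => h ![x, y, y] 1 2 rfl (by decide)
    -- Vanishing on repeated arguments is polarized to skewness.
    have h1 := h' (y + z)
    simp only [map_add, LinearMap.add_apply, h'] at h1
    rw [ofCForm_apply, ofCForm_apply] at h1
    change w.1 ![x, y, z] = -w.1 ![x, z, y]
    linear_combination h1
  exists_eq τ hτ hc := by
    obtain ⟨h, h1, h2, h3⟩ := hτ
    refine exists_ofSkew_eq h ⟨phi_isComplexForm h hc, fun v i j hv hij => ?_, traceFree_phi h h1⟩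
    have hs : T.symOp τ = (-4 : ℂ) • τ := by
      rw [neg_smul]
      exact eq_neg_of_add_eq_zero_left h3
    -- Subtracting two cyclic instances of the eigenvalue equation for -4 leaves six times the
    -- difference of φ and its cyclic shift.
    have hcyc : ∀ x y z, T.phi τ x y z = T.phi τ y z x := by
      intro x y z
      have h1 := phi_symOp h hc x y z
      have h2 := phi_symOp h hc y z x
      rw [hs, map_smul] at h1 h2
      simp only [LinearMap.smul_apply, smul_eq_mul] at h1 h2
      linear_combination (-1 / 6) * h1 + (1 / 6) * h2
    change T.phi τ (v 0) (v 1) (v 2) = 0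
    fin_cases i <;> fin_cases j
    · exact absurd rfl hij
    · rw [show v 0 = v 1 from hv, ← hcyc, phi_self h]
    · rw [show v 0 = v 2 from hv, hcyc, phi_self h]
    · rw [show v 1 = v 0 from hv, ← hcyc, phi_self h]
    · exact absurd rfl hij
    · rw [show v 1 = v 2 from hv, phi_self h]
    · rw [show v 2 = v 0 from hv, hcyc, phi_self h]
    · rw [show v 2 = v 1 from hv, phi_self h]
    · exact absurd rfl hij
  le := typeSpace_le _
  comp_I _ := typeSpace_comp_I
  comp_J _ := typeSpace_comp_J
  comp_K _ := typeSpace_comp_K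

/-- Eigenvalue 2 translates into the vanishing cyclic sum that defines K; the two trace conditions
translate into the two contractions. -/
theorem realizes_modK : T.Realizes T.modK.toRepresentation
    (T.ofSkew ∘ₗ T.modK.toSubmodule.subtype) (T.typeSpace .K) where
  equivariant g w := ofSkew_tensorRep g w.1
  mem w := ofSkew_mem w.2.1 w.2.2.1
  exists_eq τ hτ hc := by
    obtain ⟨h, h1, h2, h3⟩ := hτ
    refine exists_ofSkew_eq h ⟨phi_isComplexForm h hc, phi_skew h, fun e => sum_phi₂₃ e h h2,
      fun x y z => ?_, traceFree_phi h h1⟩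
    have hs : T.symOp τ = (2 : ℂ) • τ := sub_eq_zero.1 h3
    have h1 := phi_symOp h hc x y z
    rw [hs, map_smul] at h1
    simp only [LinearMap.smul_apply, smul_eq_mul] at h1
    change T.phi τ x y z + T.phi τ y z x + T.phi τ z x y = 0
    linear_combination (1 / 2) * h1
  le := typeSpace_le _
  comp_I _ := typeSpace_comp_I
  comp_J _ := typeSpace_comp_J
  comp_K _ := typeSpace_comp_K

/-- A tensor of degree one as a linear map. -/
def oneForm : CForm V 1 →ₗ[ℂ] (V →ₗ[ℝ] ℂ) where
  toFun F := (MultilinearMap.ofSubsingleton ℝ V ℂ (0 : Fin 1)).symm F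
  map_add' _ _ := by ext; rfl
  map_smul' _ _ := by ext; rfl

/-- The one-form is recovered from `ofForm θ` by `tr₁₂`, up to a nonzero constant; hence complex
linearity of the trilinear map in its first argument forces that of θ. -/
theorem realizes_modE (h4 : 4 < Module.finrank ℝ V) : T.Realizes T.modE.toRepresentation
    (T.ofForm ∘ₗ oneForm ∘ₗ T.modE.toSubmodule.subtype) (T.typeSpace .E) where
  equivariant g w x y z := by
    have : oneForm (tensorRep T.repN 1 g w.1) = oneForm w.1 ∘ₗ T.repN g⁻¹ := rfl
    change T.ofForm (oneForm (tensorRep T.repN 1 g w.1)) x y z = T.ofForm (oneForm w.1) _ _ _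
    rw [this, ofForm_apply, ofForm_apply]
    simp only [LinearMap.sub_apply, LinearMap.smul_apply, symOp_apply, outer_repN, repN_I, repN_J,
      repN_K]
  mem w := ofForm_mem _
  exists_eq τ hτ hc := by
    obtain ⟨θ, rfl⟩ := hτ
    rw [ofForm_comp_I, ← map_smul] at hc
    have hc' := congrArg tr₁₂ hc
    rw [tr₁₂_ofForm, tr₁₂_ofForm] at hc'
    have hθ : θ ∘ₗ T.I = Complex.I • θ := smul_right_injective _ (finrank_aux_ne h4) hc'
    refine ⟨⟨MultilinearMap.ofSubsingleton ℝ V ℂ (0 : Fin 1) θ, fun i v => ?_⟩, ?_⟩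
    · have : i = 0 := Subsingleton.elim _ _
      subst this
      change θ (Function.update v 0 (T.I (v 0)) 0) = Complex.I * θ (v 0)
      rw [Function.update_self]
      exact congrArg (fun f => f (v 0)) hθ
    · change T.ofForm (oneForm (MultilinearMap.ofSubsingleton ℝ V ℂ (0 : Fin 1) θ)) = _
      congr 1
  le := typeSpace_le _
  comp_I _ := typeSpace_comp_I
  comp_J _ := typeSpace_comp_J
  comp_K _ := typeSpace_comp_K

theorem fiveMap_xiH_mem_quatModule (h4 : 4 < Module.finrank ℝ V) {w : EType} {δ : Tri V}
    (h : δ ∈ T.typeSpace w) : T.fiveMap (toCForm (T.xiH δ)) ∈ T.quatModule (w, .H) := by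
  have ht : T.fiveMap (toCForm (T.xiH δ)) ∈ T.torsionSpace :=
    fiveMap_xi_mem_torsionSpace (hSym.comp (typeSpace_le w h) _) (hSym.comp (typeSpace_le w h) _)
      (hSym.comp (typeSpace_le w h) _) (typeSpace_tr₂₃ h4 (typeSpace_comp_I h))
      (typeSpace_tr₂₃ h4 (typeSpace_comp_J h)) (typeSpace_tr₂₃ h4 (typeSpace_comp_K h))
  cases w
  · exact ⟨fiveMap_mem_component (realizes_modLambda.xiH_mem h), ht⟩
  · exact ⟨fiveMap_mem_component (realizes_modK.xiH_mem h), ht⟩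
  · exact ⟨fiveMap_mem_component ((realizes_modE h4).xiH_mem h), ht⟩

theorem fiveMap_xi_mem_quatModule (h4 : 4 < Module.finrank ℝ V) {w : EType} {α β γ : Tri V}
    (hα : α ∈ T.typeSpace w) (hβ : β ∈ T.typeSpace w) (hγ : γ ∈ T.typeSpace w)
    (h : α ∘ₗ T.I + β ∘ₗ T.J + γ ∘ₗ T.K = 0) :
    T.fiveMap (toCForm (T.xi α β γ)) ∈ T.quatModule (w, .S₃) := by
  have ht : T.fiveMap (toCForm (T.xi α β γ)) ∈ T.torsionSpace :=
    fiveMap_xi_mem_torsionSpace (typeSpace_le w hα) (typeSpace_le w hβ) (typeSpace_le w hγ)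
      (typeSpace_tr₂₃ h4 hα) (typeSpace_tr₂₃ h4 hβ) (typeSpace_tr₂₃ h4 hγ)
  cases w
  · exact ⟨fiveMap_mem_component (realizes_modLambda.xi_mem hα hβ hγ h), ht⟩
  · exact ⟨fiveMap_mem_component (realizes_modK.xi_mem hα hβ hγ h), ht⟩
  · exact ⟨fiveMap_mem_component ((realizes_modE h4).xi_mem hα hβ hγ h), ht⟩

end Triple

/-! ### Kernel of the map to five-tensors and the Clebsch–Gordan splitting. -/

namespace Triple

variable {V : Type*} [NormedAddCommGroup V] [InnerProductSpace ℝ V] {T : Triple V}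

/-- The part of pure trace is in the kernel, since the fundamental form is invariant. -/
theorem fiveMap_xi_outer (a b c : V →ₗ[ℝ] ℂ) :
    T.fiveMap (toCForm (T.xi (outer a) (outer b) (outer c))) = 0 := by
  ext v
  rw [fiveMap_apply, fourMap_apply]
  have sI : ∀ x y, ((inner ℝ y (T.I x) : ℝ) : ℂ) = -((inner ℝ x (T.I y) : ℝ) : ℂ) := fun x y => by
    rw [← Complex.ofReal_neg, ← T.inner_I_left, real_inner_comm]
  have sJ : ∀ x y, ((inner ℝ y (T.J x) : ℝ) : ℂ) = -((inner ℝ x (T.J y) : ℝ) : ℂ) := fun x y => by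
    rw [← Complex.ofReal_neg, ← T.inner_J_left, real_inner_comm]
  have sK : ∀ x y, ((inner ℝ y (T.K x) : ℝ) : ℂ) = -((inner ℝ x (T.K y) : ℝ) : ℂ) := fun x y => by
    rw [← Complex.ofReal_neg, ← T.inner_K_left, real_inner_comm]
  have key : ∀ p q r s : V,
      T.pairing ((toCForm (T.xi (outer a) (outer b) (outer c))).curryLeft (v 0)) p q r s =
      2 * (a (v 0) * ((inner ℝ p (T.K q) : ℝ) * (inner ℝ r (T.J s) : ℝ)
          - (inner ℝ p (T.J q) : ℝ) * (inner ℝ r (T.K s) : ℝ))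
        + b (v 0) * ((inner ℝ p (T.I q) : ℝ) * (inner ℝ r (T.K s) : ℝ)
          - (inner ℝ p (T.K q) : ℝ) * (inner ℝ r (T.I s) : ℝ))
        + c (v 0) * ((inner ℝ p (T.J q) : ℝ) * (inner ℝ r (T.I s) : ℝ)
          - (inner ℝ p (T.I q) : ℝ) * (inner ℝ r (T.J s) : ℝ))) := by
    intro p q r s
    have e : ∀ x y : V, (toCForm (T.xi (outer a) (outer b) (outer c))).curryLeft (v 0) ![x, y] =
        a (v 0) * (inner ℝ x (T.I y) : ℝ) + b (v 0) * (inner ℝ x (T.J y) : ℝ)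
          + c (v 0) * (inner ℝ x (T.K y) : ℝ) := fun _ _ => rfl
    simp only [pairing, e, I_I, I_J, I_K, J_I, J_J, J_K, K_I, K_J, K_K, inner_neg_right]
    rw [real_inner_comm q p]
    push_cast
    rw [sI p q, sJ p q, sK p q]
    ring
  simp only [key]
  rw [zero_apply]
  ring

variable [FiniteDimensional ℝ V]

/-- The average of α(I·), β(J·), γ(K·) carries the H-part, and what remains after subtracting it has
vanishing sum, hence is of type S³H. If that sum is zero the H-part is absent; if the three maps
coincide the remainder is absent. -/
theorem fiveMap_xi_mem_quatClass_of_mem (h4 : 4 < Module.finrank ℝ V) {w : EType} {α β γ : Tri V}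
    (hα : α ∈ T.typeSpace w) (hβ : β ∈ T.typeSpace w) (hγ : γ ∈ T.typeSpace w)
    {C : Set (EType × HType)}
    (hH : (w, HType.H) ∉ C → α ∘ₗ T.I + β ∘ₗ T.J + γ ∘ₗ T.K = 0)
    (hS : (w, HType.S₃) ∉ C → α ∘ₗ T.I = β ∘ₗ T.J ∧ β ∘ₗ T.J = γ ∘ₗ T.K) :
    T.fiveMap (toCForm (T.xi α β γ)) ∈ T.quatClass C := by
  -- The sign comes from A² = -1: the triple δ(I·), δ(J·), δ(K·) behind `xiH δ` becomes -δ three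
  -- times after composing once more with I, J, K.
  set δ : Tri V := (-1 / 3 : ℂ) • (α ∘ₗ T.I + β ∘ₗ T.J + γ ∘ₗ T.K) with hδ
  have hm : δ ∈ T.typeSpace w := Submodule.smul_mem _ _
    (add_mem (add_mem (typeSpace_comp_I hα) (typeSpace_comp_J hβ)) (typeSpace_comp_K hγ))
  have key : T.xi α β γ = T.xiH δ + T.xi (α - δ ∘ₗ T.I) (β - δ ∘ₗ T.J) (γ - δ ∘ₗ T.K) := by
    ext x y z
    simp only [LinearMap.add_apply, xi_apply, xiH_apply, LinearMap.sub_apply, LinearMap.comp_apply]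
    ring
  rw [key, map_add, map_add]
  have le : ∀ c ∈ C, T.quatModule c ≤ T.quatClass C := fun c hc => le_biSup T.quatModule hc
  refine add_mem ?_ ?_
  · by_cases hc : (w, HType.H) ∈ C
    · exact le _ hc (fiveMap_xiH_mem_quatModule h4 hm)
    · have : δ = 0 := by rw [hδ, hH hc, smul_zero]
      rw [this, map_zero, map_zero, map_zero]
      exact zero_mem _
  · by_cases hc : (w, HType.S₃) ∈ C
    · refine le _ hc (fiveMap_xi_mem_quatModule h4 (sub_mem hα (typeSpace_comp_I hm))
        (sub_mem hβ (typeSpace_comp_J hm)) (sub_mem hγ (typeSpace_comp_K hm)) ?_)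
      ext x y z
      simp only [hδ, LinearMap.add_apply, LinearMap.sub_apply, LinearMap.comp_apply,
        LinearMap.smul_apply, smul_eq_mul, I_I, J_J, K_K, map_neg, LinearMap.neg_apply,
        LinearMap.zero_apply]
      ring
    · obtain ⟨h1, h2⟩ := hS hc
      have e1 : ∀ x y z, α (T.I x) y z = β (T.J x) y z := fun x y z =>
        congrArg (fun τ : Tri V => τ x y z) h1
      have e2 : ∀ x y z, β (T.J x) y z = γ (T.K x) y z := fun x y z =>
        congrArg (fun τ : Tri V => τ x y z) h2
      have a0 : α - δ ∘ₗ T.I = 0 := by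
        rw [hδ, ← h2, ← h1]
        ext x y z
        simp only [LinearMap.add_apply, LinearMap.sub_apply, LinearMap.comp_apply,
          LinearMap.smul_apply, smul_eq_mul, I_I, map_neg, LinearMap.neg_apply,
          LinearMap.zero_apply]
        ring
      have b0 : β - δ ∘ₗ T.J = 0 := by
        rw [hδ, h1, ← h2]
        ext x y z
        simp only [LinearMap.add_apply, LinearMap.sub_apply, LinearMap.comp_apply,
          LinearMap.smul_apply, smul_eq_mul, J_J, map_neg, LinearMap.neg_apply,
          LinearMap.zero_apply]
        ring
      have c0 : γ - δ ∘ₗ T.K = 0 := by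
        rw [hδ, h1, h2]
        ext x y z
        simp only [LinearMap.add_apply, LinearMap.sub_apply, LinearMap.comp_apply,
          LinearMap.smul_apply, smul_eq_mul, K_K, map_neg, LinearMap.neg_apply,
          LinearMap.zero_apply]
        ring
      have : T.xi (α - δ ∘ₗ T.I) (β - δ ∘ₗ T.J) (γ - δ ∘ₗ T.K) = 0 := by
        rw [a0, b0, c0]
        simp [xi]
      rw [this, map_zero, map_zero]
      exact zero_mem _

/-- The pure trace part lies in the kernel of `fiveMap`, so the three types can be treated one at a
time. -/
theorem fiveMap_xi_mem_quatClass (h4 : 4 < Module.finrank ℝ V) {α β γ : Tri V}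
    (hα : α ∈ T.hSym) (hβ : β ∈ T.hSym) (hγ : γ ∈ T.hSym) {C : Set (EType × HType)}
    (hH : ∀ w, (w, HType.H) ∉ C →
      T.proj w (α ∘ₗ T.I) + T.proj w (β ∘ₗ T.J) + T.proj w (γ ∘ₗ T.K) = 0)
    (hS : ∀ w, (w, HType.S₃) ∉ C →
      T.proj w (α ∘ₗ T.I) = T.proj w (β ∘ₗ T.J) ∧ T.proj w (β ∘ₗ T.J) = T.proj w (γ ∘ₗ T.K)) :
    T.fiveMap (toCForm (T.xi α β γ)) ∈ T.quatClass C := by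
  have hw : ∀ w, T.fiveMap (toCForm (T.xi (T.proj w α) (T.proj w β) (T.proj w γ))) ∈
      T.quatClass C := by
    intro w
    refine fiveMap_xi_mem_quatClass_of_mem h4 (proj_mem h4 hα w) (proj_mem h4 hβ w)
      (proj_mem h4 hγ w) (fun hc => ?_) fun hc => ?_
    · rw [← proj_comp_I hα, ← proj_comp_J hβ, ← proj_comp_K hγ]
      exact hH w hc
    · rw [← proj_comp_I hα, ← proj_comp_J hβ, ← proj_comp_K hγ]
      exact hS w hc
  have key : T.xi α β γ = T.xi (tracePart α) (tracePart β) (tracePart γ) +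
      (T.xi (T.proj .Λ₃ α) (T.proj .Λ₃ β) (T.proj .Λ₃ γ) +
        T.xi (T.proj .K α) (T.proj .K β) (T.proj .K γ) +
        T.xi (T.proj .E α) (T.proj .E β) (T.proj .E γ)) := by
    conv_lhs => rw [T.add_proj α, T.add_proj β, T.add_proj γ]
    ext x y z
    simp only [LinearMap.add_apply, xi_apply]
    ring
  have h0 : T.fiveMap (toCForm (T.xi (tracePart α) (tracePart β) (tracePart γ))) = 0 := by
    have e : ∀ τ : Tri V, tracePart τ = outer ((Module.finrank ℝ V : ℂ)⁻¹ • tr₂₃ τ) := fun τ =>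
      (map_smul outer _ _).symm
    rw [e, e, e]
    exact fiveMap_xi_outer _ _ _
  rw [key, map_add, map_add, h0, zero_add, map_add, map_add, map_add, map_add]
  exact add_mem (add_mem (hw _) (hw _)) (hw _)

end Triple

namespace Triple

variable {V : Type*} [NormedAddCommGroup V] [InnerProductSpace ℝ V] (T : Triple V)

/-! ### Equations satisfied when a Gray–Hervella component vanishes -/

/-- The equation that characterizes the sum of the three Gray–Hervella modules of `I` other than
the given one. -/
def ghEquation : GHType → RForm V 3 → Prop
  | .W₁, a => ∀ x y z, a ![x, y, z] + a ![y, z, x] + a ![z, x, y] =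
      a ![T.I x, T.I y, z] + a ![T.I y, T.I z, x] + a ![T.I z, T.I x, y]
  | .W₂, a => ∀ x y z, a ![x, y, z] + a ![y, x, z] =
      a ![T.I x, T.I y, z] + a ![T.I y, T.I x, z]
  | .W₃, a => ∃ θ : V →ₗ[ℝ] ℝ, ∀ x y z, a ![x, y, z] + a ![T.I x, T.I y, z] =
      inner ℝ x y * θ z - inner ℝ x z * θ y - inner ℝ x (T.I y) * θ (T.I z)
        + inner ℝ x (T.I z) * θ (T.I y)
  | .W₄, a => ∀ (e : OrthonormalBasis (Fin (Module.finrank ℝ V)) ℝ V) (z : V),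
      ∑ i, a ![e i, e i, z] = 0

/-- The solutions of `ghEquation` form a subspace. -/
def ghSolutions (c : GHType) : Submodule ℝ (RForm V 3) where
  carrier := {a | T.ghEquation c a}
  zero_mem' := by
    cases c
    · simp [ghEquation]
    · simp [ghEquation]
    · exact ⟨0, by simp⟩
    · simp [ghEquation]
  add_mem' := by
    intro a b ha hb
    cases c
    · intro x y z
      simp only [add_apply]
      linear_combination ha x y z + hb x y z
    · intro x y z
      simp only [add_apply]
      linear_combination ha x y z + hb x y z
    · obtain ⟨θ, h⟩ := ha
      obtain ⟨η, k⟩ := hb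
      refine ⟨θ + η, fun x y z => ?_⟩
      simp only [add_apply, LinearMap.add_apply]
      linear_combination h x y z + k x y z
    · intro e z
      simp only [add_apply, Finset.sum_add_distrib, ha e z, hb e z, add_zero]
  smul_mem' := by
    intro r a ha
    cases c
    · intro x y z
      simp only [smul_apply, smul_eq_mul]
      linear_combination r * ha x y z
    · intro x y z
      simp only [smul_apply, smul_eq_mul]
      linear_combination r * ha x y z
    · obtain ⟨θ, h⟩ := ha
      refine ⟨r • θ, fun x y z => ?_⟩
      simp only [smul_apply, smul_eq_mul, LinearMap.smul_apply]
      linear_combination r * h x y z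
    · intro e z
      simp only [smul_apply, ← Finset.smul_sum, ha e z, smul_zero]

variable {T}

theorem ghSpace_move {a : RForm V 3} (h : a ∈ ghSpace T.I) (x y z : V) :
    a ![x, T.I y, z] = a ![x, y, T.I z] := by
  have := h.2 x y (T.I z)
  have e : a ![x, T.I y, -z] = -a ![x, T.I y, z] := by
    have h1 := h.1 x (T.I y) (-z)
    have h2 := a.map_update_smul ![x, T.I y, z] 2 (-1) z
    simp only [update_two_vec3] at h2
    simpa using h2
  rw [I_I, e] at this
  linarith

theorem ghOne_skew {a : RForm V 3} (h : a ∈ ghOne T.I) (x y z : V) :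
    a ![x, y, z] = -a ![y, x, z] := by
  have h0 := h.2 (x + y) z
  have e1 := a.map_update_add ![x + y, x + y, z] 0 x y
  have e2 := a.map_update_add ![x, x + y, z] 1 x y
  have e3 := a.map_update_add ![y, x + y, z] 1 x y
  simp only [update_zero_vec3, update_one_vec3] at e1 e2 e3
  rw [e1, e2, e3, h.2 x z, h.2 y z] at h0
  linarith

/-- Elements of 𝒲₁ are skew in all arguments, so the compatibility with I in the last two arguments
holds in the first two as well. -/
theorem ghOne_anti {a : RForm V 3} (h : a ∈ ghOne T.I) (x y z : V) :
    a ![T.I x, T.I y, z] = -a ![x, y, z] := by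
  rw [ghOne_skew h x y z, h.1.1 y x z, neg_neg, ghOne_skew h y z x, ← h.1.2 z y x,
    ghOne_skew h (T.I x), h.1.1 (T.I y) (T.I x) z, neg_neg, ghOne_skew h (T.I y) z,
    h.1.1 z (T.I y) (T.I x), h.1.1 z (T.I x) (T.I y)]

theorem ghTwo_anti {a : RForm V 3} (h : a ∈ ghTwo T.I) (x y z : V) :
    a ![T.I x, T.I y, z] = -a ![x, y, z] := by
  -- The cyclic identity at (Ix, Iy, z). Its three cyclic instances form a linear system for the
  -- values a(I·, I·, ·), whose solution is -a by the cyclic identity at (x, y, z).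
  have key : ∀ x y z, a ![T.I x, T.I y, z] + a ![T.I y, T.I z, x] = a ![z, x, y] := by
    intro x y z
    have := h.2 (T.I x) (T.I y) z
    rw [h.1.2 z x y, ← ghSpace_move h.1 (T.I y) z x] at this
    linarith
  have h1 := key x y z
  have h2 := key y z x
  have h3 := key z x y
  have h0 := h.2 x y z
  linarith

theorem ghFour_invariant {a : RForm V 3} (h : a ∈ ghFour T.I) (x y z : V) :
    a ![T.I x, T.I y, z] = a ![x, y, z] := by
  obtain ⟨-, θ, h⟩ := h
  rw [h, h]
  simp only [T.inner_I, T.inner_I_left, I_I, map_neg, inner_neg_right]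
  ring

theorem sum_isoI {a : RForm V 3} (e : OrthonormalBasis (Fin (Module.finrank ℝ V)) ℝ V)
    (z : V) [FiniteDimensional ℝ V] :
    ∑ i, a ![T.I (e i), T.I (e i), z] = ∑ i, a ![e i, e i, z] := by
  let B : V →ₗ[ℝ] V →ₗ[ℝ] ℝ := LinearMap.mk₂ ℝ (fun x y => a ![x, y, z])
    (fun x x' y => by
      have := a.map_update_add ![x, y, z] 0 x x'
      simpa only [update_zero_vec3] using this)
    (fun c x y => by
      have := a.map_update_smul ![x, y, z] 0 c x
      simpa only [update_zero_vec3] using this)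
    (fun x y y' => by
      have := a.map_update_add ![x, y, z] 1 y y'
      simpa only [update_one_vec3] using this)
    (fun c x y => by
      have := a.map_update_smul ![x, y, z] 1 c y
      simpa only [update_one_vec3] using this)
  have := sum_bilin_orthonormal B (e.map T.isoI) e
  simpa [B] using this

/-- On 𝒲₁ and 𝒲₂ simultaneous I in the first two arguments acts as -1, on 𝒲₃ and 𝒲₄ as +1. So the
first two equations hold on 𝒲₃ + 𝒲₄ and the last two on 𝒲₁ + 𝒲₂; within each pair the defining
property of the other module applies. Only this inclusion is needed, not the direct sum
decomposition. -/
theorem ghClass_le_ghSolutions [FiniteDimensional ℝ V] {C : Set GHType} {c : GHType}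
    (hc : c ∉ C) : ghClass T.I C ≤ T.ghSolutions c := by
  refine iSup₂_le fun d hd => ?_
  have hdc : d ≠ c := fun h => hc (h ▸ hd)
  intro a ha
  have anti : d = .W₁ ∨ d = .W₂ → ∀ x y z, a ![T.I x, T.I y, z] = -a ![x, y, z] := by
    rintro (rfl | rfl)
    · exact ghOne_anti ha
    · exact ghTwo_anti ha
  have inv : d = .W₃ ∨ d = .W₄ → ∀ x y z, a ![T.I x, T.I y, z] = a ![x, y, z] := by
    rintro (rfl | rfl)
    · exact ha.2.1
    · exact ghFour_invariant ha
  have h34 : d = .W₃ ∨ d = .W₄ → c = .W₁ ∨ c = .W₂ → a ∈ T.ghSolutions c := by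
    rintro h (rfl | rfl)
    · intro x y z
      simp only [inv h]
    · intro x y z
      simp only [inv h]
  have h12 : d = .W₁ ∨ d = .W₂ → c = .W₃ ∨ c = .W₄ → a ∈ T.ghSolutions c := by
    rintro h (rfl | rfl)
    · refine ⟨0, fun x y z => ?_⟩
      simp [anti h]
    · intro e z
      have := sum_isoI (T := T) (a := a) e z
      simp only [anti h, Finset.sum_neg_distrib] at this
      linarith
  cases d <;> cases c <;> first | exact absurd rfl hdc |
    exact h34 (.inl rfl) (.inl rfl) |
    exact h34 (.inl rfl) (.inr rfl) |
    exact h34 (.inr rfl) (.inl rfl) |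
    exact h34 (.inr rfl) (.inr rfl) |
    exact h12 (.inl rfl) (.inl rfl) |
    exact h12 (.inl rfl) (.inr rfl) |
    exact h12 (.inr rfl) (.inl rfl) |
    exact h12 (.inr rfl) (.inr rfl) | skip
  · intro x y z
    have := ghOne_skew ha x y z
    have := ghOne_skew ha (T.I x) (T.I y) z
    linarith
  · intro x y z
    simp only [anti (.inr rfl)]
    have := ha.2 x y z
    linarith
  · exact ha.2.2
  · obtain ⟨-, θ, h⟩ := ha
    -- The factor 2 appears because invariance makes the left-hand side of the equation 2a.
    refine ⟨(2 : ℝ) • θ, fun x y z => ?_⟩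
    rw [inv (.inr rfl), h]
    simp only [LinearMap.smul_apply, smul_eq_mul]
    ring

/-! ### Translation to symmetric forms -/

section Translation

variable {α β γ : Tri V} {a : RForm V 3}

/-- The part of a real tensor on which `I` acts compatibly with the complex structure. -/
theorem sub_eq_of_eq (hβ : β ∈ T.hSym) (hγ : γ ∈ T.hSym)
    (ha : ∀ x y z, (a ![x, y, z] : ℂ) = γ x y (T.J z) - β x y (T.K z)) (x y z : V) :
    (a ![x, y, z] : ℂ) - a ![T.I x, T.I y, z] =
      (γ + β ∘ₗ T.I) x y (T.J z) + (γ + β ∘ₗ T.I) (T.I x) y (T.K z) := by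
  rw [ha, ha, hSym.I hβ, hSym.I hγ]
  simp only [LinearMap.add_apply, LinearMap.comp_apply, I_I, I_J, I_K, map_neg,
    LinearMap.neg_apply]
  ring

theorem add_eq_of_eq (hβ : β ∈ T.hSym) (hγ : γ ∈ T.hSym)
    (ha : ∀ x y z, (a ![x, y, z] : ℂ) = γ x y (T.J z) - β x y (T.K z)) (x y z : V) :
    (a ![x, y, z] : ℂ) + a ![T.I x, T.I y, z] =
      (γ - β ∘ₗ T.I) x y (T.J z) - (γ - β ∘ₗ T.I) (T.I x) y (T.K z) := by
  rw [ha, ha, hSym.I hβ, hSym.I hγ]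
  simp only [LinearMap.sub_apply, LinearMap.comp_apply, I_I, I_J, I_K, map_neg,
    LinearMap.neg_apply]
  ring

/-- With u = γ + β(I·), the part of a that changes sign under I ⊗ I is u(x;y,Jz) + u(Ix;y,Kz), and
the equation says that its cyclic sum vanishes. Inserting Jz, respectively Jy, in the last argument
and adding gives the eigenvalue equation. -/
theorem symOp_eq_of_ghEquation_one (hβ : β ∈ T.hSym) (hγ : γ ∈ T.hSym)
    (ha : ∀ x y z, (a ![x, y, z] : ℂ) = γ x y (T.J z) - β x y (T.K z))
    (h : T.ghEquation .W₁ a) :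
    T.symOp (γ + β ∘ₗ T.I) = (2 : ℂ) • (γ + β ∘ₗ T.I) := by
  have hu : γ + β ∘ₗ T.I ∈ T.hSym := add_mem hγ (hSym.comp hβ _)
  have hs := sub_eq_of_eq hβ hγ ha
  generalize γ + β ∘ₗ T.I = u at *
  have hc : ∀ x y z, (u x y (T.J z) + u (T.I x) y (T.K z)) + (u y z (T.J x) + u (T.I y) z (T.K x))
      + (u z x (T.J y) + u (T.I z) x (T.K y)) = 0 := by
    intro x y z
    have h0 : (a ![x, y, z] : ℂ) + a ![y, z, x] + a ![z, x, y] =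
      a ![T.I x, T.I y, z] + a ![T.I y, T.I z, x] + a ![T.I z, T.I x, y] := by
      exact_mod_cast h x y z
    rw [← hs, ← hs, ← hs]
    linear_combination h0
  ext x y z
  have h1 := hc x y (T.J z)
  have h2 := hc x z (T.J y)
  simp only [J_J, K_J, I_J, map_neg] at h1 h2
  simp only [hSym.J hu, J_J, J_K, map_neg] at h1 h2
  simp only [symOp_apply, LinearMap.smul_apply, smul_eq_mul]
  rw [hSym.symm hu x z y, hSym.I_swap hu _ y z] at h2
  rw [hSym.symm hu y z x, hSym.I_swap hu _ x z] at h1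
  rw [hSym.symm hu z y x, hSym.I_swap hu _ x y] at h2
  linear_combination h1 + h2

/-- Now the same part is skew in its first two arguments, besides being skew in the last two, hence
cyclically invariant; four instances of this invariance add up to the eigenvalue equation. -/
theorem symOp_eq_of_ghEquation_two (hβ : β ∈ T.hSym) (hγ : γ ∈ T.hSym)
    (ha : ∀ x y z, (a ![x, y, z] : ℂ) = γ x y (T.J z) - β x y (T.K z))
    (h : T.ghEquation .W₂ a) :
    T.symOp (γ + β ∘ₗ T.I) = (-4 : ℂ) • (γ + β ∘ₗ T.I) := by
  have hu : γ + β ∘ₗ T.I ∈ T.hSym := add_mem hγ (hSym.comp hβ _)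
  have hs := sub_eq_of_eq hβ hγ ha
  generalize γ + β ∘ₗ T.I = u at *
  have hc : ∀ x y z, (u x y (T.J z) + u (T.I x) y (T.K z)) + (u y x (T.J z) + u (T.I y) x (T.K z))
      = 0 := by
    intro x y z
    have h0 : (a ![x, y, z] : ℂ) + a ![y, x, z] =
      a ![T.I x, T.I y, z] + a ![T.I y, T.I x, z] := by
      exact_mod_cast h x y z
    rw [← hs, ← hs]
    linear_combination h0
  have hsk : ∀ x y z, u x y (T.J z) + u (T.I x) y (T.K z) =
      -(u x z (T.J y) + u (T.I x) z (T.K y)) := by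
    intro x y z
    rw [hSym.J_swap hu x y z, hSym.K_swap hu _ y z]
    ring
  have hcyc : ∀ x y z, u x y (T.J z) + u (T.I x) y (T.K z) =
      u y z (T.J x) + u (T.I y) z (T.K x) := by
    intro x y z
    linear_combination hc x y z - hsk y x z
  ext x y z
  have h1 := hcyc x y (T.J z)
  have h2 := hcyc x z (T.J y)
  have h3 := hcyc (T.J z) x y
  have h4 := hcyc (T.J y) x z
  simp only [J_J, K_J, I_J, map_neg] at h1 h2 h3 h4
  simp only [hSym.J hu, J_J, J_K, map_neg] at h1 h2 h3 h4
  simp only [symOp_apply, LinearMap.smul_apply, smul_eq_mul]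
  rw [hSym.symm hu x z y, hSym.I_swap hu _ y z] at h2 h4
  rw [hSym.symm hu y z x, hSym.I_swap hu _ x z] at h1
  rw [hSym.symm hu z y x, hSym.I_swap hu _ x y] at h2
  linear_combination -h1 - h2 + h3 + h4

theorem eq_symOp_of_ghEquation_three (hβ : β ∈ T.hSym) (hγ : γ ∈ T.hSym)
    (ha : ∀ x y z, (a ![x, y, z] : ℂ) = γ x y (T.J z) - β x y (T.K z))
    (h : T.ghEquation .W₃ a) : ∃ ζ, γ - β ∘ₗ T.I = T.symOp (outer ζ) := by
  have hu : γ - β ∘ₗ T.I ∈ T.hSym := sub_mem hγ (hSym.comp hβ _)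
  have hs := add_eq_of_eq hβ hγ ha
  generalize γ - β ∘ₗ T.I = u at *
  obtain ⟨θ, h⟩ := h
  have hc : ∀ x y z, u x y (T.J z) - u (T.I x) y (T.K z) =
      ((inner ℝ x y * θ z - inner ℝ x z * θ y - inner ℝ x (T.I y) * θ (T.I z)
        + inner ℝ x (T.I z) * θ (T.I y) : ℝ) : ℂ) := by
    intro x y z
    rw [← hs, ← h, Complex.ofReal_add]
  -- Evaluating at (x, y, Jz) and (x, z, Jy) and adding gives -2u on the left and S applied to (θ ∘
  -- J) ⊗ metric on the right.
  refine ⟨(-1 / 2 : ℂ) • ((Complex.ofRealCLM.toLinearMap ∘ₗ θ) ∘ₗ T.J), ?_⟩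
  ext x y z
  have h1 := hc x y (T.J z)
  have h2 := hc x z (T.J y)
  simp only [J_J, K_J, I_J, map_neg] at h1 h2
  rw [hSym.symm hu x z y, hSym.I_swap hu _ y z] at h2
  push_cast at h1 h2
  simp only [symOp_apply, outer_apply, LinearMap.smul_apply, LinearMap.comp_apply, smul_eq_mul,
    J_I, J_J, J_K, map_neg]
  simp only [ContinuousLinearMap.coe_coe, Complex.ofRealCLM_apply]
  linear_combination (-1 / 2) * (h1 + h2)

theorem tr₁₂_eq_zero_of_ghEquation_four [FiniteDimensional ℝ V] (hβ : β ∈ T.hSym)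
    (ha : ∀ x y z, (a ![x, y, z] : ℂ) = γ x y (T.J z) - β x y (T.K z))
    (h : T.ghEquation .W₄ a) : tr₁₂ (γ - β ∘ₗ T.I) = 0 := by
  ext z
  rw [map_sub, tr₁₂_comp_I hβ, LinearMap.sub_apply, LinearMap.comp_apply,
    tr₁₂_apply (stdOrthonormalBasis ℝ V), tr₁₂_apply (stdOrthonormalBasis ℝ V)]
  have h0 := h (stdOrthonormalBasis ℝ V) (T.J z)
  have h1 : ∑ i, (a ![stdOrthonormalBasis ℝ V i, stdOrthonormalBasis ℝ V i, T.J z] : ℂ) = 0 := by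
    exact_mod_cast h0
  simp only [ha, J_J, K_J, map_neg, Finset.sum_sub_distrib, Finset.sum_neg_distrib] at h1
  rw [LinearMap.zero_apply]
  linear_combination -h1

end Translation

end Triple

namespace Triple

variable {V : Type*} [NormedAddCommGroup V] [InnerProductSpace ℝ V] {T : Triple V}

theorem norm_I (v : V) : ‖T.I v‖ = ‖v‖ := T.isoI.norm_map v

theorem norm_J (v : V) : ‖T.J v‖ = ‖v‖ := T.rot.isoI.norm_map v

theorem norm_K (v : V) : ‖T.K v‖ = ‖v‖ := T.rot.rot.isoI.norm_map v

variable [FiniteDimensional ℝ V]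

/-! ### The eight-dimensional case -/

/-- The quaternionic span of e has dimension at most four, so its orthogonal complement is nonzero.
-/
theorem exists_norm_eq_one_orthogonal (h : 4 < Module.finrank ℝ V) (e : V) :
    ∃ f : V, ‖f‖ = 1 ∧ inner ℝ e f = 0 ∧ inner ℝ (T.I e) f = 0 ∧ inner ℝ (T.J e) f = 0 ∧
      inner ℝ (T.K e) f = 0 := by
  set S : Submodule ℝ V := Submodule.span ℝ (Set.range ![e, T.I e, T.J e, T.K e]) with hS
  have hlt : Module.finrank ℝ S < Module.finrank ℝ V :=
    lt_of_le_of_lt (finrank_range_le_card ![e, T.I e, T.J e, T.K e]) (by simpa using h)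
  have hne : Sᗮ ≠ ⊥ := by
    rw [Ne, Submodule.orthogonal_eq_bot_iff]
    intro hT
    rw [hT, finrank_top] at hlt
    exact lt_irrefl _ hlt
  obtain ⟨f, hf, hf0⟩ := Submodule.exists_mem_ne_zero_of_ne_bot hne
  have hf' : (‖f‖⁻¹ : ℝ) • f ∈ Sᗮ := Submodule.smul_mem _ _ hf
  have hmem : ∀ i, ![e, T.I e, T.J e, T.K e] i ∈ S := fun i => Submodule.subset_span ⟨i, rfl⟩
  refine ⟨(‖f‖⁻¹ : ℝ) • f, norm_smul_inv_norm hf0, ?_, ?_, ?_, ?_⟩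
  · exact hf' _ (hmem 0)
  · exact hf' _ (hmem 1)
  · exact hf' _ (hmem 2)
  · exact hf' _ (hmem 3)

/-- An eight-dimensional space has an adapted orthonormal basis. -/
theorem exists_adapted_orthonormalBasis (h8 : Module.finrank ℝ V = 8) :
    ∃ (e f : V) (b : OrthonormalBasis (Fin 8) ℝ V),
      ⇑b = ![e, T.I e, T.J e, T.K e, f, T.I f, T.J f, T.K f] := by
  -- Applied to the zero vector, where orthogonality is vacuous, the lemma supplies the first unit
  -- vector.
  obtain ⟨e, he, -⟩ := exists_norm_eq_one_orthogonal (T := T) (by omega : 4 < Module.finrank ℝ V) 0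
  obtain ⟨f, hf, h0, h1, h2, h3⟩ :=
    exists_norm_eq_one_orthogonal (T := T) (by omega : 4 < Module.finrank ℝ V) e
  rw [inner_I_left, neg_eq_zero] at h1
  rw [inner_J_left, neg_eq_zero] at h2
  rw [inner_K_left, neg_eq_zero] at h3
  have k0 : inner ℝ f e = (0 : ℝ) := by rw [real_inner_comm, h0]
  have k1 : inner ℝ f (T.I e) = (0 : ℝ) := by rw [real_inner_comm, inner_I_left, h1, neg_zero]
  have k2 : inner ℝ f (T.J e) = (0 : ℝ) := by rw [real_inner_comm, inner_J_left, h2, neg_zero]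
  have k3 : inner ℝ f (T.K e) = (0 : ℝ) := by rw [real_inner_comm, inner_K_left, h3, neg_zero]
  have ho : Orthonormal ℝ ![e, T.I e, T.J e, T.K e, f, T.I f, T.J f, T.K f] := by
    rw [orthonormal_iff_ite]
    intro i j
    fin_cases i <;> fin_cases j <;>
      simp [inner_I_left, inner_J_left, inner_K_left, inner_I_self, inner_J_self, inner_K_self,
        norm_I, norm_J, norm_K, he, hf, h0, h1, h2, h3, k0, k1, k2, k3]
  refine ⟨e, f, (basisOfOrthonormalOfCardEqFinrank ho (by simp [h8])).toOrthonormalBasis ?_, ?_⟩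
  · rwa [coe_basisOfOrthonormalOfCardEqFinrank]
  · rw [Module.Basis.coe_toOrthonormalBasis, coe_basisOfOrthonormalOfCardEqFinrank]

/-- In dimension eight there are no trace-free complex three-forms. -/
theorem eq_zero_of_alternating (h8 : Module.finrank ℝ V = 8) {t : Tri V}
    (hI : ∀ x y z, t (T.I x) y z = Complex.I * t x y z) (hs : ∀ x y z, t x y z = -t x z y)
    (hc : ∀ x y z, t x y z = t y z x)
    (ht : ∀ (b : OrthonormalBasis (Fin 8) ℝ V) (z : V), ∑ i, t (b i) (T.J (b i)) z = 0) :
    t = 0 := by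
  obtain ⟨e, f, b, hb⟩ := exists_adapted_orthonormalBasis (T := T) h8
  have hI₂ : ∀ x y z, t x (T.I y) z = Complex.I * t x y z := fun x y z => by
    rw [hc, hI, ← hc]
  -- The vectors e, Je, f, Jf form a complex basis of (V, I).
  have ext : ∀ g : V →ₗ[ℝ] ℂ, (∀ x, g (T.I x) = Complex.I * g x) → g e = 0 → g (T.J e) = 0 →
      g f = 0 → g (T.J f) = 0 → g = 0 := by
    intro g hg h1 h2 h3 h4
    refine b.toBasis.ext fun i => ?_
    rw [OrthonormalBasis.coe_toBasis, hb]
    fin_cases i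
    · exact h1
    · exact (hg e).trans (by rw [h1, mul_zero]; rfl)
    · exact h2
    · exact (congrArg g (T.I_J e).symm).trans ((hg _).trans (by rw [h2, mul_zero]; rfl))
    · exact h3
    · exact (hg f).trans (by rw [h3, mul_zero]; rfl)
    · exact h4
    · exact (congrArg g (T.I_J f).symm).trans ((hg _).trans (by rw [h4, mul_zero]; rfl))
  have z₂₃ : ∀ x y, t x y y = 0 := fun x y => by linear_combination (1 / 2) * hs x y y
  have z₁₂ : ∀ x y, t x x y = 0 := fun x y => by rw [← hc, z₂₃]
  have z₁₃ : ∀ x y, t x y x = 0 := fun x y => by rw [hc, z₂₃]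
  -- The vectors e, Ie, Je, Ke contribute equal terms to the trace, and likewise those of f. An
  -- alternating three-form on a four-dimensional complex space evaluates on triples of basis
  -- vectors, each of which contains e, Je or f, Jf, so this identity kills all of them.
  have sum : ∀ z, t e (T.J e) z + t f (T.J f) z = 0 := by
    intro z
    have := ht b z
    have s₁₂ : ∀ x y, t x y z = -t y x z := fun x y => by rw [hs x y z, hc y x z]
    simp only [hb, Fin.sum_univ_eight, Matrix.cons_val] at this
    simp only [J_I, J_J, ← I_J, map_neg, LinearMap.neg_apply, hI, hI₂] at this
    rw [s₁₂ (T.J e) e, s₁₂ (T.J f) f] at this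
    linear_combination (1 / 4) * this +
      (1 / 2) * (t e (T.J e) z + t f (T.J f) z) * Complex.I_mul_I
  have I₃ : ∀ x y z, t x y (T.I z) = Complex.I * t x y z := fun x y z => by
    rw [← hc, hI, hc]
  have a1 : t e (T.J e) f = 0 := by linear_combination sum f - z₁₃ f (T.J f)
  have a2 : t e (T.J e) (T.J f) = 0 := by linear_combination sum (T.J f) - z₂₃ f (T.J f)
  have a3 : t f (T.J f) e = 0 := by linear_combination sum e - z₁₃ e (T.J e)
  have a4 : t f (T.J f) (T.J e) = 0 := by linear_combination sum (T.J e) - z₂₃ e (T.J e)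
  have b1 : t e (T.J e) = 0 := ext _ (I₃ _ _) (z₁₃ _ _) (z₂₃ _ _) a1 a2
  have b2 : t f (T.J f) = 0 := ext _ (I₃ _ _) a3 a4 (z₁₃ _ _) (z₂₃ _ _)
  have c1 : ∀ z, t e (T.J e) z = 0 := fun z => by rw [b1]; rfl
  have c2 : ∀ z, t f (T.J f) z = 0 := fun z => by rw [b2]; rfl
  have b3 : t e f = 0 := ext _ (I₃ _ _) (z₁₃ _ _) (by rw [hs, c1, neg_zero]) (z₂₃ _ _)
    (by rw [hc, c2])
  have b4 : t e (T.J f) = 0 := ext _ (I₃ _ _) (z₁₃ _ _) (by rw [hs, c1, neg_zero])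
    (by rw [hs, hc, c2, neg_zero]) (z₂₃ _ _)
  have b5 : t (T.J e) f = 0 := ext _ (I₃ _ _) (by rw [← hc, c1]) (z₁₃ _ _) (z₂₃ _ _)
    (by rw [hc, c2])
  have b6 : t (T.J e) (T.J f) = 0 := ext _ (I₃ _ _) (by rw [← hc, c1]) (z₁₃ _ _)
    (by rw [hs, hc, c2, neg_zero]) (z₂₃ _ _)
  have d3 : ∀ z, t e f z = 0 := fun z => by rw [b3]; rfl
  have d4 : ∀ z, t e (T.J f) z = 0 := fun z => by rw [b4]; rfl
  have d5 : ∀ z, t (T.J e) f z = 0 := fun z => by rw [b5]; rfl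
  have d6 : ∀ z, t (T.J e) (T.J f) z = 0 := fun z => by rw [b6]; rfl
  ext x y z
  have e1 : ∀ z, (t.flip y).flip z = 0 := by
    intro z
    have k : ∀ s, (∀ z, t s e z = 0) → (∀ z, t s (T.J e) z = 0) → (∀ z, t s f z = 0) →
        (∀ z, t s (T.J f) z = 0) → t s y z = 0 := by
      intro s h1 h2 h3 h4
      have := ext ((t s).flip z) (fun x => hI₂ s x z) (h1 z) (h2 z) (h3 z) (h4 z)
      exact congrArg (fun g => g y) this
    have s₁₂ : ∀ x y z, t x y z = -t y x z := fun x y z => by rw [hs x y z, hc y x z]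
    refine ext _ (fun x => hI x y z) ?_ ?_ ?_ ?_
    · exact k e (z₁₂ e) c1 d3 d4
    · exact k _ (fun z => by rw [s₁₂, c1, neg_zero]) (z₁₂ _) d5 d6
    · exact k _ (fun z => by rw [s₁₂, d3, neg_zero]) (fun z => by rw [s₁₂, d5, neg_zero]) (z₁₂ _) c2
    · exact k _ (fun z => by rw [s₁₂, d4, neg_zero]) (fun z => by rw [s₁₂, d6, neg_zero])
        (fun z => by rw [s₁₂, c2, neg_zero]) (z₁₂ _)
  exact congrArg (fun g => g x) (e1 z)

/-- The complex-linear part and the antilinear part composed with J both have alternating trace-free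
complex forms, which vanish; `ofSkew` then recovers zero from them. -/
theorem typeSpace_lambda_eq_bot (h8 : Module.finrank ℝ V = 8) : T.typeSpace .Λ₃ = ⊥ := by
  have key : ∀ τ ∈ T.typeSpace .Λ₃, τ ∘ₗ T.I = Complex.I • τ → τ = 0 := by
    intro τ hτ hcx
    obtain ⟨h, h1, h2, h3⟩ := hτ
    have hs : T.symOp τ = (-4 : ℂ) • τ := by
      rw [neg_smul]
      exact eq_neg_of_add_eq_zero_left h3
    have h0 : T.phi τ = 0 := by
      have hI : ∀ x y z, T.phi τ (T.I x) y z = Complex.I * T.phi τ x y z := fun x y z => by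
        have := fun z => congrArg (fun τ : Tri V => τ x y z) hcx
        simp only [LinearMap.comp_apply, LinearMap.smul_apply, smul_eq_mul] at this
        simp only [phi_apply, this]
        ring
      refine eq_zero_of_alternating h8 hI (phi_skew h) ?_ fun b z => sum_phi₁₂ b h h1 z
      intro x y z
      have h1 := phi_symOp h hcx x y z
      have h2 := phi_symOp h hcx y z x
      rw [hs, map_smul] at h1 h2
      simp only [LinearMap.smul_apply, smul_eq_mul] at h1 h2
      linear_combination (-1 / 6) * h1 + (1 / 6) * h2
    have := ofSkew_phi h
    rw [h0, map_zero, map_zero] at this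
    exact (smul_eq_zero.1 this.symm).resolve_left (by norm_num)
  rw [eq_bot_iff]
  intro τ hτ
  have R := realizes_modLambda (T := T)
  have e0 := key _ (R.part₀_mem hτ) (T.part₀_comp_I τ)
  have e1 := key _ (R.part₁_mem hτ) (T.part₁_comp_I τ)
  rw [Submodule.mem_bot]
  ext x y z
  rw [T.part_add τ, e0, e1]
  simp

end Triple

namespace Triple

variable {V : Type*} [NormedAddCommGroup V] [InnerProductSpace ℝ V] {T : Triple V}
  [FiniteDimensional ℝ V]

/-! ### Linear relations between the components -/

/-- The relations between the types and traces of two trilinear maps imposed by the membership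
in the sum of the Gray–Hervella modules with labels in `C`. -/
structure HermitianRel (T : Triple V) (X Y : Tri V) (C : Set GHType) : Prop where
  lam_eq : .W₁ ∉ C → T.proj .Λ₃ Y = T.proj .Λ₃ X
  k_eq : .W₂ ∉ C → T.proj .K Y = T.proj .K X
  lam_neg : .W₃ ∉ C → T.proj .Λ₃ Y = -T.proj .Λ₃ X
  k_neg : .W₃ ∉ C → T.proj .K Y = -T.proj .K X
  tr_one : .W₁ ∉ C → tr₂₃ Y - tr₂₃ X = (4 : ℂ) • (tr₁₂ Y - tr₁₂ X)
  tr_two : .W₂ ∉ C → tr₂₃ Y - tr₂₃ X = (-2 : ℂ) • (tr₁₂ Y - tr₁₂ X)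
  tr_three : .W₃ ∉ C →
    ((Module.finrank ℝ V : ℂ) - 2) • (tr₂₃ Y + tr₂₃ X) = (8 : ℂ) • (tr₁₂ Y + tr₁₂ X)
  tr_four : .W₄ ∉ C → tr₁₂ Y = -tr₁₂ X

/-- Let u = γ + β(I·) and v = γ - β(I·). Then u(K·) is the difference and v(K·) the sum of γ(K·) and
β(J·). A missing 𝒲₁ or 𝒲₂ makes u an eigenvector of S; a missing 𝒲₃ leaves v only a part of type E
and a pure trace, and a missing 𝒲₄ makes `tr₁₂` of v vanish. -/
theorem hermitianRel_of_mem_ghClass (h4 : 4 < Module.finrank ℝ V) {β γ : Tri V}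
    (hβ : β ∈ T.hSym) (hγ : γ ∈ T.hSym) {a : RForm V 3}
    (ha : ∀ x y z, (a ![x, y, z] : ℂ) = γ x y (T.J z) - β x y (T.K z))
    {C : Set GHType} (haC : a ∈ ghClass T.I C) :
    T.HermitianRel (β ∘ₗ T.J) (γ ∘ₗ T.K) C := by
  have hu : γ + β ∘ₗ T.I ∈ T.hSym := add_mem hγ (hSym.comp hβ _)
  have hv : γ - β ∘ₗ T.I ∈ T.hSym := sub_mem hγ (hSym.comp hβ _)
  have eu : (γ + β ∘ₗ T.I) ∘ₗ T.K = γ ∘ₗ T.K - β ∘ₗ T.J := by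
    ext x y z
    simp only [LinearMap.comp_apply, LinearMap.add_apply, LinearMap.sub_apply, I_K, map_neg,
      LinearMap.neg_apply]
    ring
  have ev : (γ - β ∘ₗ T.I) ∘ₗ T.K = γ ∘ₗ T.K + β ∘ₗ T.J := by
    ext x y z
    simp only [LinearMap.comp_apply, LinearMap.add_apply, LinearMap.sub_apply, I_K, map_neg,
      LinearMap.neg_apply]
    ring
  have pu : ∀ w, T.proj w (γ + β ∘ₗ T.I) = 0 →
      T.proj w (γ ∘ₗ T.K) = T.proj w (β ∘ₗ T.J) := by
    intro w h
    rw [← sub_eq_zero, ← map_sub, ← eu, proj_comp_K hu, h, LinearMap.zero_comp]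
  have pv : ∀ w, T.proj w (γ - β ∘ₗ T.I) = 0 →
      T.proj w (γ ∘ₗ T.K) = -T.proj w (β ∘ₗ T.J) := by
    intro w h
    rw [eq_neg_iff_add_eq_zero, ← map_add, ← ev, proj_comp_K hv, h, LinearMap.zero_comp]
  have one : .W₁ ∉ C → _ := fun hc => of_symOp_eq_two h4 hu
    (symOp_eq_of_ghEquation_one hβ hγ ha (ghClass_le_ghSolutions hc haC))
  have two : .W₂ ∉ C → _ := fun hc => of_symOp_eq_neg_four h4 hu
    (symOp_eq_of_ghEquation_two hβ hγ ha (ghClass_le_ghSolutions hc haC))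
  have three : .W₃ ∉ C → _ := fun hc => of_eq_symOp_outer h4
    (eq_symOp_of_ghEquation_three hβ hγ ha (ghClass_le_ghSolutions hc haC)).choose_spec
  have four : .W₄ ∉ C → _ := fun hc =>
    tr₁₂_eq_zero_of_ghEquation_four hβ ha (ghClass_le_ghSolutions hc haC)
  refine ⟨fun hc => pu _ (one hc).1, fun hc => pu _ (two hc).1, fun hc => pv _ (three hc).1,
    fun hc => pv _ (three hc).2.1, fun hc => ?_, fun hc => ?_, fun hc => ?_, fun hc => ?_⟩
  · rw [← map_sub, ← map_sub, ← eu, tr₂₃_comp, tr₁₂_comp_K hu, (one hc).2, LinearMap.smul_comp]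
  · rw [← map_sub, ← map_sub, ← eu, tr₂₃_comp, tr₁₂_comp_K hu, (two hc).2, LinearMap.smul_comp]
  · rw [← map_add, ← map_add, ← ev, tr₂₃_comp, tr₁₂_comp_K hv, ← LinearMap.smul_comp,
      (three hc).2.2, LinearMap.smul_comp]
  · rw [eq_neg_iff_add_eq_zero, ← map_add, ← ev, tr₁₂_comp_K hv, four hc, LinearMap.zero_comp]

theorem HermitianRel.of_rot {X Y : Tri V} {C : Set GHType} (h : T.rot.HermitianRel X Y C) :
    T.HermitianRel X Y C := by
  obtain ⟨h1, h2, h3, h4, h5, h6, h7, h8⟩ := h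
  rw [rot_proj] at h1 h2 h3 h4
  exact ⟨h1, h2, h3, h4, h5, h6, h7, h8⟩

/-- The relations under which the components of type `w` lie in the sum of the quaternionic
modules with labels in `C`. -/
def TypeCond (T : Triple V) (X Y Z : Tri V) (C : Set (EType × HType)) (w : EType) : Prop :=
  ((w, HType.H) ∉ C → T.proj w X + T.proj w Y + T.proj w Z = 0) ∧
    ((w, HType.S₃) ∉ C → T.proj w X = T.proj w Y ∧ T.proj w Y = T.proj w Z)

section TypeCond

variable {X Y Z : Tri V} {C : Set (EType × HType)} {w : EType}

theorem TypeCond.of_mem (h₁ : (w, HType.H) ∈ C) (h₂ : (w, HType.S₃) ∈ C) :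
    T.TypeCond X Y Z C w :=
  ⟨fun h => absurd h₁ h, fun h => absurd h₂ h⟩

theorem TypeCond.of_eq (h : (w, HType.H) ∈ C) (h₁ : T.proj w X = T.proj w Y)
    (h₂ : T.proj w Y = T.proj w Z) : T.TypeCond X Y Z C w :=
  ⟨fun h' => absurd h h', fun _ => ⟨h₁, h₂⟩⟩

theorem TypeCond.of_sum (h : (w, HType.S₃) ∈ C)
    (h₁ : T.proj w X + T.proj w Y + T.proj w Z = 0) : T.TypeCond X Y Z C w :=
  ⟨fun _ => h₁, fun h' => absurd h h'⟩

theorem TypeCond.of_zero (h₁ : T.proj w X = 0) (h₂ : T.proj w Y = 0) (h₃ : T.proj w Z = 0) :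
    T.TypeCond X Y Z C w :=
  ⟨fun _ => by rw [h₁, h₂, h₃, add_zero, add_zero], fun _ => ⟨h₁.trans h₂.symm, h₂.trans h₃.symm⟩⟩

theorem TypeCond.of_eq_neg (h : T.proj w Z = T.proj w Y) (h' : T.proj w Z = -T.proj w Y)
    (h'' : T.proj w X = T.proj w Z ∨ T.proj w X = -T.proj w Z) : T.TypeCond X Y Z C w := by
  have hY : T.proj w Y = 0 := by
    linear_combination (norm := module) (1 / 2 : ℂ) • h.symm.trans h'
  have hZ : T.proj w Z = 0 := h.trans hY
  refine .of_zero ?_ hY hZ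
  rcases h'' with h'' | h''
  · rw [h'', hZ]
  · rw [h'', hZ, neg_zero]

theorem proj_E_eq (h₁ : tr₁₂ X = tr₁₂ Y) (h₂ : tr₂₃ X = tr₂₃ Y) : T.proj .E X = T.proj .E Y := by
  change T.ofForm (leeForm X) = T.ofForm (leeForm Y)
  rw [leeForm_apply, leeForm_apply, h₁, h₂]

theorem proj_E_eq_zero (h₁ : tr₁₂ X = 0) (h₂ : tr₂₃ X = 0) : T.proj .E X = 0 := by
  rw [← map_zero (T.proj .E)]
  exact proj_E_eq (by rw [h₁, map_zero]) (by rw [h₂, map_zero])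

theorem TypeCond.of_dim_eight (h8 : Module.finrank ℝ V = 8) (hX : X ∈ T.hSym) (hY : Y ∈ T.hSym)
    (hZ : Z ∈ T.hSym) : T.TypeCond X Y Z C .Λ₃ := by
  have : ∀ X ∈ T.hSym, T.proj .Λ₃ X = 0 := fun X hX => by
    have := proj_mem (by omega) hX .Λ₃
    rwa [typeSpace_lambda_eq_bot h8, Submodule.mem_bot] at this
  exact .of_zero (this X hX) (this Y hY) (this Z hZ)

/-- The case of traces where only the `ES³H`-part remains in dimension eight. -/
theorem TypeCond.of_trace_dim_eight (h8 : Module.finrank ℝ V = 8)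
    (hm : (EType.E, HType.S₃) ∈ C) (h₁ : tr₁₂ Z = -tr₁₂ Y) (h₂ : tr₁₂ X = -tr₁₂ Z)
    (h₃ : tr₂₃ Z - tr₂₃ Y = (-2 : ℂ) • (tr₁₂ Z - tr₁₂ Y))
    (h₄ : tr₂₃ Y - tr₂₃ X = (4 : ℂ) • (tr₁₂ Y - tr₁₂ X))
    (h₅ : ((Module.finrank ℝ V : ℂ) - 2) • (tr₂₃ Y + tr₂₃ X) = (8 : ℂ) • (tr₁₂ Y + tr₁₂ X)) :
    T.TypeCond X Y Z C .E := by
  refine .of_sum hm ?_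
  rw [h8] at h₅
  push_cast at h₅
  have e : leeForm X + leeForm Y + leeForm Z = 0 := by
    -- In real dimension d, with p = `tr₁₂ Y`, the hypotheses make the corresponding expression p(1
    -- - (4 + 24/(d - 2))/d), whose coefficient vanishes exactly when d² - 6d - 16 = 0; the positive
    -- root is d = 8.
    have : tr₁₂ X + tr₁₂ Y + tr₁₂ Z - (8 : ℂ)⁻¹ • (tr₂₃ X + tr₂₃ Y + tr₂₃ Z) = 0 := by
      linear_combination (norm := module) (1 / 4 : ℂ) • h₁ + h₂ + (-1 / 8 : ℂ) • h₃ +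
        (-1 / 16 : ℂ) • h₄ + (-1 / 32 : ℂ) • h₅
    simp only [leeForm_apply, h8]
    push_cast
    rw [← smul_add, ← smul_add]
    refine smul_eq_zero_of_right _ ?_
    rw [← this]
    module
  change T.ofForm (leeForm X) + T.ofForm (leeForm Y) + T.ofForm (leeForm Z) = 0
  rw [← map_add, ← map_add, e, map_zero]

end TypeCond

theorem fiveMap_xi_mem_quatClass_of_typeCond (h4 : 4 < Module.finrank ℝ V) {α β γ : Tri V}
    (hα : α ∈ T.hSym) (hβ : β ∈ T.hSym) (hγ : γ ∈ T.hSym) {C : Set (EType × HType)}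
    (h : ∀ w, T.TypeCond (α ∘ₗ T.I) (β ∘ₗ T.J) (γ ∘ₗ T.K) C w) :
    T.fiveMap (toCForm (T.xi α β γ)) ∈ T.quatClass C :=
  fiveMap_xi_mem_quatClass h4 hα hβ hγ (fun w => (h w).1) fun w => (h w).2

end Triple

/-! ### From Kähler derivatives to the maps α, β, γ. -/

/-- A real tensor of degree three as a complex-valued trilinear map. -/
def ofRForm {V : Type*} [AddCommGroup V] [Module ℝ V] (a : RForm V 3) : Tri V :=
  ofCForm (Complex.ofRealCLM.toLinearMap.compMultilinearMap a)

theorem ofRForm_apply {V : Type*} [AddCommGroup V] [Module ℝ V] (a : RForm V 3) (x y z : V) :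
    ofRForm a x y z = (a ![x, y, z] : ℂ) := rfl

namespace Triple

variable {V : Type*} [NormedAddCommGroup V] [InnerProductSpace ℝ V] {T : Triple V}

/-! ### The symmetric forms of an adapted triple of Kähler derivatives -/

theorem ghClass_le_ghSpace {A : Module.End ℝ V} {C : Set GHType} : ghClass A C ≤ ghSpace A := by
  refine iSup₂_le fun c _ => ?_
  cases c <;> exact inf_le_left

theorem ofRForm_skew {A : Module.End ℝ V} {a : RForm V 3} (h : a ∈ ghSpace A) (x y z : V) :
    ofRForm a x y z = -ofRForm a x z y := by
  rw [ofRForm_apply, h.1, Complex.ofReal_neg, ofRForm_apply]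

theorem ofRForm_move {a : RForm V 3} (h : a ∈ ghSpace T.I) (x y z : V) :
    ofRForm a x (T.I y) z = ofRForm a x y (T.I z) := by
  rw [ofRForm_apply, ghSpace_move h, ofRForm_apply]

variable (T) in
/-- The symmetric form attached to a tensor with the symmetries of a Kähler derivative. -/
def symPart (a : RForm V 3) : Tri V :=
  mkTri (fun x y z => (-1 / 2) * (ofRForm a x y (T.J z) + ofRForm a x z (T.J y)))
    (by intros; simp only [map_add, LinearMap.add_apply]; ring)
    (by intros; simp only [map_smul, LinearMap.smul_apply, Complex.real_smul]; ring)
    (by intros; simp only [map_add, LinearMap.add_apply]; ring)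
    (by intros; simp only [map_smul, LinearMap.smul_apply, Complex.real_smul]; ring)
    (by intros; simp only [map_add, LinearMap.add_apply]; ring)
    (by intros; simp only [map_smul, LinearMap.smul_apply, Complex.real_smul]; ring)

theorem symPart_apply (a : RForm V 3) (x y z : V) : T.symPart a x y z =
    (-1 / 2) * (ofRForm a x y (T.J z) + ofRForm a x z (T.J y)) := rfl

theorem symPart_mem {a : RForm V 3} (h : a ∈ ghSpace T.I) : T.symPart a ∈ T.hSym := by
  refine ⟨fun x y z => ?_, fun x y z => ?_, fun x y z => ?_⟩
  · rw [symPart_apply, symPart_apply]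
    ring
  · simp only [symPart_apply, J_I, ofRForm_move h, map_neg, I_K]
    ring
  · simp only [symPart_apply, J_J, map_neg]
    rw [ofRForm_skew h x (T.J y), ofRForm_skew h x (T.J z)]
    ring

/-- The tensors with the symmetries of the Kähler derivatives of an adapted triple are given by
three symmetric forms. -/
theorem exists_symmetric_forms {aI aJ aK : RForm V 3} (hI : aI ∈ ghSpace T.I)
    (hJ : aJ ∈ ghSpace T.J) (hK : ∀ x y z, aK ![x, y, z] = -aK ![x, z, y])
    (h : ∀ x y z, aK ![x, y, z] = aI ![x, y, T.J z] - aJ ![x, T.I y, z]) :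
    ∃ α ∈ T.hSym, ∃ β ∈ T.hSym, ∃ γ ∈ T.hSym,
      (∀ x y z, (aI ![x, y, z] : ℂ) = γ x y (T.J z) - β x y (T.K z)) ∧
      (∀ x y z, (aJ ![x, y, z] : ℂ) = α x y (T.K z) - γ x y (T.I z)) ∧
      ∀ x y z, (aK ![x, y, z] : ℂ) = β x y (T.I z) - α x y (T.J z) := by
  have h' : ∀ x y z, ofRForm aK x y z = ofRForm aI x y (T.J z) - ofRForm aJ x (T.I y) z := by
    intro x y z
    rw [ofRForm_apply, h, Complex.ofReal_sub, ofRForm_apply, ofRForm_apply]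
  have sI := ofRForm_skew hI
  have sJ := ofRForm_skew hJ
  have sK : ∀ x y z, ofRForm aK x y z = -ofRForm aK x z y := fun x y z => by
    rw [ofRForm_apply, hK, Complex.ofReal_neg, ofRForm_apply]
  have mI := ofRForm_move hI
  have mJ := ofRForm_move (T := T.rot) hJ
  rw [rot_I] at mJ
  -- Compatibility of the third tensor with K is not assumed; it follows from its skewness and the
  -- Leibniz relation, using that the first two are compatible with I and J.
  have hK' : aK ∈ ghSpace T.K := by
    refine ⟨hK, fun x y z => ?_⟩
    have e : ofRForm aK x (T.K y) (T.K z) = -ofRForm aK x y z := by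
      have k1 := h' x (T.K y) (T.K z)
      have k2 := h' x z y
      have j1 := mJ x y (T.K z)
      have i1 := mI x (T.J y) (T.I z)
      simp only [I_K, J_K, I_J, I_I, map_neg, LinearMap.neg_apply] at k1 j1 i1
      linear_combination k1 + i1 + j1 + sK x y z - k2 - sI x (T.J y) z + sJ x y (T.I z)
    rw [ofRForm_apply, ofRForm_apply] at e
    exact_mod_cast e
  -- The desired formula gives aI(x,y,Jz) = -γ(x;y,z) + β(x;y,Iz), whose second term is skew in y,
  -- z. So γ must be minus the symmetric part, and α, β are the analogues for the rotated bases.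
  refine ⟨_, (T.rot_hSym ▸ symPart_mem (T := T.rot) hJ : T.rot.symPart aJ ∈ T.hSym),
    T.rot.rot.symPart aK, ?_, _, symPart_mem hI, fun x y z => ?_, fun x y z => ?_, fun x y z => ?_⟩
  · rw [← T.rot_hSym, ← T.rot.rot_hSym]
    exact symPart_mem (T := T.rot.rot) hK'
  · rw [← ofRForm_apply]
    simp only [symPart_apply, rot_J, rot_K, J_J, I_K, map_neg, h', J_I, LinearMap.neg_apply]
    have i1 := mI x (T.J z) (T.K y)
    simp only [I_J, I_K, map_neg] at i1
    linear_combination (1 / 2) * i1 - (1 / 2) * sJ x (T.I y) (T.J z)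
  · rw [← ofRForm_apply]
    have k1 := sK x (T.I y) z
    have i1 := mI x y (T.J z)
    have i2 := mI x z (T.J y)
    have j1 := mJ x (T.I z) (T.K y)
    simp only [h', J_I, I_I, I_J, J_K, map_neg, LinearMap.neg_apply] at k1 i1 j1 i2
    simp only [symPart_apply, rot_J, K_K, J_I, map_neg]
    linear_combination (1 / 2) * (k1 - i1 - j1 - i2)
  · have k1 := sK x y z
    have i1 := mI x z (T.K y)
    have j1 := mJ x z (T.K y)
    rw [← ofRForm_apply]
    simp only [h', I_K, J_K, map_neg] at k1 i1 j1
    simp only [symPart_apply, rot_J, rot_K, h', I_I, J_I, K_J, map_neg, LinearMap.neg_apply]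
    linear_combination (1 / 2) * (k1 - i1 - j1 + sJ x y (T.I z))

end Triple

/-! ### The map to five-tensors as twice the sum of ∇ω_A ∧ ω_A. -/

namespace Triple

variable {V : Type*} [NormedAddCommGroup V] [InnerProductSpace ℝ V] {T : Triple V}

/-- The derivative of the fundamental form, expressed through the Kähler derivatives. -/
theorem fiveMap_xi_apply {α β γ : Tri V} (hα : α ∈ T.hSym) (hβ : β ∈ T.hSym) (hγ : γ ∈ T.hSym)
    {aI aJ aK : V → V → V → ℝ}
    (eI : ∀ x y z, (aI x y z : ℂ) = γ x y (T.J z) - β x y (T.K z))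
    (eJ : ∀ x y z, (aJ x y z : ℂ) = α x y (T.K z) - γ x y (T.I z))
    (eK : ∀ x y z, (aK x y z : ℂ) = β x y (T.I z) - α x y (T.J z)) (v : Fin 5 → V) :
    T.fiveMap (toCForm (T.xi α β γ)) v =
      ((2 * (wedge (fun w => aI (v 0) (w 0) (w 1)) (kaehlerForm T.I) (Fin.tail v)
        + wedge (fun w => aJ (v 0) (w 0) (w 1)) (kaehlerForm T.J) (Fin.tail v)
        + wedge (fun w => aK (v 0) (w 0) (w 1)) (kaehlerForm T.K) (Fin.tail v)) : ℝ) : ℂ) := by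
  rw [fiveMap_apply, fourMap_apply]
  have key : ∀ p q r s : V, T.pairing ((toCForm (T.xi α β γ)).curryLeft (v 0)) p q r s =
      2 * (aI (v 0) p q * (inner ℝ r (T.I s) : ℝ) + aJ (v 0) p q * (inner ℝ r (T.J s) : ℝ)
        + aK (v 0) p q * (inner ℝ r (T.K s) : ℝ)) := by
    intro p q r s
    have e : ∀ x y : V, (toCForm (T.xi α β γ)).curryLeft (v 0) ![x, y] =
        α (v 0) x (T.I y) + β (v 0) x (T.J y) + γ (v 0) x (T.K y) := fun _ _ => rfl
    simp only [pairing, e, eI, eJ, eK, I_I, I_J, I_K, J_I, J_J, J_K, K_I, K_J, K_K, map_neg]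
    rw [hSym.symm hα _ q p, hSym.symm hβ _ q p, hSym.symm hγ _ q p]
    simp only [hSym.I_swap hβ _ p q, hSym.I_swap hγ _ p q,
      hSym.J_swap hα _ p q, hSym.J_swap hγ _ p q,
      hSym.K_swap hα _ p q, hSym.K_swap hβ _ p q]
    ring
  simp only [key, wedge, kaehlerForm, Matrix.cons_val_zero, Matrix.cons_val_one]
  push_cast
  ring

end Triple

section Manifold

variable {n : ℕ} {M : Type*} [TopologicalSpace M]
  [ChartedSpace (EuclideanSpace ℝ (Fin (4 * n))) M] [IsManifold (𝓡 (4 * n)) ∞ M]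
  [RiemannianBundle (fun x : M => TangentSpace (𝓡 (4 * n)) x)]
  {cov : CovariantDerivative (𝓡 (4 * n)) (EuclideanSpace ℝ (Fin (4 * n)))
      (fun x : M => TangentSpace (𝓡 (4 * n)) x)}

/-! ### Covariant derivatives of Kähler forms -/

/-- The extension of a tangent vector to a vector field. -/
abbrev extendField {x : M} (v : TangentSpace (𝓡 (4 * n)) x) (y : M) :
    TangentSpace (𝓡 (4 * n)) y :=
  FiberBundle.extend (EuclideanSpace ℝ (Fin (4 * n))) v y

/-- Differentiability of a vector field at a point. -/
def DiffField (Z : ∀ y : M, TangentSpace (𝓡 (4 * n)) y) (x : M) : Prop :=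
  MDifferentiableAt (𝓡 (4 * n)) ((𝓡 (4 * n)).prod 𝓘(ℝ, EuclideanSpace ℝ (Fin (4 * n))))
    (fun y => Bundle.TotalSpace.mk' (EuclideanSpace ℝ (Fin (4 * n)))
      (E := fun y : M => TangentSpace (𝓡 (4 * n)) y) y (Z y)) x

theorem diffField_extend {x : M} (v : TangentSpace (𝓡 (4 * n)) x) :
    DiffField (extendField v) x :=
  FiberBundle.mdifferentiableAt_extend ..

theorem EndField.SmoothOn.diffField {A : EndField n M} {U : Set M} (hA : A.SmoothOn U)
    (hU : IsOpen U) {x : M} (hx : x ∈ U) {Z : ∀ y : M, TangentSpace (𝓡 (4 * n)) y}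
    (hZ : DiffField Z x) : DiffField (fun y => A y (Z y)) x :=
  MDifferentiableAt.clm_bundle_apply
    ((hA.contMDiffAt (hU.mem_nhds hx)).mdifferentiableAt (by simp)) hZ

theorem mvfderiv_congr {f g : M → ℝ} {x : M} (h : f =ᶠ[𝓝 x] g)
    (v : TangentSpace (𝓡 (4 * n)) x) :
    mvfderiv (𝓡 (4 * n)) f x v = mvfderiv (𝓡 (4 * n)) g x v :=
  congrArg (fun L : TangentSpace (𝓡 (4 * n)) x →L[ℝ] ℝ => L v)
    (h.mfderiv_eq (I := 𝓡 (4 * n)) (I' := 𝓘(ℝ, ℝ)))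

theorem covDeriv_kaehlerForm (A : EndField n M) (x : M) (X Y Z : TangentSpace (𝓡 (4 * n)) x) :
    covDeriv cov (fun y => kaehlerForm (A y).toLinearMap) x ![X, Y, Z] =
      mvfderiv (𝓡 (4 * n)) (fun y => inner ℝ (extendField Y y) (A y (extendField Z y))) x X
        - inner ℝ (cov (extendField Y) x X) (A x Z) - inner ℝ Y (A x (cov (extendField Z) x X)) := by
  rw [covDeriv, Fin.sum_univ_two, sub_sub]
  rfl

variable [IsContMDiffRiemannianBundle (𝓡 (4 * n)) ∞ (EuclideanSpace ℝ (Fin (4 * n)))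
    (fun x : M => TangentSpace (𝓡 (4 * n)) x)]

theorem DiffField.inner {x : M} {Y Z : ∀ y : M, TangentSpace (𝓡 (4 * n)) y}
    (hY : DiffField Y x) (hZ : DiffField Z x) :
    MDifferentiableAt (𝓡 (4 * n)) 𝓘(ℝ, ℝ) (fun y => inner ℝ (Y y) (Z y)) x :=
  MDifferentiableAt.inner_bundle hY hZ

set_option synthInstance.maxHeartbeats 200000 in
theorem IsLeviCivita.mvfderiv_inner (h : IsLeviCivita cov) {x : M}
    {Y Z : ∀ y : M, TangentSpace (𝓡 (4 * n)) y} (hY : DiffField Y x) (hZ : DiffField Z x)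
    (X : TangentSpace (𝓡 (4 * n)) x) :
    mvfderiv (𝓡 (4 * n)) (fun y => inner ℝ (Y y) (Z y)) x X =
      inner ℝ (cov Y x X) (Z x) + inner ℝ (Y x) (cov Z x X) := by
  have := h.metric.mvfderiv_inner_eq (extendField X) hY hZ
  simpa using this

/-- Metric compatibility cancels the term with the derivative of Y and leaves ⟨Y, (∇_X A)Z⟩. -/
theorem covDeriv_kaehlerForm_eq (h : IsLeviCivita cov) {A : EndField n M} {U : Set M}
    (hA : A.SmoothOn U) (hU : IsOpen U) {x : M} (hx : x ∈ U)
    (X Y Z : TangentSpace (𝓡 (4 * n)) x) :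
    covDeriv cov (fun y => kaehlerForm (A y).toLinearMap) x ![X, Y, Z] =
      inner ℝ Y (cov (fun y => A y (extendField Z y)) x X)
        - inner ℝ Y (A x (cov (extendField Z) x X)) := by
  rw [covDeriv_kaehlerForm, h.mvfderiv_inner (diffField_extend Y)
    (hA.diffField hU hx (diffField_extend Z))]
  simp

/-- The covariant derivative of the Kähler form of a composition. -/
theorem covDeriv_kaehlerForm_comp (h : IsLeviCivita cov) {A B C : EndField n M} {U : Set M}
    (hA : A.SmoothOn U) (hB : B.SmoothOn U) (hU : IsOpen U)
    (hC : ∀ y ∈ U, ∀ w, A y (B y w) = C y w)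
    (hs : ∀ y ∈ U, ∀ u w, inner ℝ (A y u) w = -inner ℝ u (A y w)) {x : M} (hx : x ∈ U)
    (X Y Z : TangentSpace (𝓡 (4 * n)) x) :
    covDeriv cov (fun y => kaehlerForm (C y).toLinearMap) x ![X, Y, Z] =
      -covDeriv cov (fun y => kaehlerForm (A y).toLinearMap) x ![X, B x Z, Y]
        - covDeriv cov (fun y => kaehlerForm (B y).toLinearMap) x ![X, A x Y, Z] := by
  rw [covDeriv_kaehlerForm_eq h hA hU hx, covDeriv_kaehlerForm_eq h hB hU hx,
    covDeriv_kaehlerForm]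
  -- Near x the form is -⟨AY, BZ⟩, and metric compatibility differentiates AY and BZ separately.
  have e : (fun y => inner ℝ (extendField Y y) (C y (extendField Z y))) =ᶠ[𝓝 x]
      -fun y => inner ℝ (A y (extendField Y y)) (B y (extendField Z y)) := by
    filter_upwards [hU.mem_nhds hx] with y hy
    rw [Pi.neg_apply, hs y hy, hC y hy, neg_neg]
  rw [mvfderiv_congr e, mvfderiv_neg, neg_apply, h.mvfderiv_inner
    (hA.diffField hU hx (diffField_extend Y)) (hB.diffField hU hx (diffField_extend Z))]
  simp only [extendField, FiberBundle.extend_apply_self]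
  rw [← hC x hx, ← hC x hx, ← neg_neg (inner ℝ (_ : TangentSpace (𝓡 (4 * n)) x) (A x (B x Z))),
    ← hs x hx, real_inner_comm (B x Z), real_inner_comm (B x Z)]
  simp only [hs x hx Y]
  ring

theorem covDeriv_kaehlerForm_skew {C : EndField n M} {U : Set M} (hU : IsOpen U)
    (hs : ∀ y ∈ U, ∀ u w, inner ℝ (C y u) w = -inner ℝ u (C y w)) {x : M} (hx : x ∈ U)
    (X Y Z : TangentSpace (𝓡 (4 * n)) x) :
    covDeriv cov (fun y => kaehlerForm (C y).toLinearMap) x ![X, Y, Z] =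
      -covDeriv cov (fun y => kaehlerForm (C y).toLinearMap) x ![X, Z, Y] := by
  rw [covDeriv_kaehlerForm, covDeriv_kaehlerForm]
  have e : (fun y => inner ℝ (extendField Y y) (C y (extendField Z y))) =ᶠ[𝓝 x]
      -fun y => inner ℝ (extendField Z y) (C y (extendField Y y)) := by
    filter_upwards [hU.mem_nhds hx] with y hy
    rw [Pi.neg_apply, real_inner_comm, hs y hy]
  have e' : ∀ u w, inner ℝ u (C x w) = -inner ℝ w (C x u) := fun u w => by
    rw [real_inner_comm, hs x hx]
  rw [mvfderiv_congr e, mvfderiv_neg, neg_apply, e' _ Z, e' Y]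
  ring

theorem differentiable_kaehlerForm {A : EndField n M} {U : Set M}
    (hA : A.SmoothOn U) (hU : IsOpen U) {x : M} (hx : x ∈ U)
    (Y Z : TangentSpace (𝓡 (4 * n)) x) :
    MDifferentiableAt (𝓡 (4 * n)) 𝓘(ℝ, ℝ)
      (fun y => inner ℝ (extendField Y y) (A y (extendField Z y))) x :=
  (diffField_extend Y).inner (hA.diffField hU hx (diffField_extend Z))

theorem wedge_self_kaehlerForm (A : EndField n M) (y : M)
    (v : Fin 4 → TangentSpace (𝓡 (4 * n)) y) :
    wedge (kaehlerForm (A y).toLinearMap) (kaehlerForm (A y).toLinearMap) v =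
      2 * (inner ℝ (v 0) (A y (v 1)) * inner ℝ (v 2) (A y (v 3))
        - inner ℝ (v 0) (A y (v 2)) * inner ℝ (v 1) (A y (v 3))
        + inner ℝ (v 0) (A y (v 3)) * inner ℝ (v 1) (A y (v 2))) := by
  simp only [wedge, kaehlerForm, Matrix.cons_val_zero, Matrix.cons_val_one,
    ContinuousLinearMap.coe_coe]
  ring

/-- The derivative of the Pfaffian of a skew matrix of size four. -/
theorem mvfderiv_pfaffian {a b c d e f : M → ℝ} {x : M}
    (ha : MDifferentiableAt (𝓡 (4 * n)) 𝓘(ℝ, ℝ) a x)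
    (hb : MDifferentiableAt (𝓡 (4 * n)) 𝓘(ℝ, ℝ) b x)
    (hc : MDifferentiableAt (𝓡 (4 * n)) 𝓘(ℝ, ℝ) c x)
    (hd : MDifferentiableAt (𝓡 (4 * n)) 𝓘(ℝ, ℝ) d x)
    (he : MDifferentiableAt (𝓡 (4 * n)) 𝓘(ℝ, ℝ) e x)
    (hf : MDifferentiableAt (𝓡 (4 * n)) 𝓘(ℝ, ℝ) f x) :
    MDifferentiableAt (𝓡 (4 * n)) 𝓘(ℝ, ℝ)
      (fun y => 2 * (a y * b y - c y * d y + e y * f y)) x ∧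
    ∀ X, mvfderiv (𝓡 (4 * n)) (fun y => 2 * (a y * b y - c y * d y + e y * f y)) x X =
      2 * (a x * mvfderiv (𝓡 (4 * n)) b x X + b x * mvfderiv (𝓡 (4 * n)) a x X
        - (c x * mvfderiv (𝓡 (4 * n)) d x X + d x * mvfderiv (𝓡 (4 * n)) c x X)
        + (e x * mvfderiv (𝓡 (4 * n)) f x X + f x * mvfderiv (𝓡 (4 * n)) e x X)) := by
  have h2 : MDifferentiableAt (𝓡 (4 * n)) 𝓘(ℝ, ℝ) (fun _ : M => (2 : ℝ)) x :=
    mdifferentiableAt_const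
  have hab := ha.mul hb
  have hcd := hc.mul hd
  have hef := he.mul hf
  have eq : (fun y => 2 * (a y * b y - c y * d y + e y * f y)) =
      (fun _ : M => (2 : ℝ)) * (a * b - c * d + e * f) := rfl
  rw [eq]
  refine ⟨h2.mul ((hab.sub hcd).add hef), fun X => ?_⟩
  rw [mvfderiv_mul h2 ((hab.sub hcd).add hef), mvfderiv_add (hab.sub hcd) hef,
    mvfderiv_sub hab hcd, mvfderiv_mul ha hb, mvfderiv_mul hc hd, mvfderiv_mul he hf,
    mvfderiv_const]
  simp
  ring

/-- ω_A ∧ ω_A is twice a Pfaffian in the six values of ω_A, so the product rule for it, together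
with the connection terms, regroups into 2 ∇ω_A ∧ ω_A. -/
theorem covDeriv_wedge_kaehlerForm {A : EndField n M} {U : Set M}
    (hA : A.SmoothOn U) (hU : IsOpen U) {x : M} (hx : x ∈ U)
    (v : Fin 5 → TangentSpace (𝓡 (4 * n)) x) :
    MDifferentiableAt (𝓡 (4 * n)) 𝓘(ℝ, ℝ) (fun y => wedge (kaehlerForm (A y).toLinearMap)
      (kaehlerForm (A y).toLinearMap) fun i => extendField (v i.succ) y) x ∧
    covDeriv cov (fun y => wedge (kaehlerForm (A y).toLinearMap)
      (kaehlerForm (A y).toLinearMap)) x v =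
      2 * wedge (fun w => covDeriv cov (fun y => kaehlerForm (A y).toLinearMap) x
        ![v 0, w 0, w 1]) (kaehlerForm (A x).toLinearMap) (Fin.tail v) := by
  have hd := fun i j => differentiable_kaehlerForm hA hU hx (v i) (v j)
  obtain ⟨h1, h2⟩ := mvfderiv_pfaffian (hd 1 2) (hd 3 4) (hd 1 3) (hd 2 4) (hd 1 4) (hd 2 3)
  have e : (fun y => wedge (kaehlerForm (A y).toLinearMap)
      (kaehlerForm (A y).toLinearMap) fun i => extendField (v i.succ) y) = _ :=
    funext fun y => wedge_self_kaehlerForm A y _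
  refine ⟨e ▸ h1, ?_⟩
  rw [covDeriv, e]
  refine (congrArg₂ (· - ·) (h2 (v 0)) rfl).trans ?_
  have u : ∀ (w : Fin 4 → TangentSpace (𝓡 (4 * n)) x) (i j : Fin 4) t,
      Function.update w i t j = if j = i then t else w j := fun w i j t => Function.update_apply ..
  simp only [wedge_self_kaehlerForm, Fin.sum_univ_four, u, Fin.reduceEq, if_true, if_false,
    Fin.succ_zero_eq_one, Fin.succ_one_eq_two, Fin.reduceSucc, extendField,
    FiberBundle.extend_apply_self]
  simp only [wedge, kaehlerForm, covDeriv_kaehlerForm, Matrix.cons_val_zero,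
    Matrix.cons_val_one, Fin.tail, Fin.succ_zero_eq_one, Fin.succ_one_eq_two, Fin.reduceSucc,
    extendField, ContinuousLinearMap.coe_coe]
  ring

end Manifold

/-! ### Linear algebra of the relations among X, Y and Z. -/

namespace Triple

variable {V : Type*} [NormedAddCommGroup V] [InnerProductSpace ℝ V] {T : Triple V}
  [FiniteDimensional ℝ V] {X Y Z : Tri V}

theorem TypeCond.of_eq_neg' {C : Set (EType × HType)} {w : EType} (h : T.proj w X = T.proj w Z)
    (h' : T.proj w X = -T.proj w Z) (h'' : T.proj w Z = -T.proj w Y) : T.TypeCond X Y Z C w := by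
  have hZ : T.proj w Z = 0 := by
    linear_combination (norm := module) (1 / 2 : ℂ) • h.symm.trans h'
  exact .of_zero (h.trans hZ) (by rw [← neg_eq_zero, ← h'', hZ]) hZ

/-- Going once around the triangle changes the sign three times, so each part equals its own
negative. -/
theorem TypeCond.of_neg {C : Set (EType × HType)} {w : EType} (h : T.proj w Z = -T.proj w Y)
    (h' : T.proj w X = -T.proj w Z) (h'' : T.proj w Y = -T.proj w X) :
    T.TypeCond X Y Z C w := by
  refine .of_zero ?_ ?_ ?_
  · linear_combination (norm := module) (1 / 2 : ℂ) • (-h + h' + h'')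
  · linear_combination (norm := module) (1 / 2 : ℂ) • (h - h' + h'')
  · linear_combination (norm := module) (1 / 2 : ℂ) • (h + h' - h'')

theorem TypeCond.of_eq_of_neg {C : Set (EType × HType)} {w : EType}
    (h : T.proj w Z = T.proj w Y) (h' : T.proj w X = T.proj w Z)
    (h'' : T.proj w Y = -T.proj w X) : T.TypeCond X Y Z C w := by
  have hX : T.proj w X = 0 := by
    linear_combination (norm := module) (1 / 2 : ℂ) • (h + h' + h'')
  exact .of_zero hX (by rw [h'', hX, neg_zero]) (by rw [← h', hX])

section Trace

variable {C : Set GHType}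

/-- The differences p, q of the traces satisfy q = 4p and q = -2p, so both vanish. -/
theorem HermitianRel.proj_E_eq (h : T.HermitianRel X Y C) (h₁ : .W₁ ∉ C) (h₂ : .W₂ ∉ C) :
    T.proj .E Y = T.proj .E X := by
  have t₁ := h.tr_one h₁
  have t₂ := h.tr_two h₂
  refine Triple.proj_E_eq ?_ ?_
  · linear_combination (norm := module) (-1 / 6 : ℂ) • t₁ + (1 / 6 : ℂ) • t₂
  · linear_combination (norm := module) (1 / 3 : ℂ) • t₁ + (2 / 3 : ℂ) • t₂

theorem HermitianRel.tr₂₃_eq (h : T.HermitianRel X Y C) (hX : tr₁₂ X = 0) (hY : tr₁₂ Y = 0)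
    (hC : .W₁ ∉ C ∨ .W₂ ∉ C) : tr₂₃ Y = tr₂₃ X := by
  rw [← sub_eq_zero]
  rcases hC with hC | hC
  · rw [h.tr_one hC, hX, hY, sub_zero, smul_zero]
  · rw [h.tr_two hC, hX, hY, sub_zero, smul_zero]

theorem HermitianRel.tr₂₃_neg (h : T.HermitianRel X Y C) (h4 : 4 < Module.finrank ℝ V)
    (hX : tr₁₂ X = 0) (hY : tr₁₂ Y = 0) (hC : .W₃ ∉ C) : tr₂₃ Y = -tr₂₃ X := by
  have h3 := h.tr_three hC
  rw [hX, hY, add_zero, smul_zero] at h3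
  rw [eq_neg_iff_add_eq_zero]
  refine (smul_eq_zero.1 h3).resolve_left ?_
  have : Module.finrank ℝ V ≠ 2 := by omega
  exact fun h0 => this (by exact_mod_cast sub_eq_zero.1 h0)

theorem tr₁₂_eq_zero_of_neg (h₁ : tr₁₂ Z = -tr₁₂ Y) (h₂ : tr₁₂ X = -tr₁₂ Z)
    (h₃ : tr₁₂ Y = -tr₁₂ X) : tr₁₂ X = 0 ∧ tr₁₂ Y = 0 ∧ tr₁₂ Z = 0 := by
  refine ⟨?_, ?_, ?_⟩
  · linear_combination (norm := module) (1 / 2 : ℂ) • (-h₁ + h₂ + h₃)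
  · linear_combination (norm := module) (1 / 2 : ℂ) • (h₁ - h₂ + h₃)
  · linear_combination (norm := module) (1 / 2 : ℂ) • (h₁ + h₂ - h₃)

theorem TypeCond.of_traces {C : Set (EType × HType)}
    (hp : tr₁₂ X = 0 ∧ tr₁₂ Y = 0 ∧ tr₁₂ Z = 0) (h : tr₂₃ Z = tr₂₃ Y) (h' : tr₂₃ Z = -tr₂₃ Y)
    (h'' : tr₂₃ X = tr₂₃ Z) : T.TypeCond X Y Z C .E := by
  obtain ⟨hX, hY, hZ⟩ := hp
  have qY : tr₂₃ Y = 0 := by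
    linear_combination (norm := module) (1 / 2 : ℂ) • h.symm.trans h'
  exact .of_zero (proj_E_eq_zero hX (h''.trans (h.trans qY))) (proj_E_eq_zero hY qY)
    (proj_E_eq_zero hZ (h.trans qY))

theorem TypeCond.of_traces_eq {C : Set (EType × HType)} (hm : (EType.E, HType.H) ∈ C)
    (hp : tr₁₂ X = 0 ∧ tr₁₂ Y = 0 ∧ tr₁₂ Z = 0) (h : tr₂₃ Z = tr₂₃ Y) (h' : tr₂₃ X = tr₂₃ Z) :
    T.TypeCond X Y Z C .E := by
  obtain ⟨hX, hY, hZ⟩ := hp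
  exact .of_eq hm (Triple.proj_E_eq (hX.trans hY.symm) (h'.trans h))
    (Triple.proj_E_eq (hY.trans hZ.symm) h.symm)

end Trace

/-- The Kähler derivative of `IJ` from those of `I` and `J`. -/
def compForm (T : Triple V) (aI aJ : RForm V 3) : RForm V 3 :=
  aI.compLinearMap ![LinearMap.id, LinearMap.id, T.J] -
    aJ.compLinearMap ![LinearMap.id, T.I, LinearMap.id]

theorem compForm_apply (aI aJ : RForm V 3) (u v w : V) :
    T.compForm aI aJ ![u, v, w] = aI ![u, v, T.J w] - aJ ![u, T.I v, w] := by
  change aI _ - aJ _ = _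
  congr 2 <;> · funext i; fin_cases i <;> rfl

/-- The derivative of the fundamental form is determined by three trilinear maps whose mutual
relations are governed by the Gray–Hervella types. -/
theorem exists_trilinear (h4 : 4 < Module.finrank ℝ V) {aI aJ aK : RForm V 3}
    (sI : aI ∈ ghSpace T.I) (sJ : aJ ∈ ghSpace T.J)
    (hK : ∀ x y z, aK ![x, y, z] = -aK ![x, z, y])
    (h : ∀ x y z, aK ![x, y, z] = aI ![x, y, T.J z] - aJ ![x, T.I y, z]) :
    ∃ X Y Z : Tri V, (X ∈ T.hSym ∧ Y ∈ T.hSym ∧ Z ∈ T.hSym) ∧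
      (∀ C, aI ∈ ghClass T.I C → T.HermitianRel Y Z C) ∧
      (∀ C, aJ ∈ ghClass T.J C → T.HermitianRel Z X C) ∧
      (∀ C, aK ∈ ghClass T.K C → T.HermitianRel X Y C) ∧
      ∀ C, (∀ w, T.TypeCond X Y Z C w) → ∃ t ∈ T.quatClass C, ∀ v, t v =
        ((2 * (wedge (fun w => aI ![v 0, w 0, w 1]) (kaehlerForm T.I) (Fin.tail v)
          + wedge (fun w => aJ ![v 0, w 0, w 1]) (kaehlerForm T.J) (Fin.tail v)
          + wedge (fun w => aK ![v 0, w 0, w 1]) (kaehlerForm T.K)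
            (Fin.tail v)) : ℝ) : ℂ) := by
  obtain ⟨α, hα, β, hβ, γ, hγ, fI, fJ, fK⟩ := exists_symmetric_forms sI sJ hK h
  have r1 : ∀ C, aI ∈ ghClass T.I C → T.HermitianRel (β ∘ₗ T.J) (γ ∘ₗ T.K) C :=
    fun C hC => hermitianRel_of_mem_ghClass h4 hβ hγ fI hC
  have r2 : ∀ C, aJ ∈ ghClass T.J C → T.HermitianRel (γ ∘ₗ T.K) (α ∘ₗ T.I) C := by
    intro C hC
    have hγ' : γ ∈ T.rot.hSym := by rwa [rot_hSym]
    have hα' : α ∈ T.rot.hSym := by rwa [rot_hSym]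
    have := hermitianRel_of_mem_ghClass (T := T.rot) h4 hγ' hα' fJ hC
    exact this.of_rot
  have r3 : ∀ C, aK ∈ ghClass T.K C → T.HermitianRel (α ∘ₗ T.I) (β ∘ₗ T.J) C := by
    intro C hC
    have hα' : α ∈ T.rot.rot.hSym := by rwa [rot_hSym, rot_hSym]
    have hβ' : β ∈ T.rot.rot.hSym := by rwa [rot_hSym, rot_hSym]
    have := hermitianRel_of_mem_ghClass (T := T.rot.rot) h4 hα' hβ' fK hC
    exact this.of_rot.of_rot
  refine ⟨α ∘ₗ T.I, β ∘ₗ T.J, γ ∘ₗ T.K, ⟨hSym.comp hα _, hSym.comp hβ _, hSym.comp hγ _⟩,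
    r1, r2, r3, fun C hC => ⟨_, fiveMap_xi_mem_quatClass_of_typeCond h4 hα hβ hγ hC, ?_⟩⟩
  exact fiveMap_xi_apply (aI := fun x y z => aI ![x, y, z]) (aJ := fun x y z => aJ ![x, y, z])
    (aK := fun x y z => aK ![x, y, z]) hα hβ hγ fI fJ fK

end Triple

/-! ### Pointwise reduction on the manifold. -/

section Manifold

variable {n : ℕ} {M : Type*} [TopologicalSpace M]
  [ChartedSpace (EuclideanSpace ℝ (Fin (4 * n))) M] [IsManifold (𝓡 (4 * n)) ∞ M]
  [RiemannianBundle (fun x : M => TangentSpace (𝓡 (4 * n)) x)]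
  {cov : CovariantDerivative (𝓡 (4 * n)) (EuclideanSpace ℝ (Fin (4 * n)))
      (fun x : M => TangentSpace (𝓡 (4 * n)) x)}

instance (x : M) : FiniteDimensional ℝ (TangentSpace (𝓡 (4 * n)) x) :=
  inferInstanceAs (FiniteDimensional ℝ (EuclideanSpace ℝ (Fin (4 * n))))

theorem finrank_tangentSpace (x : M) :
    Module.finrank ℝ (TangentSpace (𝓡 (4 * n)) x) = 4 * n :=
  finrank_euclideanSpace_fin

variable [IsContMDiffRiemannianBundle (𝓡 (4 * n)) ∞ (EuclideanSpace ℝ (Fin (4 * n)))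
    (fun x : M => TangentSpace (𝓡 (4 * n)) x)]

/-- The fundamental form is defined by a basis chosen separately at each point; on the open set U it
agrees with the formula in the given smooth basis, which can be differentiated. -/
theorem covDeriv_fundamentalForm (Q : AlmostQuaternionHermitian n M) {U : Set M} (hU : IsOpen U)
    (b : AdaptedBasis Q.bundle U) {x : M} (hx : x ∈ U)
    (v : Fin 5 → TangentSpace (𝓡 (4 * n)) x) :
    covDeriv cov Q.fundamentalForm x v =
      2 * (wedge (fun w => covDeriv cov (fun y => kaehlerForm (b.I y).toLinearMap) x
          ![v 0, w 0, w 1]) (kaehlerForm (b.I x).toLinearMap) (Fin.tail v)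
        + wedge (fun w => covDeriv cov (fun y => kaehlerForm (b.J y).toLinearMap) x
          ![v 0, w 0, w 1]) (kaehlerForm (b.J x).toLinearMap) (Fin.tail v)
        + wedge (fun w => covDeriv cov (fun y => kaehlerForm (b.K y).toLinearMap) x
          ![v 0, w 0, w 1]) (kaehlerForm (b.K x).toLinearMap) (Fin.tail v)) := by
  obtain ⟨dI, eI⟩ := covDeriv_wedge_kaehlerForm (cov := cov) b.smooth_I hU hx v
  obtain ⟨dJ, eJ⟩ := covDeriv_wedge_kaehlerForm (cov := cov) b.smooth_J hU hx v
  obtain ⟨dK, eK⟩ := covDeriv_wedge_kaehlerForm (cov := cov) b.smooth_K hU hx v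
  rw [mul_add, mul_add, ← eI, ← eJ, ← eK, covDeriv, covDeriv, covDeriv, covDeriv]
  have e : (fun y => Q.fundamentalForm y fun i => extendField (v i.succ) y) =ᶠ[𝓝 x]
      (fun y => wedge (kaehlerForm (b.I y).toLinearMap) (kaehlerForm (b.I y).toLinearMap)
          fun i => extendField (v i.succ) y)
        + (fun y => wedge (kaehlerForm (b.J y).toLinearMap) (kaehlerForm (b.J y).toLinearMap)
          fun i => extendField (v i.succ) y)
        + fun y => wedge (kaehlerForm (b.K y).toLinearMap) (kaehlerForm (b.K y).toLinearMap)
          fun i => extendField (v i.succ) y := by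
    filter_upwards [hU.mem_nhds hx] with y hy
    rw [Q.fundamentalForm_eq b hy]
    rfl
  have e' : ∀ w, Q.fundamentalForm x w =
      wedge (kaehlerForm (b.I x).toLinearMap) (kaehlerForm (b.I x).toLinearMap) w
      + wedge (kaehlerForm (b.J x).toLinearMap) (kaehlerForm (b.J x).toLinearMap) w
      + wedge (kaehlerForm (b.K x).toLinearMap) (kaehlerForm (b.K x).toLinearMap) w := by
    intro w
    rw [Q.fundamentalForm_eq b hx]
    rfl
  rw [mvfderiv_congr e, mvfderiv_add (dI.add dJ) dK, mvfderiv_add dI dJ]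
  simp only [e', Finset.sum_add_distrib, add_apply]
  ring

set_option maxHeartbeats 1000000 in
/-- At each point the derivative of the fundamental form is determined by three trilinear maps
whose mutual relations are governed by the Gray–Hervella types. -/
theorem exists_trilinear (hn : 1 < n) (hcov : IsLeviCivita cov)
    (Q : AlmostQuaternionHermitian n M) {U : Set M} (hU : IsOpen U) (b : AdaptedBasis Q.bundle U)
    {CI CJ : Set GHType} (hI : HasHermitianType cov U b.I CI) (hJ : HasHermitianType cov U b.J CJ)
    (x : M) (hx : x ∈ U) :
    ∃ X Y Z : Tri (TangentSpace (𝓡 (4 * n)) x),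
      (X ∈ (b.triple x hx).hSym ∧ Y ∈ (b.triple x hx).hSym ∧ Z ∈ (b.triple x hx).hSym) ∧
      (∀ C, HasHermitianType cov U b.I C → (b.triple x hx).HermitianRel Y Z C) ∧
      (∀ C, HasHermitianType cov U b.J C → (b.triple x hx).HermitianRel Z X C) ∧
      (∀ C, HasHermitianType cov U b.K C → (b.triple x hx).HermitianRel X Y C) ∧
      ∀ C, (∀ w, (b.triple x hx).TypeCond X Y Z C w) → ∃ t ∈ (b.triple x hx).quatClass C,
        ∀ v, t v = (covDeriv cov Q.fundamentalForm x v : ℂ) := by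
  set T := b.triple x hx with hT
  have h4 : 4 < Module.finrank ℝ (TangentSpace (𝓡 (4 * n)) x) := by
    rw [finrank_tangentSpace]
    omega
  -- `covDeriv` is a priori only a function of the vectors; the type hypotheses on I and J supply
  -- multilinear maps representing it.
  obtain ⟨aI, haI, eI⟩ := hI x hx
  obtain ⟨aJ, haJ, eJ⟩ := hJ x hx
  have sI : aI ∈ ghSpace T.I := Triple.ghClass_le_ghSpace haI
  have sJ : aJ ∈ ghSpace T.J := Triple.ghClass_le_ghSpace haJ
  -- No type hypothesis on K is available in general, so its tensor is built from those of I and J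
  -- by the Leibniz rule.
  have eK : ∀ u v w, T.compForm aI aJ ![u, v, w] =
      covDeriv cov (fun y => kaehlerForm (b.K y).toLinearMap) x ![u, v, w] := by
    intro u v w
    rw [Triple.compForm_apply, covDeriv_kaehlerForm_comp hcov b.smooth_I b.smooth_J hU b.IJ
      (fun y hy => (b.triple y hy).inner_I_left) hx, ← eI, ← eJ, sI.1]
    rfl
  have sK : ∀ u v w, T.compForm aI aJ ![u, v, w] = -T.compForm aI aJ ![u, w, v] := by
    intro u v w
    rw [eK, eK]
    exact covDeriv_kaehlerForm_skew hU (fun y hy => (b.triple y hy).inner_K_left) hx u v w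
  obtain ⟨X, Y, Z, hm, rI, rJ, rK, hC⟩ :=
    Triple.exists_trilinear h4 sI sJ sK (Triple.compForm_apply aI aJ)
  -- The representing tensor is determined by its values, so the same X, Y, Z serve for every type
  -- condition.
  have uI : ∀ C, HasHermitianType cov U b.I C → aI ∈ ghClass T.I C := by
    intro C h
    obtain ⟨t, ht, et⟩ := h x hx
    have : t = aI := MultilinearMap.ext fun v => (et v).trans (eI v).symm
    exact this ▸ ht
  have uJ : ∀ C, HasHermitianType cov U b.J C → aJ ∈ ghClass T.J C := by
    intro C h
    obtain ⟨t, ht, et⟩ := h x hx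
    have : t = aJ := MultilinearMap.ext fun v => (et v).trans (eJ v).symm
    exact this ▸ ht
  have uK : ∀ C, HasHermitianType cov U b.K C → T.compForm aI aJ ∈ ghClass T.K C := by
    intro C h
    obtain ⟨t, ht, et⟩ := h x hx
    have : t = T.compForm aI aJ := by
      refine MultilinearMap.ext fun v => ?_
      have ev : v = ![v 0, v 1, v 2] := by funext i; fin_cases i <;> rfl
      rw [et, ev, eK]
    exact this ▸ ht
  have uC : ∀ C, (∀ w, T.TypeCond X Y Z C w) → ∃ t ∈ T.quatClass C,
      ∀ v, t v = (covDeriv cov Q.fundamentalForm x v : ℂ) := by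
    intro C h
    obtain ⟨t, ht, et⟩ := hC C h
    refine ⟨t, ht, fun v => ?_⟩
    rw [et, covDeriv_fundamentalForm Q hU b hx]
    simp only [eI, eJ, eK]
    rfl
  exact ⟨X, Y, Z, hm, fun C h => rI C (uI C h), fun C h => rJ C (uJ C h),
    fun C h => rK C (uK C h), uC⟩

end Manifold

end AQH

/-! ### The fourteen implications. -/

set_option maxHeartbeats 1000000 in
open AQH GHType EType HType in
theorem theorem5p4 {n : ℕ} (hn : 1 < n) {M : Type*} [TopologicalSpace M]
    [ChartedSpace (EuclideanSpace ℝ (Fin (4 * n))) M] [IsManifold (𝓡 (4 * n)) ∞ M]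
    [RiemannianBundle (fun x : M => TangentSpace (𝓡 (4 * n)) x)]
    [IsContMDiffRiemannianBundle (𝓡 (4 * n)) ∞ (EuclideanSpace ℝ (Fin (4 * n)))
      (fun x : M => TangentSpace (𝓡 (4 * n)) x)]
    (cov : CovariantDerivative (𝓡 (4 * n)) (EuclideanSpace ℝ (Fin (4 * n)))
      (fun x : M => TangentSpace (𝓡 (4 * n)) x))
    (hcov : IsLeviCivita cov)
    (Q : AlmostQuaternionHermitian n M) (U : Set M) (hU : IsOpen U)
    (b : AdaptedBasis Q.bundle U) :
    -- (i)
    ((HasHermitianType cov U b.I {W₁, W₄} ∧ HasHermitianType cov U b.J {W₂, W₄}) ∨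
        (HasHermitianType cov U b.I {W₁, W₂, W₄} ∧ HasHermitianType cov U b.J {W₁, W₂, W₄} ∧
          HasHermitianType cov U b.K {W₁, W₂, W₄}) →
      HasQuaternionicType cov Q b ({E} ×ˢ {S₃, H})) ∧
    -- (ii)
    (HasHermitianType cov U b.I {W₁, W₃, W₄} ∧ HasHermitianType cov U b.J {W₁, W₃, W₄} →
      HasQuaternionicType cov Q b ({Λ₃, E} ×ˢ {S₃, H} ∪ {(K, H)})) ∧
    -- (iii)
    (HasHermitianType cov U b.I {W₂, W₃, W₄} ∧ HasHermitianType cov U b.J {W₂, W₃, W₄} →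
      HasQuaternionicType cov Q b ({K, E} ×ˢ {S₃, H} ∪ {(Λ₃, H)})) ∧
    -- (iv)
    (∀ c ∈ ({W₂, W₃} : Set GHType),
      HasHermitianType cov U b.I {W₁, W₄} ∧ HasHermitianType cov U b.J {W₁, c, W₄} →
        HasQuaternionicType cov Q b ({Λ₃, E} ×ˢ {S₃, H})) ∧
    -- (v)
    (∀ c ∈ ({W₁, W₃} : Set GHType),
      HasHermitianType cov U b.I {W₂, W₄} ∧ HasHermitianType cov U b.J {W₂, c, W₄} →
        HasQuaternionicType cov Q b ({K, E} ×ˢ {S₃, H})) ∧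
    -- (vi)
    (HasHermitianType cov U b.I {W₃, W₄} ∧ HasHermitianType cov U b.J {W₃, W₄} →
      HasQuaternionicType cov Q b ({Λ₃, K, E} ×ˢ {H})) ∧
    -- (vii)
    (HasHermitianType cov U b.I {W₁} ∧ HasHermitianType cov U b.J {W₁, W₃} ∧
        HasHermitianType cov U b.K {W₁, W₃} →
      HasQuaternionicType cov Q b ({Λ₃} ×ˢ {S₃, H})) ∧
    -- (viii)
    (HasHermitianType cov U b.I {W₂} ∧ HasHermitianType cov U b.J {W₂, W₃} ∧
        HasHermitianType cov U b.K {W₂, W₃} →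
      HasQuaternionicType cov Q b ({K} ×ˢ {S₃, H})) ∧
    -- (ix)
    (HasHermitianType cov U b.I {W₁, W₃} ∧ HasHermitianType cov U b.J {W₁, W₃} ∧
        HasHermitianType cov U b.K {W₁, W₃} →
      HasQuaternionicType cov Q b ({Λ₃} ×ˢ {S₃, H} ∪ {K, E} ×ˢ {H})) ∧
    -- (x)
    (HasHermitianType cov U b.I {W₂, W₃} ∧ HasHermitianType cov U b.J {W₂, W₃} ∧
        HasHermitianType cov U b.K {W₂, W₃} →
      HasQuaternionicType cov Q b ({K} ×ˢ {S₃, H} ∪ {Λ₃, E} ×ˢ {H})) ∧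
    -- (xi)
    ((HasHermitianType cov U b.I {W₁} ∧ HasHermitianType cov U b.J {W₂, W₃} ∧
          HasHermitianType cov U b.K {W₁, W₂, W₃}) ∨
        (HasHermitianType cov U b.I {W₂} ∧ HasHermitianType cov U b.J {W₁, W₃} ∧
          HasHermitianType cov U b.K {W₁, W₂, W₃}) ∨
        (HasHermitianType cov U b.I {W₁, W₂} ∧ HasHermitianType cov U b.J {W₁, W₃} ∧
          HasHermitianType cov U b.K {W₂, W₃}) →
      HasQuaternionicType cov Q b ({Λ₃, K} ×ˢ {S₃, H})) ∧
    -- (xii)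
    (HasHermitianType cov U b.I {W₁, W₃} ∧ HasHermitianType cov U b.J {W₂, W₃} ∧
        HasHermitianType cov U b.K {W₁, W₂, W₃} →
      HasQuaternionicType cov Q b ({Λ₃, K} ×ˢ {S₃, H} ∪ {(E, H)})) ∧
    -- (xiii)
    (n = 2 → HasHermitianType cov U b.I {W₁, W₃} ∧ HasHermitianType cov U b.J {W₁, W₂, W₃} ∧
        HasHermitianType cov U b.K {W₂, W₄} →
      HasQuaternionicType cov Q b ({K} ×ˢ {S₃, H} ∪ {(E, S₃)})) ∧
    -- (xiv)
    (n = 2 → HasHermitianType cov U b.I {W₁, W₃} ∧ HasHermitianType cov U b.J {W₁, W₃} ∧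
        HasHermitianType cov U b.K {W₄} →
      HasQuaternionicType cov Q b {(E, S₃)}) := by
  refine ⟨?_, ?_, ?_, ?_, ?_, ?_, ?_, ?_, ?_, ?_, ?_, ?_, ?_, ?_⟩
  · rintro (⟨hI, hJ⟩ | ⟨hI, hJ, hK⟩) x hx
    · obtain ⟨X, Y, Z, hm, rI, rJ, rK, hΩ⟩ := exists_trilinear hn hcov Q hU b hI hJ x hx
      replace rI := rI _ hI
      replace rJ := rJ _ hJ
      refine hΩ _ fun w => ?_
      cases w
      -- For ω_J both 𝒲₁ and 𝒲₃ are missing, so the Λ³₀E-parts of X and Z are equal and opposite;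
      -- for ω_I the missing 𝒲₃ then disposes of Y.
      · exact .of_eq_neg' (rJ.lam_eq (by simp)) (rJ.lam_neg (by simp))
          (rI.lam_neg (by simp))
      · exact .of_eq_neg (rI.k_eq (by simp)) (rI.k_neg (by simp))
          (.inr (rJ.k_neg (by simp)))
      · exact .of_mem (by simp) (by simp)
    · obtain ⟨X, Y, Z, hm, rI, rJ, rK, hΩ⟩ := exists_trilinear hn hcov Q hU b hI hJ x hx
      replace rI := rI _ hI
      replace rJ := rJ _ hJ
      replace rK := rK _ hK
      refine hΩ _ fun w => ?_
      cases w
      · exact .of_neg (rI.lam_neg (by simp)) (rJ.lam_neg (by simp)) (rK.lam_neg (by simp))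
      · exact .of_neg (rI.k_neg (by simp)) (rJ.k_neg (by simp)) (rK.k_neg (by simp))
      · exact .of_mem (by simp) (by simp)
  · rintro ⟨hI, hJ⟩ x hx
    obtain ⟨X, Y, Z, hm, rI, rJ, rK, hΩ⟩ := exists_trilinear hn hcov Q hU b hI hJ x hx
    replace rI := rI _ hI
    replace rJ := rJ _ hJ
    refine hΩ _ fun w => ?_
    cases w
    · exact .of_mem (by simp) (by simp)
    -- 𝒲₂ is missing for both forms, so the three K-parts coincide and only KH can occur.
    · exact .of_eq (by simp) ((rJ.k_eq (by simp)).trans (rI.k_eq (by simp)))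
          (rI.k_eq (by simp)).symm
    · exact .of_mem (by simp) (by simp)
  · rintro ⟨hI, hJ⟩ x hx
    obtain ⟨X, Y, Z, hm, rI, rJ, rK, hΩ⟩ := exists_trilinear hn hcov Q hU b hI hJ x hx
    replace rI := rI _ hI
    replace rJ := rJ _ hJ
    refine hΩ _ fun w => ?_
    cases w
    · exact .of_eq (by simp) ((rJ.lam_eq (by simp)).trans (rI.lam_eq (by simp)))
          (rI.lam_eq (by simp)).symm
    · exact .of_mem (by simp) (by simp)
    · exact .of_mem (by simp) (by simp)
  · rintro c (rfl | rfl) ⟨hI, hJ⟩ x hx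
    · obtain ⟨X, Y, Z, hm, rI, rJ, rK, hΩ⟩ := exists_trilinear hn hcov Q hU b hI hJ x hx
      replace rI := rI _ hI
      replace rJ := rJ _ hJ
      refine hΩ _ fun w => ?_
      cases w
      · exact .of_mem (by simp) (by simp)
      · exact .of_eq_neg (rI.k_eq (by simp)) (rI.k_neg (by simp))
          (.inr (rJ.k_neg (by simp)))
      · exact .of_mem (by simp) (by simp)
    · obtain ⟨X, Y, Z, hm, rI, rJ, rK, hΩ⟩ := exists_trilinear hn hcov Q hU b hI hJ x hx
      replace rI := rI _ hI
      replace rJ := rJ _ hJ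
      refine hΩ _ fun w => ?_
      cases w
      · exact .of_mem (by simp) (by simp)
      · exact .of_eq_neg (rI.k_eq (by simp)) (rI.k_neg (by simp))
          (.inl (rJ.k_eq (by simp)))
      · exact .of_mem (by simp) (by simp)
  · rintro c (rfl | rfl) ⟨hI, hJ⟩ x hx
    · obtain ⟨X, Y, Z, hm, rI, rJ, rK, hΩ⟩ := exists_trilinear hn hcov Q hU b hI hJ x hx
      replace rI := rI _ hI
      replace rJ := rJ _ hJ
      refine hΩ _ fun w => ?_
      cases w
      · exact .of_eq_neg (rI.lam_eq (by simp)) (rI.lam_neg (by simp))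
          (.inr (rJ.lam_neg (by simp)))
      · exact .of_mem (by simp) (by simp)
      · exact .of_mem (by simp) (by simp)
    · obtain ⟨X, Y, Z, hm, rI, rJ, rK, hΩ⟩ := exists_trilinear hn hcov Q hU b hI hJ x hx
      replace rI := rI _ hI
      replace rJ := rJ _ hJ
      refine hΩ _ fun w => ?_
      cases w
      · exact .of_eq_neg (rI.lam_eq (by simp)) (rI.lam_neg (by simp))
          (.inl (rJ.lam_eq (by simp)))
      · exact .of_mem (by simp) (by simp)
      · exact .of_mem (by simp) (by simp)
  · rintro ⟨hI, hJ⟩ x hx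
    obtain ⟨X, Y, Z, hm, rI, rJ, rK, hΩ⟩ := exists_trilinear hn hcov Q hU b hI hJ x hx
    replace rI := rI _ hI
    replace rJ := rJ _ hJ
    refine hΩ _ fun w => ?_
    cases w
    · exact .of_eq (by simp) ((rJ.lam_eq (by simp)).trans (rI.lam_eq (by simp)))
          (rI.lam_eq (by simp)).symm
    · exact .of_eq (by simp) ((rJ.k_eq (by simp)).trans (rI.k_eq (by simp)))
          (rI.k_eq (by simp)).symm
    -- Both 𝒲₁ and 𝒲₂ are missing for I and for J; the two trace relations together make the E-parts
    -- equal as well.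
    · exact .of_eq (by simp) ((rJ.proj_E_eq (by simp) (by simp)).trans
          (rI.proj_E_eq (by simp) (by simp))) (rI.proj_E_eq (by simp) (by simp)).symm
  · rintro ⟨hI, hJ, hK⟩ x hx
    obtain ⟨X, Y, Z, hm, rI, rJ, rK, hΩ⟩ := exists_trilinear hn hcov Q hU b hI hJ x hx
    replace rI := rI _ hI
    replace rJ := rJ _ hJ
    replace rK := rK _ hK
    -- 𝒲₄ is missing for all three forms: three sign changes around the triangle annihilate every
    -- `tr₁₂`, and the E-part then depends on `tr₂₃` alone.
    have hp := Triple.tr₁₂_eq_zero_of_neg (rI.tr_four (by simp)) (rJ.tr_four (by simp))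
      (rK.tr_four (by simp))
    have h4 : 4 < Module.finrank ℝ (TangentSpace (𝓡 (4 * n)) x) := by
      rw [finrank_tangentSpace]
      omega
    refine hΩ _ fun w => ?_
    cases w
    · exact .of_mem (by simp) (by simp)
    · exact .of_eq_neg (rI.k_eq (by simp)) (rI.k_neg (by simp))
          (.inl (rJ.k_eq (by simp)))
    · exact .of_traces hp (rI.tr₂₃_eq hp.2.1 hp.2.2 (.inr (by simp)))
          (rI.tr₂₃_neg h4 hp.2.1 hp.2.2 (by simp)) (rJ.tr₂₃_eq hp.2.2 hp.1 (.inr (by simp)))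
  · rintro ⟨hI, hJ, hK⟩ x hx
    obtain ⟨X, Y, Z, hm, rI, rJ, rK, hΩ⟩ := exists_trilinear hn hcov Q hU b hI hJ x hx
    replace rI := rI _ hI
    replace rJ := rJ _ hJ
    replace rK := rK _ hK
    have hp := Triple.tr₁₂_eq_zero_of_neg (rI.tr_four (by simp)) (rJ.tr_four (by simp))
      (rK.tr_four (by simp))
    have h4 : 4 < Module.finrank ℝ (TangentSpace (𝓡 (4 * n)) x) := by
      rw [finrank_tangentSpace]
      omega
    refine hΩ _ fun w => ?_
    cases w
    · exact .of_eq_neg (rI.lam_eq (by simp)) (rI.lam_neg (by simp))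
          (.inl (rJ.lam_eq (by simp)))
    · exact .of_mem (by simp) (by simp)
    · exact .of_traces hp (rI.tr₂₃_eq hp.2.1 hp.2.2 (.inl (by simp)))
          (rI.tr₂₃_neg h4 hp.2.1 hp.2.2 (by simp)) (rJ.tr₂₃_eq hp.2.2 hp.1 (.inl (by simp)))
  · rintro ⟨hI, hJ, hK⟩ x hx
    obtain ⟨X, Y, Z, hm, rI, rJ, rK, hΩ⟩ := exists_trilinear hn hcov Q hU b hI hJ x hx
    replace rI := rI _ hI
    replace rJ := rJ _ hJ
    replace rK := rK _ hK
    have hp := Triple.tr₁₂_eq_zero_of_neg (rI.tr_four (by simp)) (rJ.tr_four (by simp))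
      (rK.tr_four (by simp))
    refine hΩ _ fun w => ?_
    cases w
    · exact .of_mem (by simp) (by simp)
    · exact .of_eq (by simp) ((rJ.k_eq (by simp)).trans (rI.k_eq (by simp)))
          (rI.k_eq (by simp)).symm
    · exact .of_traces_eq (by simp) hp (rI.tr₂₃_eq hp.2.1 hp.2.2 (.inr (by simp)))
          (rJ.tr₂₃_eq hp.2.2 hp.1 (.inr (by simp)))
  · rintro ⟨hI, hJ, hK⟩ x hx
    obtain ⟨X, Y, Z, hm, rI, rJ, rK, hΩ⟩ := exists_trilinear hn hcov Q hU b hI hJ x hx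
    replace rI := rI _ hI
    replace rJ := rJ _ hJ
    replace rK := rK _ hK
    have hp := Triple.tr₁₂_eq_zero_of_neg (rI.tr_four (by simp)) (rJ.tr_four (by simp))
      (rK.tr_four (by simp))
    refine hΩ _ fun w => ?_
    cases w
    · exact .of_eq (by simp) ((rJ.lam_eq (by simp)).trans (rI.lam_eq (by simp)))
          (rI.lam_eq (by simp)).symm
    · exact .of_mem (by simp) (by simp)
    · exact .of_traces_eq (by simp) hp (rI.tr₂₃_eq hp.2.1 hp.2.2 (.inl (by simp)))
          (rJ.tr₂₃_eq hp.2.2 hp.1 (.inl (by simp)))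
  · rintro (⟨hI, hJ, hK⟩ | ⟨hI, hJ, hK⟩ | ⟨hI, hJ, hK⟩) x hx
    · obtain ⟨X, Y, Z, hm, rI, rJ, rK, hΩ⟩ := exists_trilinear hn hcov Q hU b hI hJ x hx
      replace rI := rI _ hI
      replace rJ := rJ _ hJ
      replace rK := rK _ hK
      have hp := Triple.tr₁₂_eq_zero_of_neg (rI.tr_four (by simp)) (rJ.tr_four (by simp))
        (rK.tr_four (by simp))
      have h4 : 4 < Module.finrank ℝ (TangentSpace (𝓡 (4 * n)) x) := by
        rw [finrank_tangentSpace]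
        omega
      refine hΩ _ fun w => ?_
      cases w
      · exact .of_mem (by simp) (by simp)
      · exact .of_mem (by simp) (by simp)
      · exact .of_traces hp (rI.tr₂₃_eq hp.2.1 hp.2.2 (.inr (by simp)))
          (rI.tr₂₃_neg h4 hp.2.1 hp.2.2 (by simp)) (rJ.tr₂₃_eq hp.2.2 hp.1 (.inl (by simp)))
    · obtain ⟨X, Y, Z, hm, rI, rJ, rK, hΩ⟩ := exists_trilinear hn hcov Q hU b hI hJ x hx
      replace rI := rI _ hI
      replace rJ := rJ _ hJ
      replace rK := rK _ hK
      have hp := Triple.tr₁₂_eq_zero_of_neg (rI.tr_four (by simp)) (rJ.tr_four (by simp))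
        (rK.tr_four (by simp))
      have h4 : 4 < Module.finrank ℝ (TangentSpace (𝓡 (4 * n)) x) := by
        rw [finrank_tangentSpace]
        omega
      refine hΩ _ fun w => ?_
      cases w
      · exact .of_mem (by simp) (by simp)
      · exact .of_mem (by simp) (by simp)
      · exact .of_traces hp (rI.tr₂₃_eq hp.2.1 hp.2.2 (.inl (by simp)))
          (rI.tr₂₃_neg h4 hp.2.1 hp.2.2 (by simp)) (rJ.tr₂₃_eq hp.2.2 hp.1 (.inr (by simp)))
    · obtain ⟨X, Y, Z, hm, rI, rJ, rK, hΩ⟩ := exists_trilinear hn hcov Q hU b hI hJ x hx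
      replace rI := rI _ hI
      replace rJ := rJ _ hJ
      replace rK := rK _ hK
      have hp := Triple.tr₁₂_eq_zero_of_neg (rI.tr_four (by simp)) (rJ.tr_four (by simp))
        (rK.tr_four (by simp))
      have h4 : 4 < Module.finrank ℝ (TangentSpace (𝓡 (4 * n)) x) := by
        rw [finrank_tangentSpace]
        omega
      refine hΩ _ fun w => ?_
      cases w
      · exact .of_mem (by simp) (by simp)
      · exact .of_mem (by simp) (by simp)
      -- The type of ω_I allows both 𝒲₁ and 𝒲₂, so equality of `tr₂₃` for Y and Z is obtained
      -- through X, from the relations of ω_K and ω_J; the missing 𝒲₃ for ω_I gives the opposite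
      -- sign.
      · exact .of_traces hp ((rK.tr₂₃_eq hp.1 hp.2.1 (.inl (by simp))).trans (rJ.tr₂₃_eq hp.2.2 hp.1 (.inr (by simp)))).symm
          (rI.tr₂₃_neg h4 hp.2.1 hp.2.2 (by simp)) (rJ.tr₂₃_eq hp.2.2 hp.1 (.inr (by simp)))
  · rintro ⟨hI, hJ, hK⟩ x hx
    obtain ⟨X, Y, Z, hm, rI, rJ, rK, hΩ⟩ := exists_trilinear hn hcov Q hU b hI hJ x hx
    replace rI := rI _ hI
    replace rJ := rJ _ hJ
    replace rK := rK _ hK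
    have hp := Triple.tr₁₂_eq_zero_of_neg (rI.tr_four (by simp)) (rJ.tr_four (by simp))
      (rK.tr_four (by simp))
    refine hΩ _ fun w => ?_
    cases w
    · exact .of_mem (by simp) (by simp)
    · exact .of_mem (by simp) (by simp)
    · exact .of_traces_eq (by simp) hp (rI.tr₂₃_eq hp.2.1 hp.2.2 (.inr (by simp)))
          (rJ.tr₂₃_eq hp.2.2 hp.1 (.inl (by simp)))
  · rintro h2 ⟨hI, hJ, hK⟩ x hx
    obtain ⟨X, Y, Z, hm, rI, rJ, rK, hΩ⟩ := exists_trilinear hn hcov Q hU b hI hJ x hx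
    replace rI := rI _ hI
    replace rJ := rJ _ hJ
    replace rK := rK _ hK
    have h8 : Module.finrank ℝ (TangentSpace (𝓡 (4 * n)) x) = 8 := by
      rw [finrank_tangentSpace, h2]
    refine hΩ _ fun w => ?_
    cases w
    · exact .of_dim_eight h8 hm.1 hm.2.1 hm.2.2
    · exact .of_mem (by simp) (by simp)
    -- The five trace relations used come from 𝒲₂ and 𝒲₄ missing for ω_I, 𝒲₄ missing for ω_J, and 𝒲₁
    -- and 𝒲₃ missing for ω_K.
    · exact .of_trace_dim_eight h8 (by simp) (rI.tr_four (by simp)) (rJ.tr_four (by simp))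
          (rI.tr_two (by simp)) (rK.tr_one (by simp)) (rK.tr_three (by simp))
  · rintro h2 ⟨hI, hJ, hK⟩ x hx
    obtain ⟨X, Y, Z, hm, rI, rJ, rK, hΩ⟩ := exists_trilinear hn hcov Q hU b hI hJ x hx
    replace rI := rI _ hI
    replace rJ := rJ _ hJ
    replace rK := rK _ hK
    have h8 : Module.finrank ℝ (TangentSpace (𝓡 (4 * n)) x) = 8 := by
      rw [finrank_tangentSpace, h2]
    refine hΩ _ fun w => ?_
    cases w
    · exact .of_dim_eight h8 hm.1 hm.2.1 hm.2.2
    -- A single sign change around the triangle, coming from 𝒲₃ missing for ω_K, already kills the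
    -- K-parts.
    · exact .of_eq_of_neg (rI.k_eq (by simp)) (rJ.k_eq (by simp)) (rK.k_neg (by simp))
    · exact .of_trace_dim_eight h8 (by simp) (rI.tr_four (by simp)) (rJ.tr_four (by simp))
          (rI.tr_two (by simp)) (rK.tr_one (by simp)) (rK.tr_three (by simp))

end
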